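/- A combinatorial map is a finite connected graph $\Gamma$ (parallel edges allowed) whose edges are coloured red, green and black so that each colour class is a perfect matching and the union of the red and the green edges is a disjoint union of $4$-cycles, called the quadrilaterals, or edges, of the map; $E(\Gamma)$ denotes the set of quadrilaterals. An isomorphism of combinatorial maps is a colour-preserving isomorphism of graphs. The $\Delta$-matroid $D_\Gamma$ of $\Gamma$ has ground set $E(\Gamma)$. Its feasible sets are the sets $F$ for which there is a Hamilton cycle of $\Gamma$ that contains all black edges and whose green edges are exactly the green edges of the quadrilaterals in $F$. The lower (upper) matroid of $D_\Gamma$ is the matroid on $E(\Gamma)$ whose bases are the feasible sets of least (largest) cardinality. A matroid $N$ with rank function $r$ on a finite set $E$ is called $3$-connected (in the sense of Tutte) if for $k=1,2$ every partition $E = X \sqcup Y$ with $|X|,|Y|\ge k$ satisfies $r(X)+r(Y)\ge r(E)+k$. **Theorem.** Let $M$ be a combinatorial map such that the lower and the upper matroid of its $\Delta$-matroid $D_M$ are both $3$-connected. Then $M$ is determined by $D_M$: if $M'$ is any combinatorial map and $\varphi\colon E(M)\to E(M')$ is an isomorphism from $D_M$ to $D_{M'}$ (a bijection such that $F\subseteq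 E(M)$ is feasible if and only if $\varphi(F)$ is feasible), then there is an isomorphism of combinatorial maps $M\to M'$ which induces $\varphi$ on the quadrilaterals. -/

import Mathlib

/-! ### Matroid connectivity and Δ-matroids -/

/-- A matroid is `n`-connected (in the sense of Tutte) if it has no `k`-separation with
`1 ≤ k < n`. A `k`-separation is a partition of the ground set into two sets `X`, `Y` with at
least `k` elements each, such that `r X + r Y - r M < k`. -/
def Matroid.IsNConnected {α : Type*} (M : Matroid α) (n : ℕ) : Prop :=
  ∀ k : ℕ, 1 ≤ k → k < n → ∀ X Y : Set α, X ∪ Y = M.E → Disjoint X Y →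
    (k : ℕ∞) ≤ X.encard → (k : ℕ∞) ≤ Y.encard → M.eRank + (k : ℕ∞) ≤ M.eRk X + M.eRk Y

/-- A Δ-matroid with ground set the whole type `E`: a nonempty family of feasible sets that
satisfies the symmetric exchange axiom (where `y = x` is allowed). -/
structure DeltaMatroid (E : Type*) where
  Feasible : Set E → Prop
  exists_feasible : ∃ F, Feasible F
  exchange : ∀ F₁ F₂, Feasible F₁ → Feasible F₂ → ∀ x ∈ symmDiff F₁ F₂,
    ∃ y ∈ symmDiff F₂ F₁, Feasible (symmDiff F₁ {x, y})

namespace DeltaMatroid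

variable {E : Type*} (D : DeltaMatroid E)

/-- Feasible sets of least cardinality. -/
def IsLowerBase (B : Set E) : Prop :=
  D.Feasible B ∧ ∀ F, D.Feasible F → B.ncard ≤ F.ncard

/-- Feasible sets of largest cardinality. -/
def IsUpperBase (B : Set E) : Prop :=
  D.Feasible B ∧ ∀ F, D.Feasible F → F.ncard ≤ B.ncard

theorem exists_isLowerBase : ∃ B, D.IsLowerBase B := by
  classical
  have h : ∃ n, ∃ F, D.Feasible F ∧ F.ncard = n :=
    let ⟨F, hF⟩ := D.exists_feasible
    ⟨_, F, hF, rfl⟩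
  obtain ⟨F, hF, hn⟩ := Nat.find_spec h
  exact ⟨F, hF, fun G hG => hn ▸ Nat.find_min' h ⟨G, hG, rfl⟩⟩

theorem exists_isUpperBase [Finite E] : ∃ B, D.IsUpperBase B := by
  obtain ⟨B, hB, hm⟩ := Set.exists_max_image {F | D.Feasible F} Set.ncard (Set.toFinite _)
    D.exists_feasible
  exact ⟨B, hB, hm⟩

theorem symmDiff_pair_exchange {B : Set E} {x y : E} (hx : x ∈ B) (hy : y ∉ B) :
    symmDiff B {x, y} = insert y (B \ {x}) := by
  ext z
  simp only [Set.mem_symmDiff, Set.mem_insert_iff, Set.mem_singleton_iff, Set.mem_sdiff]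
  constructor
  · rintro (⟨h1, h2⟩ | ⟨h1 | h1, h2⟩)
    · exact Or.inr ⟨h1, fun h => h2 (Or.inl h)⟩
    · exact absurd (h1 ▸ hx) h2
    · exact Or.inl h1
  · rintro (h | ⟨h1, h2⟩)
    · exact Or.inr ⟨Or.inr h, h ▸ hy⟩
    · refine Or.inl ⟨h1, ?_⟩
      rintro (h | h)
      · exact h2 h
      · exact hy (h ▸ h1)

theorem isLowerBase_exchange [Finite E] : Matroid.ExchangeProperty D.IsLowerBase := by
  rintro B₁ B₂ ⟨h1, m1⟩ ⟨h2, m2⟩ x ⟨hx1, hx2⟩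
  obtain ⟨y, hy, hf⟩ := D.exchange B₁ B₂ h1 h2 x (Or.inl ⟨hx1, hx2⟩)
  have hyB : y ∉ B₁ := by
    intro hyB
    have hlt : (symmDiff B₁ {x, y}).ncard < B₁.ncard := by
      apply Set.ncard_lt_ncard _ (Set.toFinite _)
      refine ⟨?_, fun h => ?_⟩
      · rintro z (⟨hz, -⟩ | ⟨hz | hz, -⟩)
        · exact hz
        · exact hz ▸ hx1
        · exact (show z = y from hz) ▸ hyB
      · rcases h hx1 with ⟨-, h⟩ | ⟨-, h⟩
        · exact h (Or.inl rfl)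
        · exact h hx1
    exact absurd (m1 _ hf) (not_le.2 hlt)
  have hy2 : y ∈ B₂ := by
    rcases hy with h | h
    · exact h.1
    · exact absurd h.1 hyB
  refine ⟨y, ⟨hy2, hyB⟩, ?_⟩
  rw [symmDiff_pair_exchange hx1 hyB] at hf
  refine ⟨hf, fun F hF => ?_⟩
  rw [Set.ncard_exchange hyB hx1]
  exact m1 F hF

/-- The lower matroid: its bases are the feasible sets of least cardinality. -/
def lowerMatroid [Finite E] : Matroid E :=
  Matroid.ofIsBaseOfFinite (E := Set.univ) Set.finite_univ D.IsLowerBase D.exists_isLowerBase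
    D.isLowerBase_exchange fun _ _ => Set.subset_univ _

/-- The dual Δ-matroid, whose feasible sets are the complements of the feasible sets. -/
def dual : DeltaMatroid E where
  Feasible F := D.Feasible Fᶜ
  exists_feasible := let ⟨F, hF⟩ := D.exists_feasible; ⟨Fᶜ, by rwa [compl_compl]⟩
  exchange F₁ F₂ h1 h2 x hx := by
    obtain ⟨y, hy, hf⟩ := D.exchange _ _ h1 h2 x (by rwa [compl_symmDiff_compl])
    refine ⟨y, by rwa [compl_symmDiff_compl] at hy, ?_⟩
    have : (symmDiff F₁ {x, y})ᶜ = symmDiff F₁ᶜ {x, y} := by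
      ext z
      simp only [Set.mem_symmDiff, Set.mem_compl_iff]
      by_cases h1 : z ∈ F₁ <;> by_cases h2 : z ∈ ({x, y} : Set E) <;> simp [h1, h2]
    rwa [this]

theorem dual_isLowerBase_iff [Finite E] (B : Set E) :
    D.dual.IsLowerBase Bᶜ ↔ D.IsUpperBase B := by
  have key : ∀ F G : Set E, Fᶜ.ncard ≤ Gᶜ.ncard ↔ G.ncard ≤ F.ncard := by
    intro F G
    have h1 := Set.ncard_add_ncard_compl F
    have h2 := Set.ncard_add_ncard_compl G
    omega
  unfold IsLowerBase IsUpperBase dual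
  simp only [compl_compl]
  refine and_congr_right fun _ => ⟨fun h F hF => ?_, fun h F hF => ?_⟩
  · exact (key _ _).1 (h Fᶜ (by rwa [compl_compl]))
  · have := (key B Fᶜ).2 (h _ hF)
    rwa [compl_compl] at this

theorem isUpperBase_exchange [Finite E] : Matroid.ExchangeProperty D.IsUpperBase := by
  have h : D.IsUpperBase = D.dual.lowerMatroid✶.IsBase := by
    funext B
    rw [Matroid.dual_isBase_iff (Set.subset_univ _), eq_iff_iff, ← dual_isLowerBase_iff,
      Set.compl_eq_univ_sdiff]
    rfl
  rw [h]
  exact D.dual.lowerMatroid✶.isBase_exchange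

/-- The upper matroid: its bases are the feasible sets of largest cardinality. -/
def upperMatroid [Finite E] : Matroid E :=
  Matroid.ofIsBaseOfFinite (E := Set.univ) Set.finite_univ D.IsUpperBase D.exists_isUpperBase
    D.isUpperBase_exchange fun _ _ => Set.subset_univ _

end DeltaMatroid

/-! ### Combinatorial maps -/

/-- The three colours of the edges of a map graph. -/
inductive MapColor
  | red | green | black

/-- A combinatorial map (map graph) with vertex set `V`: a connected multigraph whose edges are
coloured red, green and black so that each colour class is a perfect matching and the union of
the red and the green edges is a disjoint union of 4-cycles. The matching of colour `c` is given
by the fixed-point free involution `mate c`, which sends a vertex to the other end of its edge of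
colour `c`. As `red` and `green` are fixed-point free involutions, the red-green cycle through `v`
is a 4-cycle `v, red v, green (red v), green v` exactly if the two involutions commute at `v` and
`red v ≠ green v`. -/
structure CombinatorialMap (V : Type*) where
  mate : MapColor → V → V
  mate_mate : ∀ c v, mate c (mate c v) = v
  mate_ne : ∀ c v, mate c v ≠ v
  red_ne_green : ∀ v, mate .red v ≠ mate .green v
  red_green_comm : ∀ v, mate .red (mate .green v) = mate .green (mate .red v)
  connected : (SimpleGraph.fromRel fun u v => ∃ c, mate c u = v).Connected

namespace CombinatorialMap

variable {V : Type*} (M : CombinatorialMap V)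

/-- The edges of the map: the red-green cycles (quadrilaterals), that is, the connected components
of the graph formed by the red and the green edges. -/
def Edge : Type _ :=
  (SimpleGraph.fromRel fun u v => M.mate .red u = v ∨ M.mate .green u = v).ConnectedComponent

/-- The quadrilateral through a vertex of the map graph. -/
def quad (v : V) : M.Edge :=
  SimpleGraph.connectedComponentMk _ v

/-- A spanning subgraph of the map graph, given by a set of coloured edges: `v ∈ H.edges c` says
that the edge of colour `c` at `v` belongs to `H`. -/
structure SpanningSubgraph where
  edges : MapColor → Set V
  mate_mem : ∀ c v, v ∈ edges c → M.mate c v ∈ edges c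

namespace SpanningSubgraph

variable {M} (H : M.SpanningSubgraph)

/-- The underlying simple graph (parallel edges are identified). -/
def toSimpleGraph : SimpleGraph V :=
  SimpleGraph.fromRel fun u v => ∃ c, u ∈ H.edges c ∧ M.mate c u = v

/-- `H` contains all the black edges. -/
def IsFullyBlack : Prop :=
  ∀ v, v ∈ H.edges .black

/-- Every vertex has degree two in `H`; parallel edges are counted separately. -/
def IsTwoRegular : Prop :=
  ∀ v, {c | v ∈ H.edges c}.ncard = 2

/-- A Hamilton cycle is a connected 2-regular spanning subgraph. -/
def IsHamiltonCycle : Prop :=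
  H.IsTwoRegular ∧ H.toSimpleGraph.Connected

/-- The quadrilaterals whose green edges belong to `H`. -/
def greenQuads : Set M.Edge :=
  {q | ∀ v, M.quad v = q → v ∈ H.edges .green}

end SpanningSubgraph

/-- The sets of quadrilaterals given by the pairs of green edges in a fully black Hamilton
cycle. -/
def IsFeasible (F : Set M.Edge) : Prop :=
  ∃ H : M.SpanningSubgraph, H.IsFullyBlack ∧ H.IsHamiltonCycle ∧ H.greenQuads = F

/-! The next facts show that the feasible sets form a Δ-matroid. -/

theorem edge_finite [Finite V] : Finite M.Edge :=
  Finite.of_surjective M.quad fun q => q.ind fun v => ⟨v, rfl⟩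

instance [Finite V] : Finite M.Edge := M.edge_finite

theorem quad_surj (q : M.Edge) : ∃ v, M.quad v = q :=
  SimpleGraph.ConnectedComponent.ind (fun v => ⟨v, rfl⟩) q

theorem quad_red (v : V) : M.quad (M.mate .red v) = M.quad v :=
  SimpleGraph.ConnectedComponent.sound (SimpleGraph.Adj.reachable
    (by rw [SimpleGraph.fromRel_adj]; exact ⟨M.mate_ne _ _, Or.inr (Or.inl rfl)⟩))

theorem quad_green (v : V) : M.quad (M.mate .green v) = M.quad v :=
  SimpleGraph.ConnectedComponent.sound (SimpleGraph.Adj.reachable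
    (by rw [SimpleGraph.fromRel_adj]; exact ⟨M.mate_ne _ _, Or.inr (Or.inr rfl)⟩))

theorem reachable_ind {G : SimpleGraph V} {a : V} {P : V → Prop} (ha : P a)
    (h : ∀ u v, G.Adj u v → P u → P v) {v : V} (hv : G.Reachable a v) : P v := by
  rw [SimpleGraph.reachable_iff_reflTransGen] at hv
  induction hv with
  | refl => exact ha
  | tail _ h2 ih => exact h _ _ h2 ih

theorem quad_eq {a v : V} (h : M.quad v = M.quad a) :
    v = a ∨ v = M.mate .red a ∨ v = M.mate .green a ∨ v = M.mate .red (M.mate .green a) := by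
  have hr := SimpleGraph.ConnectedComponent.exact h.symm
  have c := M.red_green_comm
  have i := M.mate_mate
  refine reachable_ind (P := fun v => v = a ∨ v = M.mate .red a ∨ v = M.mate .green a ∨
    v = M.mate .red (M.mate .green a)) (Or.inl rfl) ?_ hr
  intro u v huv hu
  rw [SimpleGraph.fromRel_adj] at huv
  have : v = M.mate .red u ∨ v = M.mate .green u := by
    rcases huv.2 with (h | h) | (h | h)
    · exact Or.inl h.symm
    · exact Or.inr h.symm
    · exact Or.inl (by rw [← h, i])
    · exact Or.inr (by rw [← h, i])
  rcases this with rfl | rfl <;> rcases hu with rfl | rfl | rfl | rfl <;> simp [i, c]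

open Classical in
/-- The non-black neighbour of `v` in the fully black 2-regular subgraph given by `F`. -/
noncomputable def step (F : Set M.Edge) (v : V) : V :=
  if M.quad v ∈ F then M.mate .green v else M.mate .red v

theorem quad_step (F : Set M.Edge) (v : V) : M.quad (M.step F v) = M.quad v := by
  unfold step; split_ifs
  · exact M.quad_green v
  · exact M.quad_red v

theorem step_step (F : Set M.Edge) (v : V) : M.step F (M.step F v) = v := by
  have h := M.quad_step F v
  by_cases hv : M.quad v ∈ F
  · have h2 : M.step F v = M.mate .green v := if_pos hv
    rw [step, if_pos (by rwa [h]), h2, M.mate_mate]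
  · have h2 : M.step F v = M.mate .red v := if_neg hv
    rw [step, if_neg (by rwa [h]), h2, M.mate_mate]

theorem step_ne (F : Set M.Edge) (v : V) : M.step F v ≠ v := by
  unfold step; split_ifs <;> exact M.mate_ne _ _

theorem step_congr {F F' : Set M.Edge} {v : V} (h : M.quad v ∈ F ↔ M.quad v ∈ F') :
    M.step F v = M.step F' v := by
  by_cases hv : M.quad v ∈ F
  · exact (if_pos hv).trans (if_pos (h.1 hv)).symm
  · exact (if_neg hv).trans (if_neg fun h' => hv (h.2 h')).symm

theorem quad_eq_step {F F' : Set M.Edge} {a v : V} (h : M.quad v = M.quad a)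
    (hF : M.quad a ∈ F ↔ M.quad a ∉ F') :
    v = a ∨ v = M.step F a ∨ v = M.step F' a ∨ v = M.step F (M.step F' a) := by
  have h1 := M.quad_eq h
  have c := M.red_green_comm a
  have hq := M.quad_step F' a
  by_cases ha : M.quad a ∈ F
  · have hb := hF.1 ha
    have e1 : M.step F' a = M.mate .red a := if_neg hb
    have e2 : M.step F (M.step F' a) = M.mate .green (M.step F' a) := if_pos (by rwa [hq])
    have e3 : M.step F a = M.mate .green a := if_pos ha
    rw [e2, e1, e3, ← c]; tauto
  · have hb : M.quad a ∈ F' := by tauto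
    have e1 : M.step F' a = M.mate .green a := if_pos hb
    have e2 : M.step F (M.step F' a) = M.mate .red (M.step F' a) := if_neg (by rwa [hq])
    have e3 : M.step F a = M.mate .red a := if_neg ha
    rw [e2, e1, e3]; tauto

/-- The fully black 2-regular subgraph whose green edges are those of the quadrilaterals
in `F`. -/
def sub (F : Set M.Edge) : M.SpanningSubgraph where
  edges
    | .red => {v | M.quad v ∉ F}
    | .green => {v | M.quad v ∈ F}
    | .black => Set.univ
  mate_mem := by
    rintro (_ | _ | _) v hv
    · simpa only [Set.mem_ofPred_eq, quad_red] using hv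
    · simpa only [Set.mem_ofPred_eq, quad_green] using hv
    · trivial

/-- Being in the same component of the subgraph given by `F`. -/
def Joined (F : Set M.Edge) (u v : V) : Prop :=
  (M.sub F).toSimpleGraph.Reachable u v

theorem isFeasible_iff (F : Set M.Edge) : M.IsFeasible F ↔ ∀ u v, M.Joined F u v := by
  constructor
  · rintro ⟨H, hb, ⟨h2, hc⟩, rfl⟩
    have hrg : ∀ v, v ∈ H.edges .red ↔ v ∉ H.edges .green := by
      intro v
      have h := h2 v
      constructor
      · intro hr hg
        have : {c | v ∈ H.edges c} = ({.red, .green, .black} : Set MapColor) := by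
          ext c; cases c <;> simp [hr, hg, hb v]
        rw [this, Set.ncard_eq_three.2 ⟨_, _, _, by simp, by simp, by simp, rfl⟩] at h
        omega
      · intro hg
        by_contra hr
        have : {c | v ∈ H.edges c} = ({.black} : Set MapColor) := by
          ext c; cases c <;> simp [hr, hg, hb v]
        rw [this, Set.ncard_singleton] at h
        omega
    have hgr : ∀ v, v ∈ H.edges .green → M.mate .red v ∈ H.edges .green := by
      intro v hv
      by_contra h
      have := H.mate_mem _ _ ((hrg _).2 h)
      rw [M.mate_mate] at this
      exact (hrg _).1 this hv
    have hg : ∀ v, M.quad v ∈ H.greenQuads ↔ v ∈ H.edges .green := by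
      intro v
      refine ⟨fun h => h v rfl, fun h w hw => ?_⟩
      rcases M.quad_eq hw with rfl | rfl | rfl | rfl
      · exact h
      · exact hgr _ h
      · exact H.mate_mem _ _ h
      · exact hgr _ (H.mate_mem _ _ h)
    have : (M.sub H.greenQuads).edges = H.edges := by
      funext c
      ext v
      cases c
      · exact (not_congr (hg v)).trans (hrg v).symm
      · exact hg v
      · exact ⟨fun _ => hb v, fun _ => trivial⟩
    intro u v
    unfold Joined SpanningSubgraph.toSimpleGraph
    rw [this]
    exact hc.preconnected u v
  · intro h
    refine ⟨M.sub F, fun _ => trivial, ⟨fun v => ?_, ?_⟩, ?_⟩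
    · by_cases hv : M.quad v ∈ F
      · have : {c | v ∈ (M.sub F).edges c} = ({.green, .black} : Set MapColor) := by
          ext c; cases c <;> simp [sub, hv]
        rw [this, Set.ncard_pair (by simp)]
      · have : {c | v ∈ (M.sub F).edges c} = ({.red, .black} : Set MapColor) := by
          ext c; cases c <;> simp [sub, hv]
        rw [this, Set.ncard_pair (by simp)]
    · have := M.connected.nonempty
      exact SimpleGraph.Connected.mk h
    · ext q
      obtain ⟨v, rfl⟩ := M.quad_surj q
      exact ⟨fun hq => hq v rfl, fun hq w hw => by
        change M.quad w ∈ F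
        rwa [hw]⟩

namespace Joined

variable {M} {F F' : Set M.Edge} {a u v w : V}

theorem rfl' : M.Joined F u u := SimpleGraph.Reachable.refl _
theorem symm (h : M.Joined F u v) : M.Joined F v u := SimpleGraph.Reachable.symm h
theorem trans (h : M.Joined F u v) (h' : M.Joined F v w) : M.Joined F u w :=
  SimpleGraph.Reachable.trans h h'

theorem black (F : Set M.Edge) (v : V) : M.Joined F v (M.mate .black v) :=
  SimpleGraph.Adj.reachable (by
    unfold SpanningSubgraph.toSimpleGraph
    rw [SimpleGraph.fromRel_adj]
    exact ⟨(M.mate_ne _ _).symm, Or.inl ⟨.black, trivial, rfl⟩⟩)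

theorem step (F : Set M.Edge) (v : V) : M.Joined F v (M.step F v) :=
  SimpleGraph.Adj.reachable (by
    unfold SpanningSubgraph.toSimpleGraph
    rw [SimpleGraph.fromRel_adj]
    refine ⟨(M.step_ne _ _).symm, Or.inl ?_⟩
    by_cases hv : M.quad v ∈ F
    · exact ⟨.green, hv, (if_pos hv).symm⟩
    · exact ⟨.red, hv, (if_neg hv).symm⟩)

theorem ind {P : V → Prop} (ha : P a) (hb : ∀ v, P v → P (M.mate .black v))
    (hs : ∀ v, P v → P (M.step F v)) (h : M.Joined F a v) : P v := by
  have key : ∀ c u, u ∈ (M.sub F).edges c → P u → P (M.mate c u) := by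
    rintro (_ | _ | _) u hu hP
    · have := hs u hP
      rwa [CombinatorialMap.step, if_neg hu] at this
    · have := hs u hP
      rwa [CombinatorialMap.step, if_pos (show M.quad u ∈ F from hu)] at this
    · exact hb u hP
  refine reachable_ind ha (fun u v huv hu => ?_) h
  unfold SpanningSubgraph.toSimpleGraph at huv
  rw [SimpleGraph.fromRel_adj] at huv
  rcases huv.2 with ⟨c, hc, rfl⟩ | ⟨c, hc, rfl⟩
  · exact key c u hc hu
  · have := key c _ ((M.sub F).mate_mem c v hc) hu
    rwa [M.mate_mate] at this

theorem mono (h : ∀ v, M.Joined F' v (M.step F v)) (huv : M.Joined F u v) : M.Joined F' u v :=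
  ind (P := fun v => M.Joined F' u v) rfl' (fun v hv => hv.trans (black _ v))
    (fun v hv => hv.trans (h v)) huv

end Joined

/-- One turn along the subgraph given by `F`. -/
noncomputable def turn (F : Set M.Edge) (v : V) : V :=
  M.step F (M.mate .black v)

theorem black_turn_ne (F : Set M.Edge) :
    ∀ (k : ℕ) (v : V), M.mate .black ((M.turn F)^[k] v) ≠ v
  | 0, v => M.mate_ne _ v
  | 1, v => by
    intro h
    have h2 : M.turn F v = M.mate .black v := by
      have := congrArg (M.mate .black) h
      rwa [M.mate_mate] at this
    exact M.step_ne F _ h2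
  | k + 2, v => by
    intro h
    apply black_turn_ne F k (M.turn F v)
    rw [Function.iterate_succ_apply', Function.iterate_succ_apply] at h
    have h2 : M.turn F ((M.turn F)^[k] (M.turn F v)) = M.mate .black v := by
      have := congrArg (M.mate .black) h
      rwa [M.mate_mate] at this
    have h3 := congrArg (M.step F) h2
    unfold turn at h3 ⊢
    rwa [M.step_step] at h3

/-- If the two edges of the subgraph at a quadrilateral lie in different components, then swapping
colours there merges these components. -/
theorem Joined.merge [Finite V] {M : CombinatorialMap V} {F F' : Set M.Edge} {a : V}
    (hF : ∀ q, q ≠ M.quad a → (q ∈ F ↔ q ∈ F')) (ha : M.quad a ∈ F ↔ M.quad a ∉ F')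
    (hn : ¬ M.Joined F a (M.step F' a)) {u v : V} (huv : M.Joined F u v) :
    M.Joined F' u v := by
  -- the hypothesis holds at all four corners
  have hcomm : M.step F (M.step F' a) = M.step F' (M.step F a) := by
    have q1 := M.quad_step F a
    have q2 := M.quad_step F' a
    have c := M.red_green_comm a
    by_cases h : M.quad a ∈ F
    · have h' := ha.1 h
      have e1 : M.step F a = M.mate .green a := if_pos h
      have e2 : M.step F' a = M.mate .red a := if_neg h'
      have e3 : M.step F (M.step F' a) = M.mate .green (M.step F' a) := if_pos (by rwa [q2])
      have e4 : M.step F' (M.step F a) = M.mate .red (M.step F a) := if_neg (by rwa [q1])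
      rw [e3, e4, e1, e2, c]
    · have h' : M.quad a ∈ F' := by tauto
      have e1 : M.step F a = M.mate .red a := if_neg h
      have e2 : M.step F' a = M.mate .green a := if_pos h'
      have e3 : M.step F (M.step F' a) = M.mate .red (M.step F' a) := if_neg (by rwa [q2])
      have e4 : M.step F' (M.step F a) = M.mate .green (M.step F a) := if_pos (by rwa [q1])
      rw [e3, e4, e1, e2, c]
  have hall : ∀ w, M.quad w = M.quad a → ¬ M.Joined F w (M.step F' w) := by
    intro w hw h
    rcases M.quad_eq_step hw ha with rfl | rfl | rfl | rfl
    · exact hn h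
    · rw [← hcomm] at h
      exact hn (((Joined.step F a).trans h).trans (Joined.step F _).symm)
    · rw [M.step_step] at h
      exact hn h.symm
    · rw [hcomm, M.step_step, ← hcomm] at h
      exact hn ((Joined.step F a).trans (h.symm.trans (Joined.step F _).symm))
  refine Joined.mono (fun w => ?_) huv
  by_cases hw : M.quad w = M.quad a
  swap
  · rw [M.step_congr (hF _ hw)]
    exact Joined.step F' w
  -- walk around the component of `w` until `M.step F w` is reached
  have hinj : Function.Injective (M.turn F) := by
    intro x y hxy
    have h1 := congrArg (M.step F) hxy
    unfold turn at h1
    rw [M.step_step, M.step_step] at h1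
    have h2 := congrArg (M.mate .black) h1
    rwa [M.mate_mate, M.mate_mate] at h2
  have hper : w ∈ Function.periodicPts (M.turn F) :=
    hinj.mem_periodicPts w
  set n := Function.minimalPeriod (M.turn F) w with hn_def
  have hpos : 0 < n := Function.minimalPeriod_pos_of_mem_periodicPts hper
  have hFw : ∀ k, M.Joined F w ((M.turn F)^[k] w) := by
    intro k
    induction k with
    | zero => exact Joined.rfl'
    | succ k ih =>
      rw [Function.iterate_succ_apply']
      exact (ih.trans (Joined.black F _)).trans (Joined.step F _)
  have hwalk : ∀ k, k < n → M.Joined F' w ((M.turn F)^[k] w) := by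
    intro k
    induction k with
    | zero => exact fun _ => Joined.rfl'
    | succ k ih =>
      intro hk
      have h1 := (ih (by omega)).trans (Joined.black F' _)
      set x := M.mate .black ((M.turn F)^[k] w) with hx
      have hstep : (M.turn F)^[k + 1] w = M.step F x := by
        rw [Function.iterate_succ_apply']; rfl
      rw [hstep]
      have hxa : M.quad x ≠ M.quad a := by
        intro hxa
        have hJ : M.Joined F w x := (hFw k).trans (Joined.black F _)
        have ha' : M.quad w ∈ F ↔ M.quad w ∉ F' := by rwa [hw]
        rcases M.quad_eq_step (hxa.trans hw.symm) ha' with h | h | h | h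
        · exact M.black_turn_ne F k w (hx.symm.trans h)
        · have : (M.turn F)^[k + 1] w = w := by rw [hstep, h, M.step_step]
          exact Function.not_isPeriodicPt_of_pos_of_lt_minimalPeriod (by omega) hk this
        · exact hall w hw (h ▸ hJ)
        · exact hall w hw ((h ▸ hJ).trans (Joined.step F _).symm)
      rw [M.step_congr (hF _ hxa)]
      exact h1.trans (Joined.step F' _)
  have hlast : M.mate .black ((M.turn F)^[n - 1] w) = M.step F w := by
    have h1 : (M.turn F)^[n - 1 + 1] w = w := by
      rw [Nat.sub_add_cancel hpos]
      exact Function.iterate_minimalPeriod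
    rw [Function.iterate_succ_apply'] at h1
    have h2 := congrArg (M.step F) h1
    unfold turn at h2
    rwa [M.step_step] at h2
  rw [← hlast]
  exact (hwalk (n - 1) (by omega)).trans (Joined.black F' _)

theorem exists_isFeasible [Finite V] : ∃ F, M.IsFeasible F := by
  obtain ⟨F, -, hmax⟩ := Set.exists_max_image (Set.univ : Set (Set M.Edge))
    (fun F => {p : V × V | M.Joined F p.1 p.2}.ncard) (Set.toFinite _) ⟨∅, trivial⟩
  refine ⟨F, (M.isFeasible_iff F).2 ?_⟩
  by_contra hcon
  have : ∃ z c, ¬ M.Joined F z (M.mate c z) := by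
    by_contra! h
    refine hcon fun u v => reachable_ind (P := fun v => M.Joined F u v) Joined.rfl'
      (fun x y hxy hx => ?_) (M.connected.preconnected u v)
    rw [SimpleGraph.fromRel_adj] at hxy
    rcases hxy.2 with ⟨c, rfl⟩ | ⟨c, rfl⟩
    · exact hx.trans (h x c)
    · exact hx.trans (h y c).symm
  obtain ⟨z, c, hz⟩ := this
  set F' := symmDiff F {M.quad z} with hF'
  have h1 : ∀ q, q ≠ M.quad z → (q ∈ F ↔ q ∈ F') := by
    intro q hq
    simp [hF', Set.mem_symmDiff, hq]
  have h2 : M.quad z ∈ F ↔ M.quad z ∉ F' := by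
    simp [hF', Set.mem_symmDiff]
  have h3 : M.mate c z = M.step F' z := by
    by_cases hm : M.quad z ∈ F
    · have e : M.step F' z = M.mate .red z := if_neg (h2.1 hm)
      cases c
      · exact e.symm
      · exact absurd ((if_pos hm : M.step F z = M.mate .green z) ▸ Joined.step F z) hz
      · exact absurd (Joined.black F z) hz
    · have e : M.step F' z = M.mate .green z := if_pos (by tauto)
      cases c
      · exact absurd ((if_neg hm : M.step F z = M.mate .red z) ▸ Joined.step F z) hz
      · exact e.symm
      · exact absurd (Joined.black F z) hz
  have hlt : {p : V × V | M.Joined F p.1 p.2}.ncard < {p : V × V | M.Joined F' p.1 p.2}.ncard := by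
    apply Set.ncard_lt_ncard _ (Set.toFinite _)
    refine ⟨fun p hp => Joined.merge h1 h2 (h3 ▸ hz) hp, fun h => hz ?_⟩
    rw [h3]
    exact h (show (z, M.step F' z) ∈ _ from Joined.step F' z)
  exact absurd (hmax F' trivial) (not_le.2 hlt)

theorem isFeasible_exchange [Finite V] (F₁ F₂ : Set M.Edge) (h1 : M.IsFeasible F₁)
    (h2 : M.IsFeasible F₂) (x : M.Edge) (hx : x ∈ symmDiff F₁ F₂) :
    ∃ y ∈ symmDiff F₂ F₁, M.IsFeasible (symmDiff F₁ {x, y}) := by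
  rw [isFeasible_iff] at h1 h2
  set K := symmDiff F₁ {x} with hK
  by_cases hKc : ∀ u v, M.Joined K u v
  · refine ⟨x, by rwa [symmDiff_comm], ?_⟩
    rw [isFeasible_iff, Set.pair_eq_singleton]
    exact hKc
  obtain ⟨a, rfl⟩ := M.quad_surj x
  have hK1 : ∀ q, q ≠ M.quad a → (q ∈ F₁ ↔ q ∈ K) := by
    intro q hq
    simp [hK, Set.mem_symmDiff, hq]
  have hK2 : M.quad a ∈ K ↔ M.quad a ∉ F₁ := by
    simp [hK, Set.mem_symmDiff]
  have hK3 : M.quad a ∈ K ↔ M.quad a ∈ F₂ := by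
    rw [hK2]
    rcases hx with h | h <;> simp [h.1, h.2]
  set a' := M.step F₁ a with ha'
  have hcov : ∀ v, M.Joined K a v ∨ M.Joined K a' v := by
    have hquad : ∀ w, M.quad w = M.quad a → M.Joined K a w ∨ M.Joined K a' w := by
      intro w hw
      have hw' : M.quad w = M.quad a' := by rw [hw, ha', quad_step]
      rcases M.quad_eq_step hw hK2 with h | h | h | h
      · exact Or.inl (h ▸ Joined.rfl')
      · exact Or.inl (h ▸ Joined.step K a)
      · exact Or.inr (h ▸ Joined.rfl')
      · exact Or.inr (h ▸ Joined.step K a')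
    intro v
    refine Joined.ind (F := F₁) (P := fun v => M.Joined K a v ∨ M.Joined K a' v)
      (Or.inl Joined.rfl') ?_ ?_ (h1 a v)
    · exact fun w hw => hw.imp (·.trans (Joined.black K w)) (·.trans (Joined.black K w))
    · intro w hw
      by_cases hwa : M.quad w = M.quad a
      · exact hquad _ (by rw [quad_step, hwa])
      · rw [M.step_congr (hK1 _ hwa)]
        exact hw.imp (·.trans (Joined.step K w)) (·.trans (Joined.step K w))
  have haa : ¬ M.Joined K a a' := by
    intro h
    have hall : ∀ v, M.Joined K a v := fun v => (hcov v).elim id (h.trans ·)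
    exact hKc fun u v => (hall u).symm.trans (hall v)
  obtain ⟨z, hz⟩ : ∃ z, ¬ M.Joined K z (M.step F₂ z) := by
    by_contra! h
    exact hKc fun u v => Joined.mono h (h2 u v)
  have hzK : ¬ (M.quad z ∈ K ↔ M.quad z ∈ F₂) := by
    intro h
    rw [← M.step_congr h] at hz
    exact hz (Joined.step K z)
  have hza : M.quad z ≠ M.quad a := by
    intro h
    rw [h] at hzK
    exact hzK hK3
  set K' := symmDiff K {M.quad z} with hK'
  have g1 : ∀ q, q ≠ M.quad z → (q ∈ K ↔ q ∈ K') := by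
    intro q hq
    simp [hK', Set.mem_symmDiff, hq]
  have g2 : M.quad z ∈ K ↔ M.quad z ∉ K' := by
    simp [hK', Set.mem_symmDiff]
  have g3 : M.step F₂ z = M.step K' z := M.step_congr (by tauto)
  rw [g3] at hz
  have mono : ∀ {u v}, M.Joined K u v → M.Joined K' u v := fun h => Joined.merge g1 g2 hz h
  have hjoin : M.Joined K' a a' := by
    have hs := Joined.step K' z
    rcases hcov z with h | h <;> rcases hcov (M.step K' z) with h' | h'
    · exact absurd (h.symm.trans h') hz
    · exact (mono h).trans (hs.trans (mono h').symm)
    · exact (mono h').trans (hs.symm.trans (mono h).symm)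
    · exact absurd (h.symm.trans h') hz
  have hall : ∀ v, M.Joined K' a v := fun v =>
    (hcov v).elim (mono ·) fun h => hjoin.trans (mono h)
  refine ⟨M.quad z, ?_, ?_⟩
  · rw [← hK1 _ hza] at hzK
    rw [Set.mem_symmDiff]
    clear_value a' K K'
    clear hcov mono hall hjoin
    by_cases e1 : M.quad z ∈ F₁ <;> by_cases e2 : M.quad z ∈ F₂ <;> simp_all
  · have hKK : symmDiff F₁ {M.quad a, M.quad z} = K' := by
      ext q
      simp only [hK', hK, Set.mem_symmDiff, Set.mem_insert_iff, Set.mem_singleton_iff]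
      by_cases e1 : q = M.quad a
      · have e2 : q ≠ M.quad z := fun h => hza (h.symm.trans e1)
        simp [e1, hza.symm]
      · by_cases e2 : q = M.quad z <;> by_cases e3 : q ∈ F₁ <;> simp [e1, e2, e3, hza]
    rw [hKK, isFeasible_iff]
    exact fun u v => (hall u).symm.trans (hall v)

/-- The Δ-matroid of a combinatorial map. Its ground set is the set of quadrilaterals; a set of
quadrilaterals is feasible if it corresponds to the pairs of green edges of a fully black Hamilton
cycle of the map graph. -/
def deltaMatroid [Finite V] : DeltaMatroid M.Edge where
  Feasible := M.IsFeasible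
  exists_feasible := M.exists_isFeasible
  exchange := M.isFeasible_exchange

end CombinatorialMap

/-- An isomorphism of Δ-matroids is a bijection of the ground sets which preserves feasibility in
both directions. -/
structure DeltaMatroid.Iso {E E' : Type*} (D : DeltaMatroid E) (D' : DeltaMatroid E') where
  toEquiv : E ≃ E'
  feasible_iff : ∀ F, D.Feasible F ↔ D'.Feasible (toEquiv '' F)

/-- An isomorphism of combinatorial maps is a colour preserving isomorphism of map graphs. -/
structure CombinatorialMap.Iso {V V' : Type*} (M : CombinatorialMap V)
    (M' : CombinatorialMap V') where
  toEquiv : V ≃ V'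
  map_mate : ∀ c v, toEquiv (M.mate c v) = M'.mate c (toEquiv v)

/-!
The vertices of the map graph are called flags. Call a pair `(ρ, γ)` of functions on the
quadrilaterals admissible if some function `z` on the flags, constant along black edges, changes by
`ρ e` along the red and by `γ e` along the green edges of each quadrilateral `e`. The admissible
pairs form the `labelSpace` `L` over the field with two elements. It is isotropic for the standard
symplectic form, and a set `F` is feasible exactly if no nonzero pair in `L` vanishes along the
edges which `F` selects (`IsLabelling.isFeasibleLabel_iff`). Near a feasible set, `L` is the graph
of a symmetric matrix, whose entries can be read off from the feasible sets at distance one and two;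
hence `D_M` determines `L` (`IsLabelling.labelSpace_eq`). So it has to be shown that `L` determines
the map.

The vertices of the map are the red-black cycles; together with the quadrilaterals they form a graph
`G`. The pairs `(0, γ)` in `L` are the cuts of `G`, and they represent the lower matroid, which is
thus the cycle matroid of `G`. If there are at least four quadrilaterals, 3-connectivity of this
matroid means that `G` is simple and 3-connected (`IsLabelling.isThreeConnected`), and so is the
graph of the second map. By Whitney's theorem (`IsThreeConnected.exists_star_eq`) the two maps have
the same graph. It remains to recover the rotation around each vertex and the way in which an edge
is glued in.

Here the second half of `L` is used. If `(ρ₁, γ₁)` is in `L` and `ρ₂` is a cycle of `G` which meets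
the cycle `ρ₁` only in few vertices, then the number `∑ ρ₂ γ₁`, which depends on `L` only, is a sum
of values of a lift `z` of `(ρ₁, γ₁)` at flags of these vertices
(`IsLabelling.sum_mul_eq_of_disjoint`). For two cycles through a single common vertex `v` it tells
whether they cross at `v`. Menger's theorem supplies enough such pairs of cycles
(`IsThreeConnected.exists_isLinkage`) to conclude that edges which are consecutive at `v` in one map
are consecutive in the other (`IsLabelling.exists_label_black_eq`). This defines the isomorphism on
red and black edges. For the green edges the same number is evaluated for two cycles of a theta
graph through an edge (`IsThreeConnected.exists_isTheta`).

With two or three quadrilaterals, 3-connectivity of the lower and the upper matroid only says that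
neither of them has loops or coloops, and with a single quadrilateral it says nothing. In these
cases the map graph is small enough to be written down (`IsLabelling.isoOver_of_card_eq_one`,
`IsLabelling.isoOver_of_card_eq_two`, `IsLabelling.isoOver_of_card_eq_three`). Exchanging red and
green passes to the dual map.
-/

/-! ### The label space of a map -/

theorem ZMod.two_cases (x : ZMod 2) : x = 0 ∨ x = 1 := by
  revert x; decide

theorem ZMod.two_eq_one_of_ne_zero {x : ZMod 2} (h : x ≠ 0) : x = 1 :=
  (ZMod.two_cases x).resolve_left h

/-- A sum over a finite type vanishes in characteristic two if an involution without fixed points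
preserves the summand. -/
theorem sum_eq_zero_of_involution {V : Type*} [Fintype V] {s : V → V} (hs : ∀ a, s (s a) = a)
    (hne : ∀ a, s a ≠ a) {y : V → ZMod 2} (hy : ∀ a, y (s a) = y a) : ∑ a, y a = 0 := by
  refine Finset.sum_involution (fun a _ => s a) (fun a _ => ?_) (fun a _ _ => hne a)
    (fun _ _ => Finset.mem_univ _) (fun a _ => hs a)
  rw [hy]; exact CharTwo.add_self_eq_zero _

/-- Fredholm alternative for a pair of involutions `b`, `s` over the field with two elements:
the system `z ∘ b = z`, `z ∘ s = z + u` is solvable if `u` is orthogonal to every `r` for which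
`r + r ∘ s` is invariant under `b`. -/
theorem exists_invariant_add_of_orthogonal {V : Type*} [Fintype V] {s b : V → V}
    (hs : ∀ a, s (s a) = a) (hb : ∀ a, b (b a) = a) (u : V → ZMod 2)
    (h : ∀ r : V → ZMod 2, (∀ a, r (b a) + r (s (b a)) = r a + r (s a)) → ∑ a, r a * u a = 0) :
    ∃ z : V → ZMod 2, (∀ a, z (b a) = z a) ∧ ∀ a, z (s a) = z a + u a := by
  classical
  let T : (V → ZMod 2) →ₗ[ZMod 2] (V → ZMod 2) × (V → ZMod 2) :=
    { toFun := fun z => (fun a => z (b a) + z a, fun a => z (s a) + z a)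
      map_add' := fun x y => by
        ext a
        · change (x (b a) + y (b a)) + (x a + y a) = (x (b a) + x a) + (y (b a) + y a); ring
        · change (x (s a) + y (s a)) + (x a + y a) = (x (s a) + x a) + (y (s a) + y a); ring
      map_smul' := fun c x => by
        ext a
        · change c * x (b a) + c * x a = c * (x (b a) + x a); ring
        · change c * x (s a) + c * x a = c * (x (s a) + x a); ring }
  by_cases hu : ((0, u) : (V → ZMod 2) × (V → ZMod 2)) ∈ LinearMap.range T
  · obtain ⟨z, hz⟩ := hu
    have h1 : ∀ a, z (b a) + z a = 0 := fun a => congrFun (congrArg Prod.fst hz) a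
    have h2 : ∀ a, z (s a) + z a = u a := fun a => congrFun (congrArg Prod.snd hz) a
    refine ⟨z, fun a => CharTwo.add_eq_zero.1 (h1 a), fun a => ?_⟩
    rw [← h2 a]; grind
  · exfalso
    obtain ⟨f, hf, hT⟩ := Submodule.exists_le_ker_of_notMem hu
    set p : V → ZMod 2 := fun a => f (Pi.single a 1, 0) with hp
    set r : V → ZMod 2 := fun a => f (0, Pi.single a 1) with hr
    have hfr : ∀ y : V → ZMod 2, f (0, y) = ∑ a, r a * y a := by
      intro y
      have := LinearMap.pi_apply_eq_sum_univ (f ∘ₗ LinearMap.inr (ZMod 2) (V → ZMod 2) _) y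
      simp only [LinearMap.comp_apply, LinearMap.inr_apply, smul_eq_mul] at this
      rw [this]
      refine Finset.sum_congr rfl fun a _ => ?_
      rw [mul_comm, hr]
      congr 3
      ext j; simp [Pi.single_apply, eq_comm]
    have key : ∀ a, p (b a) + p a + (r (s a) + r a) = 0 := by
      intro a
      have h0 : f (T (Pi.single a 1)) = 0 := hT ⟨_, rfl⟩
      have e : T (Pi.single a 1) = (Pi.single (b a) 1, 0) + (Pi.single a 1, 0) +
          ((0, Pi.single (s a) 1) + (0, Pi.single a 1)) := by
        have hc : ∀ t : V → V, (∀ a, t (t a) = a) → ∀ x, (t x = a ↔ x = t a) := fun t ht x =>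
          ⟨fun h => by rw [← h, ht], fun h => by rw [h, ht]⟩
        ext x
        · simp [T, Pi.single_apply, hc b hb]
        · simp [T, Pi.single_apply, hc s hs]
      rw [e, map_add, map_add, map_add] at h0
      exact h0
    refine hf ?_
    rw [hfr]
    refine h r fun a => ?_
    have k1 := key a
    have k2 := key (b a)
    rw [hb] at k2
    grind

namespace CombinatorialMap

variable {V E : Type*}

/-- A labelling of the quadrilaterals by a type `E`: a surjection from the vertices of the map
graph whose fibres are the quadrilaterals. -/
structure IsLabelling (M : CombinatorialMap V) (l : V → E) : Prop where
  surj : Function.Surjective l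
  red : ∀ a, l (M.mate .red a) = l a
  green : ∀ a, l (M.mate .green a) = l a
  fiber : ∀ {a b}, l b = l a → b = a ∨ b = M.mate .red a ∨ b = M.mate .green a ∨
    b = M.mate .red (M.mate .green a)

/-- The space of pairs `(ρ, γ)` of functions on the quadrilaterals such that some function `z`,
constant along black edges, changes by `ρ e` along the red edges and by `γ e` along the green
edges of each quadrilateral `e`. -/
def labelSpace (M : CombinatorialMap V) (l : V → E) :
    Submodule (ZMod 2) ((E → ZMod 2) × (E → ZMod 2)) where
  carrier := {p | ∃ z : V → ZMod 2, (∀ a, z (M.mate .black a) = z a) ∧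
    (∀ a, z (M.mate .red a) = z a + p.1 (l a)) ∧ ∀ a, z (M.mate .green a) = z a + p.2 (l a)}
  zero_mem' := ⟨0, fun _ => rfl, fun _ => rfl, fun _ => rfl⟩
  add_mem' := by
    rintro p q ⟨z, h1, h2, h3⟩ ⟨y, k1, k2, k3⟩
    refine ⟨z + y, fun a => ?_, fun a => ?_, fun a => ?_⟩
    · simp [h1, k1]
    · simp only [Pi.add_apply, h2, k2, Prod.fst_add]; ring
    · simp only [Pi.add_apply, h3, k3, Prod.snd_add]; ring
  smul_mem' := by
    rintro c p ⟨z, h1, h2, h3⟩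
    refine ⟨c • z, fun a => ?_, fun a => ?_, fun a => ?_⟩
    · simp [h1]
    · simp only [Pi.smul_apply, h2, Prod.smul_fst, smul_eq_mul]; ring
    · simp only [Pi.smul_apply, h3, Prod.smul_snd, smul_eq_mul]; ring

/-- Feasibility in terms of invariant functions: a function which is invariant along the fully
black subgraph given by `F` is constant. -/
def IsFeasibleLabel (M : CombinatorialMap V) (l : V → E) (F : Set E) : Prop :=
  ∀ z : V → ZMod 2, (∀ a, z (M.mate .black a) = z a) → (∀ a, l a ∉ F → z (M.mate .red a) = z a) →
    (∀ a, l a ∈ F → z (M.mate .green a) = z a) → ∀ a b, z a = z b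

theorem isFeasible_iff_isFeasibleLabel (M : CombinatorialMap V) {l : V → E} {F : Set E}
    {F' : Set M.Edge} (hF : ∀ a, M.quad a ∈ F' ↔ l a ∈ F) :
    M.IsFeasible F' ↔ M.IsFeasibleLabel l F := by
  classical
  rw [isFeasible_iff]
  constructor
  · intro h z hb hr hg a b
    refine Joined.ind (P := fun v => z a = z v) rfl (fun v hv => by rw [hb, hv])
      (fun v hv => ?_) (h a b)
    rw [hv]
    by_cases hv : M.quad v ∈ F'
    · rw [step, if_pos hv, hg v ((hF v).1 hv)]
    · rw [step, if_neg hv, hr v (mt (hF v).2 hv)]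
  · intro h u v
    have := h (fun w => if M.Joined F' u w then 1 else 0) (fun a => ?_) (fun a ha => ?_)
      (fun a ha => ?_) u v
    · by_contra hv
      simp [hv, Joined.rfl'] at this
    · have : M.Joined F' u (M.mate .black a) ↔ M.Joined F' u a :=
        ⟨fun h => h.trans (Joined.black _ _).symm, fun h => h.trans (Joined.black _ _)⟩
      simp [this]
    · have e : M.mate .red a = M.step F' a := (if_neg (mt (hF a).1 ha)).symm
      have : M.Joined F' u (M.mate .red a) ↔ M.Joined F' u a := by
        rw [e]
        exact ⟨fun h => h.trans (Joined.step _ _).symm, fun h => h.trans (Joined.step _ _)⟩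
      simp [this]
    · have e : M.mate .green a = M.step F' a := (if_pos ((hF a).2 ha)).symm
      have : M.Joined F' u (M.mate .green a) ↔ M.Joined F' u a := by
        rw [e]
        exact ⟨fun h => h.trans (Joined.step _ _).symm, fun h => h.trans (Joined.step _ _)⟩
      simp [this]

/-- The label of a pair along the edges that belong to the fully black subgraph given by `F`. -/
noncomputable def along (F : Set E) (p : (E → ZMod 2) × (E → ZMod 2)) (e : E) : ZMod 2 :=
  open Classical in if e ∈ F then p.2 e else p.1 e

/-- The label of a pair along the edges of the quadrilaterals that do not belong to the fully
black subgraph given by `F`. -/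
noncomputable def across (F : Set E) (p : (E → ZMod 2) × (E → ZMod 2)) (e : E) : ZMod 2 :=
  open Classical in if e ∈ F then p.1 e else p.2 e

theorem along_add (F : Set E) (p q : (E → ZMod 2) × (E → ZMod 2)) (e : E) :
    along F (p + q) e = along F p e + along F q e := by
  unfold along; split_ifs <;> rfl

theorem across_add (F : Set E) (p q : (E → ZMod 2) × (E → ZMod 2)) (e : E) :
    across F (p + q) e = across F p e + across F q e := by
  unfold across; split_ifs <;> rfl

theorem eq_zero_of_along_across {F : Set E} {p : (E → ZMod 2) × (E → ZMod 2)}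
    (h1 : ∀ e, along F p e = 0) (h2 : ∀ e, across F p e = 0) : p = 0 := by
  unfold along at h1
  unfold across at h2
  ext e <;> have h1 := h1 e <;> have h2 := h2 e <;> by_cases he : e ∈ F <;> simp_all

/-- Opposite flags of a quadrilateral are distinct. -/
theorem red_green_ne (M : CombinatorialMap V) (a : V) : M.mate .red (M.mate .green a) ≠ a := by
  intro h
  have := congrArg (M.mate .red) h
  rw [M.mate_mate] at this
  exact M.red_ne_green a this.symm

namespace IsLabelling

variable {M : CombinatorialMap V} {l : V → E} (hl : M.IsLabelling l)
include hl

theorem sum_fiber [Fintype V] [DecidableEq E] (a : V) (r : V → ZMod 2) :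
    ∑ b with l b = l a, r b =
      r a + r (M.mate .red a) + (r (M.mate .green a) + r (M.mate .red (M.mate .green a))) := by
  classical
  have e : (Finset.univ.filter fun b => l b = l a) =
      {a, M.mate .red a, M.mate .green a, M.mate .red (M.mate .green a)} := by
    ext b
    simp only [Finset.mem_filter, Finset.mem_univ, true_and, Finset.mem_insert,
      Finset.mem_singleton]
    refine ⟨hl.fiber, ?_⟩
    rintro (rfl | rfl | rfl | rfl) <;> simp [hl.red, hl.green]
  have h1 := M.mate_ne .red a
  have h2 := M.mate_ne .green a
  have h3 := M.red_green_ne a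
  have h4 := M.red_ne_green a
  have h5 := M.mate_ne .red (M.mate .green a)
  have h6 : M.mate .red a ≠ M.mate .red (M.mate .green a) := fun h => by
    have := congrArg (M.mate .red) h
    rw [M.mate_mate, M.mate_mate] at this
    exact h2 this.symm
  rw [e, Finset.sum_insert, Finset.sum_insert, Finset.sum_insert, Finset.sum_singleton]
  · ring
  · simpa using h5.symm
  · simp [h4, h6]
  · simp [h1.symm, h2.symm, h3.symm]

/-- Isotropy of the label space. -/
theorem isotropic [Fintype V] [Fintype E] {p q : (E → ZMod 2) × (E → ZMod 2)}
    (hp : p ∈ M.labelSpace l) (hq : q ∈ M.labelSpace l) :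
    ∑ e, (p.1 e * q.2 e + p.2 e * q.1 e) = 0 := by
  classical
  obtain ⟨z, h1, h2, h3⟩ := hp
  obtain ⟨y, k1, k2, k3⟩ := hq
  have h0 : ∑ a, z a * y a = 0 :=
    sum_eq_zero_of_involution (M.mate_mate .black) (M.mate_ne .black) fun a => by rw [h1, k1]
  rw [← Finset.sum_fiberwise Finset.univ l] at h0
  rw [← h0]
  refine Finset.sum_congr rfl fun e _ => ?_
  obtain ⟨a, rfl⟩ := hl.surj e
  rw [hl.sum_fiber a]
  simp only [h2, h3, k2, k3, hl.green]
  generalize z a = x1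
  generalize y a = x2
  generalize p.1 (l a) = x3
  generalize p.2 (l a) = x4
  generalize q.1 (l a) = x5
  generalize q.2 (l a) = x6
  clear * -
  grind

/-- A function whose change along the edges of the subgraph given by `F` depends only on the
quadrilateral changes by the same amount along opposite edges of every quadrilateral. -/
theorem exists_labels {F : Set E} {z : V → ZMod 2} {σ : E → ZMod 2}
    (hr : ∀ a, l a ∉ F → z (M.mate .red a) = z a + σ (l a))
    (hg : ∀ a, l a ∈ F → z (M.mate .green a) = z a + σ (l a)) :
    ∃ p : (E → ZMod 2) × (E → ZMod 2), (∀ a, z (M.mate .red a) = z a + p.1 (l a)) ∧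
      (∀ a, z (M.mate .green a) = z a + p.2 (l a)) ∧ along F p = σ := by
  classical
  choose α hα using hl.surj
  have wd : ∀ (c : MapColor), (c = .red ∨ c = .green) → ∀ a,
      z (M.mate c a) + z a = z (M.mate c (α (l a))) + z (α (l a)) := by
    intro c hc a
    have hg' : l a ∈ F → z (M.mate .green (M.mate .red (α (l a)))) =
        z (M.mate .red (α (l a))) + σ (l a) := fun h => by
      have := hg (M.mate .red (α (l a))) (by rwa [hl.red, hα])
      rwa [hl.red, hα] at this
    have hr' : l a ∉ F → z (M.mate .red (M.mate .green (α (l a)))) =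
        z (M.mate .green (α (l a))) + σ (l a) := fun h => by
      have := hr (M.mate .green (α (l a))) (by rwa [hl.green, hα])
      rwa [hl.green, hα] at this
    have hg0 := hg (α (l a))
    have hr0 := hr (α (l a))
    rw [hα] at hg0 hr0
    rw [← M.red_green_comm] at hg'
    rcases hl.fiber (hα (l a)).symm with h | h | h | h <;> rcases hc with rfl | rfl <;>
      rw [h] <;>
      simp only [← M.red_green_comm, M.mate_mate, hl.red, hl.green, hα] <;>
      by_cases hF : l a ∈ F <;>
      simp only [hF, not_true_eq_false, not_false_eq_true, forall_const] at hg' hr' hg0 hr0 <;>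
      grind
  refine ⟨(fun e => z (M.mate .red (α e)) + z (α e), fun e => z (M.mate .green (α e)) + z (α e)),
    fun a => ?_, fun a => ?_, ?_⟩
  · have := wd .red (Or.inl rfl) a
    grind
  · have := wd .green (Or.inr rfl) a
    grind
  · funext e
    unfold along
    split_ifs with h
    · have := hg (α e) (by rwa [hα])
      rw [hα] at this
      simp only [this]; grind
    · have := hr (α e) (by rwa [hα])
      rw [hα] at this
      simp only [this]; grind

/-- The label along `F` can be prescribed arbitrarily, up to orthogonality to the functions
that are invariant along `F`. -/
theorem exists_along_eq [Fintype V] [Fintype E] {F : Set E} {σ : E → ZMod 2}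
    (h : ∀ p ∈ M.labelSpace l, (∀ e, along F p e = 0) → ∑ e, σ e * across F p e = 0) :
    ∃ p ∈ M.labelSpace l, along F p = σ := by
  classical
  let s : V → V := fun a => if l a ∈ F then M.mate .green a else M.mate .red a
  have hs : ∀ a, s (s a) = a := fun a => by
    by_cases ha : l a ∈ F
    · simp [s, ha, hl.green, M.mate_mate]
    · simp [s, ha, hl.red, M.mate_mate]
  have key : ∀ r : V → ZMod 2, (∀ a, r (M.mate .black a) + r (s (M.mate .black a)) =
      r a + r (s a)) → ∑ a, r a * σ (l a) = 0 := by
    intro r hr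
    set m : V → ZMod 2 := fun a => r a + r (s a) with hm
    have hms : ∀ a, m (s a) = m a := fun a => by simp only [hm, hs]; ring
    obtain ⟨p, h1, h2, h3⟩ := hl.exists_labels (F := F) (z := m) (σ := 0)
      (fun a ha => by simpa [s, ha] using hms a) (fun a ha => by simpa [s, ha] using hms a)
    have := h p ⟨m, hr, h1, h2⟩ (fun e => by rw [h3]; rfl)
    rw [← Finset.sum_fiberwise Finset.univ l, ← this]
    refine Finset.sum_congr rfl fun e _ => ?_
    obtain ⟨a, rfl⟩ := hl.surj e
    rw [hl.sum_fiber a]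
    simp only [hl.red, hl.green]
    have g1 := h1 a
    have g2 := h2 a
    have e1 := hl.green a
    have e2 := hl.red a
    unfold across
    by_cases ha : l a ∈ F
    · simp only [ha, if_true]
      have : p.1 (l a) = m (M.mate .red a) + m a := by rw [g1]; grind
      rw [this]
      simp only [hm, s, ha, e2, if_true, ← M.red_green_comm]
      ring
    · simp only [ha, if_false]
      have : p.2 (l a) = m (M.mate .green a) + m a := by rw [g2]; grind
      rw [this]
      simp only [hm, s, ha, e1, if_false]
      ring
  obtain ⟨z, hb, hz⟩ := exists_invariant_add_of_orthogonal hs (M.mate_mate .black) _ key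
  obtain ⟨p, h1, h2, h3⟩ := hl.exists_labels (F := F) (z := z) (σ := σ)
    (fun a ha => by simpa [s, ha] using hz a) (fun a ha => by simpa [s, ha] using hz a)
  exact ⟨p, ⟨z, hb, h1, h2⟩, h3⟩

/-- A set is feasible exactly if no nonzero element of the label space vanishes along it. -/
theorem isFeasibleLabel_iff (F : Set E) :
    M.IsFeasibleLabel l F ↔ ∀ p ∈ M.labelSpace l, (∀ e, along F p e = 0) → p = 0 := by
  classical
  constructor
  · rintro h p ⟨z, h1, h2, h3⟩ hp
    have hc := h z h1 (fun a ha => by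
        have := hp (l a)
        rw [along, if_neg ha] at this
        rw [h2, this, add_zero]) fun a ha => by
        have := hp (l a)
        rw [along, if_pos ha] at this
        rw [h3, this, add_zero]
    ext e
    · obtain ⟨a, rfl⟩ := hl.surj e
      have := h2 a
      rw [hc (M.mate .red a) a] at this
      simpa using this
    · obtain ⟨a, rfl⟩ := hl.surj e
      have := h3 a
      rw [hc (M.mate .green a) a] at this
      simpa using this
  · intro h z hb hr hg
    obtain ⟨p, h1, h2, h3⟩ := hl.exists_labels (F := F) (z := z) (σ := 0)
      (fun a ha => by simpa using hr a ha) (fun a ha => by simpa using hg a ha)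
    have hp := h p ⟨z, hb, h1, h2⟩ (fun e => by rw [h3]; rfl)
    subst hp
    intro a b
    refine reachable_ind (P := fun b => z a = z b) rfl (fun x y hxy hx => ?_)
      (M.connected.preconnected a b)
    rw [SimpleGraph.fromRel_adj] at hxy
    have key : ∀ c x, z (M.mate c x) = z x := by
      rintro (_ | _ | _) x
      · simpa using h1 x
      · simpa using h2 x
      · exact hb x
    rcases hxy.2 with ⟨c, rfl⟩ | ⟨c, rfl⟩
    · rw [key, hx]
    · rw [hx, key]

end IsLabelling

end CombinatorialMap

/-! ### Feasible sets determine the label space -/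

namespace CombinatorialMap

variable {E : Type*}

theorem along_symmDiff (F S : Set E) (p : (E → ZMod 2) × (E → ZMod 2)) (e : E) :
    (e ∈ S → along (symmDiff F S) p e = across F p e) ∧
      (e ∉ S → along (symmDiff F S) p e = along F p e) := by
  unfold along across
  constructor <;> intro h <;> by_cases hF : e ∈ F <;> simp [Set.mem_symmDiff, h, hF]

theorem sum_along_mul_across [Fintype E] (F : Set E) (p q : (E → ZMod 2) × (E → ZMod 2)) :
    ∑ e, (along F p e * across F q e + across F p e * along F q e) =
      ∑ e, (p.1 e * q.2 e + p.2 e * q.1 e) := by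
  refine Finset.sum_congr rfl fun e _ => ?_
  unfold along across
  split_ifs <;> ring

theorem along_smul (F : Set E) (c : ZMod 2) (p : (E → ZMod 2) × (E → ZMod 2)) (e : E) :
    along F (c • p) e = c * along F p e := by
  unfold along; split_ifs <;> rfl

theorem across_smul (F : Set E) (c : ZMod 2) (p : (E → ZMod 2) × (E → ZMod 2)) (e : E) :
    across F (c • p) e = c * across F p e := by
  unfold across; split_ifs <;> rfl

/-- An isotropic space of pairs on which the label along `F` can be prescribed arbitrarily. Such a
space is the graph of a symmetric matrix, with respect to the splitting of the labels into those
along and those across `F`. -/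
structure IsLagrangianAt [Fintype E] (L : Submodule (ZMod 2) ((E → ZMod 2) × (E → ZMod 2)))
    (F : Set E) : Prop where
  isotropic : ∀ p ∈ L, ∀ q ∈ L, ∑ e, (p.1 e * q.2 e + p.2 e * q.1 e) = 0
  surj : ∀ σ : E → ZMod 2, ∃ p ∈ L, along F p = σ

/-- No nonzero element of the space vanishes along `F`. -/
def IsTransversal (L : Submodule (ZMod 2) ((E → ZMod 2) × (E → ZMod 2))) (F : Set E) : Prop :=
  ∀ p ∈ L, (∀ e, along F p e = 0) → p = 0

namespace IsLagrangianAt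

variable [Fintype E] {L L' : Submodule (ZMod 2) ((E → ZMod 2) × (E → ZMod 2))} {F : Set E}

/-- By isotropy, the labels across `F` are obtained from those along `F` by the symmetric matrix
whose rows are the elements `q` of `L` with `along F q` a coordinate vector. -/
theorem across_eq [DecidableEq E] (hL : IsLagrangianAt L F) {p q : (E → ZMod 2) × (E → ZMod 2)}
    {y : E} (hp : p ∈ L) (hq : q ∈ L) (hqy : along F q = Pi.single y 1) :
    across F p y = ∑ e, along F p e * across F q e := by
  have h := hL.isotropic p hp q hq
  rw [← sum_along_mul_across F, Finset.sum_add_distrib, hqy] at h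
  simp only [Pi.single_apply, mul_ite, mul_one, mul_zero, Finset.sum_ite_eq', Finset.mem_univ,
    if_true] at h
  exact (CharTwo.add_eq_zero.1 h).symm

theorem across_symm [DecidableEq E] (hL : IsLagrangianAt L F)
    {p q : (E → ZMod 2) × (E → ZMod 2)} {x y : E} (hp : p ∈ L) (hq : q ∈ L)
    (hpx : along F p = Pi.single x 1) (hqy : along F q = Pi.single y 1) :
    across F p y = across F q x := by
  rw [hL.across_eq hp hq hqy, hpx]
  simp [Pi.single_apply]

theorem isTransversal (hL : IsLagrangianAt L F) : IsTransversal L F := by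
  classical
  intro p hp h0
  refine eq_zero_of_along_across h0 fun y => ?_
  obtain ⟨q, hq, hqy⟩ := hL.surj (Pi.single y 1)
  rw [hL.across_eq hp hq hqy]
  simp [h0]

/-- Feasibility of the sets at distance one from `F` gives the diagonal of the matrix. -/
theorem isTransversal_singleton_iff [DecidableEq E] (hL : IsLagrangianAt L F)
    {p : (E → ZMod 2) × (E → ZMod 2)} {x : E} (hp : p ∈ L) (hpx : along F p = Pi.single x 1) :
    IsTransversal L (symmDiff F {x}) ↔ across F p x ≠ 0 := by
  constructor
  · intro h h0
    have : p = 0 := h p hp fun e => by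
      by_cases he : e = x
      · subst he; rw [(along_symmDiff F {e} p e).1 rfl, h0]
      · rw [(along_symmDiff F {x} p e).2 he, hpx, Pi.single_eq_of_ne he]
    have h1 := congrFun hpx x
    rw [this] at h1
    simp [along] at h1
  · intro h q hq h0
    have hqx : across F q x = 0 := by rw [← (along_symmDiff F {x} q x).1 rfl, h0]
    have hq' : ∀ e, e ≠ x → along F q e = 0 := fun e he => by
      rw [← (along_symmDiff F {x} q e).2 he, h0]
    rw [hL.across_eq hq hp hpx, Finset.sum_eq_single x (fun e _ he => by rw [hq' e he, zero_mul])
      (by simp)] at hqx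
    refine hL.isTransversal q hq fun e => ?_
    by_cases he : e = x
    · subst he; exact (mul_eq_zero.1 hqx).resolve_right h
    · exact hq' e he

/-- Feasibility of the sets at distance two from `F` gives the principal minors of order two. -/
theorem isTransversal_pair_iff [DecidableEq E] (hL : IsLagrangianAt L F)
    {p q : (E → ZMod 2) × (E → ZMod 2)} {x y : E} (hxy : x ≠ y) (hp : p ∈ L) (hq : q ∈ L)
    (hpx : along F p = Pi.single x 1) (hqy : along F q = Pi.single y 1) :
    IsTransversal L (symmDiff F {x, y}) ↔
      across F p x * across F q y + across F p y ≠ 0 := by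
  have hs := hL.across_symm hp hq hpx hqy
  constructor
  · intro h h0
    have : ∀ a b e : ZMod 2, a * e + b = 0 → ∃ c d : ZMod 2, (c ≠ 0 ∨ d ≠ 0) ∧
      c * a + d * b = 0 ∧ c * b + d * e = 0 := by decide
    obtain ⟨c, d, hcd, h1, h2⟩ := this _ _ _ h0
    have hz : c • p + d • q = 0 := by
      refine h _ (L.add_mem (L.smul_mem c hp) (L.smul_mem d hq)) fun e => ?_
      by_cases he : e ∈ ({x, y} : Set E)
      · rw [(along_symmDiff F _ _ e).1 he, across_add, across_smul, across_smul]
        rcases he with rfl | rfl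
        · rw [← hs, h1]
        · exact h2
      · rw [(along_symmDiff F _ _ e).2 he, along_add, along_smul, along_smul, hpx, hqy,
          Pi.single_eq_of_ne fun h => he (Or.inl h), Pi.single_eq_of_ne fun h => he (Or.inr h)]
        ring
    have hx : along F (c • p + d • q) x = c := by
      rw [along_add, along_smul, along_smul, hpx, hqy, Pi.single_eq_of_ne hxy]
      simp
    have hy : along F (c • p + d • q) y = d := by
      rw [along_add, along_smul, along_smul, hpx, hqy, Pi.single_eq_of_ne hxy.symm]
      simp
    rw [hz] at hx hy
    rcases hcd with h | h
    · exact h (by rw [← hx]; simp [along])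
    · exact h (by rw [← hy]; simp [along])
  · intro h r hr h0
    have hr' : ∀ e, e ∉ ({x, y} : Set E) → along F r e = 0 := fun e he => by
      rw [← (along_symmDiff F _ r e).2 he, h0]
    have hsum : ∀ g : E → ZMod 2,
        ∑ e, along F r e * g e = along F r x * g x + along F r y * g y := by
      intro g
      rw [← Finset.sum_pair (f := fun e => along F r e * g e) hxy]
      refine (Finset.sum_subset (Finset.subset_univ _) fun e _ he => ?_).symm
      rw [hr' e (by simpa using he), zero_mul]
    have hrx : across F r x = 0 := by rw [← (along_symmDiff F {x, y} r x).1 (Or.inl rfl), h0]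
    have hry : across F r y = 0 := by rw [← (along_symmDiff F {x, y} r y).1 (Or.inr rfl), h0]
    rw [hL.across_eq hr hp hpx, hsum] at hrx
    rw [hL.across_eq hr hq hqy, hsum, ← hs] at hry
    have : ∀ a b e c d : ZMod 2, a * e + b ≠ 0 → c * a + d * b = 0 → c * b + d * e = 0 →
      c = 0 ∧ d = 0 := by decide
    obtain ⟨hc, hd⟩ := this _ _ _ _ _ h hrx hry
    refine hL.isTransversal r hr fun e => ?_
    by_cases he : e ∈ ({x, y} : Set E)
    · rcases he with rfl | rfl
      · exact hc
      · exact hd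
    · exact hr' e he

/-- A Lagrangian space is determined by the sets to which it is transversal. -/
theorem le_of_isTransversal_iff (hL : IsLagrangianAt L F) (hL' : IsLagrangianAt L' F)
    (h : ∀ F, IsTransversal L F ↔ IsTransversal L' F) : L ≤ L' := by
  classical
  choose ℓ hℓ hℓs using fun x => hL.surj (Pi.single x 1)
  choose ℓ' hℓ' hℓs' using fun x => hL'.surj (Pi.single x 1)
  have z2 : ∀ a b : ZMod 2, (a ≠ 0 ↔ b ≠ 0) → a = b := by decide
  have hdiag : ∀ x, across F (ℓ x) x = across F (ℓ' x) x := fun x => z2 _ _ <| by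
    rw [← hL.isTransversal_singleton_iff (hℓ x) (hℓs x),
      ← hL'.isTransversal_singleton_iff (hℓ' x) (hℓs' x), h]
  have hoff : ∀ x y, across F (ℓ x) y = across F (ℓ' x) y := fun x y => by
    by_cases hxy : x = y
    · subst hxy; exact hdiag x
    · have := z2 (across F (ℓ x) x * across F (ℓ y) y + across F (ℓ x) y)
          (across F (ℓ' x) x * across F (ℓ' y) y + across F (ℓ' x) y) <| by
        rw [← hL.isTransversal_pair_iff hxy (hℓ x) (hℓ y) (hℓs x) (hℓs y),
          ← hL'.isTransversal_pair_iff hxy (hℓ' x) (hℓ' y) (hℓs' x) (hℓs' y), h]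
      rw [hdiag, hdiag] at this
      exact add_left_cancel this
  intro p hp
  obtain ⟨p', hp', hs⟩ := hL'.surj (along F p)
  have : p = p' := by
    have h0 : p + p' = 0 := by
      refine eq_zero_of_along_across (F := F) (fun e => ?_) fun e => ?_
      · rw [along_add, hs, CharTwo.add_self_eq_zero]
      · rw [across_add, hL.across_eq hp (hℓ e) (hℓs e), hL'.across_eq hp' (hℓ' e) (hℓs' e), hs]
        simp only [hoff]
        exact CharTwo.add_self_eq_zero _
    have h1 : ∀ q : (E → ZMod 2) × (E → ZMod 2), q + q = 0 := fun q => by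
      ext e <;> exact CharTwo.add_self_eq_zero _
    exact (add_right_cancel (h0.trans (h1 p').symm))
  rwa [this]

end IsLagrangianAt

theorem IsLabelling.isLagrangianAt {V : Type*} [Fintype V] [Fintype E] {M : CombinatorialMap V}
    {l : V → E} (hl : M.IsLabelling l) {F : Set E} (hF : M.IsFeasibleLabel l F) :
    IsLagrangianAt (M.labelSpace l) F where
  isotropic p hp q hq := hl.isotropic hp hq
  surj σ := hl.exists_along_eq fun p hp h0 => by
    rw [(hl.isFeasibleLabel_iff F).1 hF p hp h0]
    simp [across]

/-- The label space is determined by the feasible sets. -/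
theorem IsLabelling.labelSpace_eq {V V' : Type*} [Fintype V] [Fintype V'] [Fintype E]
    {M : CombinatorialMap V} {M' : CombinatorialMap V'} {l : V → E} {l' : V' → E}
    (hl : M.IsLabelling l) (hl' : M'.IsLabelling l')
    (h : ∀ F, M.IsFeasibleLabel l F ↔ M'.IsFeasibleLabel l' F)
    (hex : ∃ F, M.IsFeasibleLabel l F) : M.labelSpace l = M'.labelSpace l' := by
  obtain ⟨F, hF⟩ := hex
  have hT : ∀ F, IsTransversal (M.labelSpace l) F ↔ IsTransversal (M'.labelSpace l') F :=
    fun F => by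
      rw [IsTransversal, IsTransversal, ← hl.isFeasibleLabel_iff, ← hl'.isFeasibleLabel_iff, h]
  have h1 := hl.isLagrangianAt hF
  have h2 := hl'.isLagrangianAt ((h F).1 hF)
  exact le_antisymm (h1.le_of_isTransversal_iff h2 hT)
    (h2.le_of_isTransversal_iff h1 fun F => (hT F).symm)

end CombinatorialMap

/-! ### Binary representations of 3-connected matroids -/

/-- The elements of a space of functions that vanish outside `X`. -/
def Submodule.supportedOn {E : Type*} (U : Submodule (ZMod 2) (E → ZMod 2)) (X : Set E) :
    Submodule (ZMod 2) (E → ZMod 2) :=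
  U ⊓ LinearMap.ker (LinearMap.funLeft (ZMod 2) (ZMod 2) (Subtype.val : (Xᶜ : Set E) → E))

theorem Submodule.mem_supportedOn {E : Type*} {U : Submodule (ZMod 2) (E → ZMod 2)} {X : Set E}
    {u : E → ZMod 2} : u ∈ U.supportedOn X ↔ u ∈ U ∧ ∀ e, e ∉ X → u e = 0 := by
  rw [Submodule.supportedOn, Submodule.mem_inf, LinearMap.mem_ker]
  refine and_congr_right fun _ => ⟨fun h e he => congrFun h ⟨e, he⟩, fun h => ?_⟩
  ext e
  exact h e e.2

/-- A space of functions over the field with two elements represents a matroid if the elements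
of every base are coordinates for it. -/
structure Represents {E : Type*} (U : Submodule (ZMod 2) (E → ZMod 2)) (N : Matroid E) :
    Prop where
  inj : ∀ B, N.IsBase B → ∀ u ∈ U, (∀ b ∈ B, u b = 0) → u = 0
  surj : ∀ B, N.IsBase B → ∀ b ∈ B, ∃ u ∈ U, u b = 1 ∧ ∀ b' ∈ B, b' ≠ b → u b' = 0

namespace Represents

variable {E : Type*} [Finite E] {U : Submodule (ZMod 2) (E → ZMod 2)} {N : Matroid E}

theorem finrank_le_eRank (h : Represents U N) : (Module.finrank (ZMod 2) U : ℕ∞) ≤ N.eRank := by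
  classical
  have := Fintype.ofFinite E
  obtain ⟨B, hB⟩ := N.exists_isBase
  rw [← hB.encard_eq_eRank]
  let g : U →ₗ[ZMod 2] (B → ZMod 2) :=
    (LinearMap.funLeft (ZMod 2) (ZMod 2) (Subtype.val : B → E)) ∘ₗ U.subtype
  have hg : Function.Injective g := by
    rw [← LinearMap.ker_eq_bot, LinearMap.ker_eq_bot']
    intro u hu
    exact Subtype.ext (h.inj B hB u u.2 fun b hb => congrFun hu ⟨b, hb⟩)
  have h1 := LinearMap.finrank_le_finrank_of_injective hg
  rw [Module.finrank_fintype_fun_eq_card] at h1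
  rw [Set.encard_eq_coe_toFinset_card, Set.toFinset_card]
  exact_mod_cast h1

/-- The rank of `X` plus the dimension of the space of functions vanishing on `X` is at most the
dimension of the whole space. -/
theorem eRk_add_finrank_le (h : Represents U N) (X : Set E) :
    N.eRk X + Module.finrank (ZMod 2) (U.supportedOn Xᶜ) ≤ Module.finrank (ZMod 2) U := by
  classical
  have := Fintype.ofFinite E
  obtain ⟨I, hI⟩ := N.exists_isBasis' X
  obtain ⟨B, hB, hIB⟩ := hI.indep.exists_isBase_superset
  rw [← hI.encard_eq_eRk]
  let g : U →ₗ[ZMod 2] (I → ZMod 2) :=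
    (LinearMap.funLeft (ZMod 2) (ZMod 2) (Subtype.val : I → E)) ∘ₗ U.subtype
  have hg : LinearMap.range g = ⊤ := by
    rw [LinearMap.range_eq_top]
    intro σ
    choose u hu h1 h2 using fun i : I => h.surj B hB i (hIB i.2)
    refine ⟨∑ i, σ i • ⟨u i, hu i⟩, ?_⟩
    ext j
    rw [map_sum, Finset.sum_apply, Finset.sum_eq_single j]
    · change σ j * u j j = σ j
      rw [h1, mul_one]
    · intro i _ hij
      change σ i * u i j = 0
      rw [h2 i j (hIB j.2) fun hh => hij (Subtype.ext hh.symm), mul_zero]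
    · simp
  have h1 := LinearMap.finrank_range_add_finrank_ker g
  rw [hg, finrank_top, Module.finrank_fintype_fun_eq_card] at h1
  have h2 : Module.finrank (ZMod 2) (U.supportedOn Xᶜ) ≤
      Module.finrank (ZMod 2) (LinearMap.ker g) := by
    rw [← Submodule.finrank_map_subtype_eq]
    refine Submodule.finrank_mono fun u hu => ?_
    rw [Submodule.mem_supportedOn] at hu
    refine ⟨⟨u, hu.1⟩, ?_, rfl⟩
    rw [SetLike.mem_coe, LinearMap.mem_ker]
    ext i
    exact hu.2 i fun hh => hh (hI.subset i.2)
  rw [Set.encard_eq_coe_toFinset_card, Set.toFinset_card]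
  norm_cast
  omega

/-- Connectivity of a represented matroid in terms of the representing space. -/
theorem finrank_supportedOn (h : Represents U N) (hE : N.E = Set.univ) {n : ℕ}
    (hN : N.IsNConnected n) {k : ℕ} (h1 : 1 ≤ k) (hk : k < n) {X : Set E} (hX : k ≤ X.ncard)
    (hXc : k ≤ Xᶜ.ncard) :
    Module.finrank (ZMod 2) (U.supportedOn X) + Module.finrank (ZMod 2) (U.supportedOn Xᶜ) + k ≤
      Module.finrank (ZMod 2) U := by
  have e1 := h.eRk_add_finrank_le X
  have e2 := h.eRk_add_finrank_le Xᶜ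
  rw [compl_compl] at e2
  have e3 := hN k h1 hk X Xᶜ (by rw [hE, Set.union_compl_self]) disjoint_compl_right
    (by rw [← (Set.toFinite X).cast_ncard_eq]; exact_mod_cast hX)
    (by rw [← (Set.toFinite Xᶜ).cast_ncard_eq]; exact_mod_cast hXc)
  have e4 := h.finrank_le_eRank
  have f1 : N.eRk X ≠ ⊤ := fun hh => by rw [hh] at e1; simp at e1
  have f2 : N.eRk Xᶜ ≠ ⊤ := fun hh => by rw [hh] at e2; simp at e2
  generalize N.eRk X = r at *
  generalize N.eRk Xᶜ = r' at *
  lift r to ℕ using f1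
  lift r' to ℕ using f2
  have e5 := (add_le_add_left e4 (k : ℕ∞)).trans e3
  norm_cast at *
  omega

end Represents

/-- No element of `E` is a coordinate function of `U`, nor a zero coordinate. -/
structure NoLoopColoop {E : Type*} (U : Submodule (ZMod 2) (E → ZMod 2)) : Prop where
  coloop : ∀ u ∈ U, ∀ e, u e ≠ 0 → ∃ e', e' ≠ e ∧ u e' ≠ 0
  loop : ∀ e, ∃ u ∈ U, u e ≠ 0

/-- For any bipartition into two sets with at least two elements, the functions supported in one
of the sets span together a subspace of codimension at least two. -/
def HasNoTwoSeparation {E : Type*} (U : Submodule (ZMod 2) (E → ZMod 2)) : Prop :=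
  ∀ X : Set E, 2 ≤ X.ncard → 2 ≤ Xᶜ.ncard → ∀ w : E → ZMod 2, ∃ u ∈ U, ∀ x ∈ U, ∀ y ∈ U,
    (∀ e, e ∉ X → x e = 0) → (∀ e, e ∈ X → y e = 0) → u ≠ x + y ∧ u ≠ x + y + w

namespace Represents

variable {E : Type*} [Finite E] {U : Submodule (ZMod 2) (E → ZMod 2)} {N : Matroid E}

/-- The bound for separations into one element and the rest. -/
theorem noLoopColoop (h : Represents U N) (hE : N.E = Set.univ) (hN : N.IsNConnected 3)
    (hn : 2 ≤ Nat.card E) : NoLoopColoop U := by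
  classical
  have key : ∀ e : E, Module.finrank (ZMod 2) (U.supportedOn {e}) +
      Module.finrank (ZMod 2) (U.supportedOn {e}ᶜ) + 1 ≤ Module.finrank (ZMod 2) U := by
    intro e
    refine h.finrank_supportedOn hE hN le_rfl (by omega) (by simp) ?_
    have := Set.ncard_add_ncard_compl {e}
    rw [Set.ncard_singleton] at this
    omega
  constructor
  · intro u hu e he
    by_contra! hc
    have : U ≤ U.supportedOn {e} ⊔ U.supportedOn {e}ᶜ := by
      intro x hx
      rw [Submodule.mem_sup]
      refine ⟨x e • u, ?_, x + x e • u, ?_, ?_⟩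
      · rw [Submodule.mem_supportedOn]
        refine ⟨U.smul_mem _ hu, fun e' he' => ?_⟩
        rw [Pi.smul_apply, hc e' he', smul_zero]
      · rw [Submodule.mem_supportedOn]
        refine ⟨U.add_mem hx (U.smul_mem _ hu), fun e' he' => ?_⟩
        obtain rfl : e' = e := by simpa using he'
        rw [Pi.add_apply, Pi.smul_apply, ZMod.two_eq_one_of_ne_zero he, smul_eq_mul, mul_one,
          CharTwo.add_self_eq_zero]
      · ext i
        simp only [Pi.add_apply]
        rw [add_comm (x i), ← add_assoc, CharTwo.add_self_eq_zero, zero_add]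
    have h1 := Submodule.finrank_mono this
    have h2 := Submodule.finrank_add_le_finrank_add_finrank (U.supportedOn {e}) (U.supportedOn {e}ᶜ)
    have h3 := key e
    omega
  · intro e
    by_contra! hc
    have : U ≤ U.supportedOn {e}ᶜ := by
      intro x hx
      rw [Submodule.mem_supportedOn]
      refine ⟨hx, fun e' he' => ?_⟩
      obtain rfl : e' = e := by simpa using he'
      exact hc x hx
    have h1 := Submodule.finrank_mono this
    have h3 := key e
    omega

/-- The bound for separations into two sets with at least two elements. -/
theorem hasNoTwoSeparation (h : Represents U N) (hE : N.E = Set.univ)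
    (hN : N.IsNConnected 3) : HasNoTwoSeparation U := by
  intro X hX hXc w
  have key := h.finrank_supportedOn hE hN (k := 2) (by omega) (by omega) hX hXc
  by_contra! hc
  have : U ≤ U.supportedOn X ⊔ U.supportedOn Xᶜ ⊔ Submodule.span (ZMod 2) {w} := by
    intro u hu
    obtain ⟨x, hx, y, hy, h1, h2, h3⟩ := hc u hu
    have hx' : x ∈ U.supportedOn X := Submodule.mem_supportedOn.2 ⟨hx, h1⟩
    have hy' : y ∈ U.supportedOn Xᶜ :=
      Submodule.mem_supportedOn.2 ⟨hy, fun e he => h2 e (by simpa using he)⟩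
    by_cases hxy : u = x + y
    · rw [hxy]
      exact Submodule.mem_sup_left (Submodule.add_mem_sup hx' hy')
    · rw [h3 hxy]
      exact Submodule.add_mem_sup (Submodule.add_mem_sup hx' hy')
        (Submodule.mem_span_singleton_self w)
  have h1 := Submodule.finrank_mono this
  have h2 := Submodule.finrank_add_le_finrank_add_finrank (U.supportedOn X) (U.supportedOn Xᶜ)
  have h3 := Submodule.finrank_add_le_finrank_add_finrank
    (U.supportedOn X ⊔ U.supportedOn Xᶜ) (Submodule.span (ZMod 2) {w})
  have h4 := finrank_span_le_card (R := ZMod 2) ({w} : Set (E → ZMod 2))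
  rw [Set.toFinset_card, Fintype.card_unique] at h4
  omega

end Represents

/-! ### The lower and the upper matroid -/

namespace CombinatorialMap

variable {E : Type*}

/-- The functions `γ` such that `(0, γ)` belongs to the space `L` of pairs. For the label space of a
map these are the cuts of the graph formed by the vertices and the edges of the map. -/
def cuts (L : Submodule (ZMod 2) ((E → ZMod 2) × (E → ZMod 2))) :
    Submodule (ZMod 2) (E → ZMod 2) :=
  L.comap (LinearMap.inr (ZMod 2) _ _)

/-- The functions `γ` such that `(ρ, γ)` belongs to the space `L` of pairs for some `ρ`. For the
label space of a map these are the cycles of the dual graph. -/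
def cocycles (L : Submodule (ZMod 2) ((E → ZMod 2) × (E → ZMod 2))) :
    Submodule (ZMod 2) (E → ZMod 2) :=
  L.map (LinearMap.snd (ZMod 2) _ _)

end CombinatorialMap

namespace DeltaMatroid

open CombinatorialMap

variable {E : Type*} [Fintype E] {D : DeltaMatroid E}
  {L : Submodule (ZMod 2) ((E → ZMod 2) × (E → ZMod 2))}

/-- The entries of the matrix at a feasible set `B` vanish at all pairs of elements whose exchange
gives infeasible sets. -/
theorem across_eq_zero [DecidableEq E] {B : Set E} (hL : IsLagrangianAt L B)
    (hD : ∀ F, D.Feasible F ↔ IsTransversal L F) {p : (E → ZMod 2) × (E → ZMod 2)} {b e : E}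
    (hp : p ∈ L) (hpb : along B p = Pi.single b 1) (h1 : ¬ D.Feasible (symmDiff B {b}))
    (h2 : ¬ D.Feasible (symmDiff B {b, e})) : across B p e = 0 := by
  rw [hD, hL.isTransversal_singleton_iff hp hpb, not_not] at h1
  by_cases he : b = e
  · rw [← he, h1]
  · obtain ⟨q, hq, hqe⟩ := hL.surj (Pi.single e 1)
    rw [hD, hL.isTransversal_pair_iff he hp hq hpb hqe, not_not, h1, zero_mul, zero_add] at h2
    exact h2

/-- The cut space represents the lower matroid. -/
theorem represents_lowerMatroid (hD : ∀ F, D.Feasible F ↔ IsTransversal L F)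
    (hL : ∀ F, D.Feasible F → IsLagrangianAt L F) : Represents (cuts L) D.lowerMatroid := by
  classical
  constructor
  · intro B hB u hu h0
    have hB : D.IsLowerBase B := hB
    have := (hD B).1 hB.1 (0, u) hu fun e => by
      unfold along
      split_ifs with he
      · exact h0 e he
      · rfl
    exact congrArg Prod.snd this
  · intro B hB b hb
    have hB : D.IsLowerBase B := hB
    have hLB := hL B hB.1
    obtain ⟨p, hp, hpb⟩ := hLB.surj (Pi.single b 1)
    have hlt : ∀ S : Set E, S ⊆ B → S.Nonempty → ¬ D.Feasible (symmDiff B S) := by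
      intro S hSB hS hF
      refine absurd (hB.2 _ hF) (not_le.2 (Set.ncard_lt_ncard ?_ (Set.toFinite B)))
      obtain ⟨x, hx⟩ := hS
      rw [Set.symmDiff_def, Set.sdiff_eq_empty.2 hSB, Set.union_empty]
      exact ⟨Set.sdiff_subset, fun h => (h (hSB hx)).2 hx⟩
    have hp1 : p.1 = 0 := by
      ext e
      by_cases he : e ∈ B
      · have := across_eq_zero hLB hD hp hpb (hlt {b} (by simpa using hb) ⟨b, rfl⟩)
          (hlt {b, e} (by rintro x (rfl | rfl); exacts [hb, he]) ⟨b, Or.inl rfl⟩)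
        simpa [across, he] using this
      · have := congrFun hpb e
        rw [Pi.single_eq_of_ne (fun h : e = b => he (by rw [h]; exact hb))] at this
        simpa [along, he] using this
    refine ⟨p.2, ?_, ?_, ?_⟩
    · change (0, p.2) ∈ L
      rwa [← hp1]
    · have := congrFun hpb b
      simpa [along, hb] using this
    · intro e he hne
      have := congrFun hpb e
      rw [Pi.single_eq_of_ne hne] at this
      simpa [along, he] using this

/-- The cycle space of the dual graph represents the upper matroid. -/
theorem represents_upperMatroid (hD : ∀ F, D.Feasible F ↔ IsTransversal L F)
    (hL : ∀ F, D.Feasible F → IsLagrangianAt L F) : Represents (cocycles L) D.upperMatroid := by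
  classical
  constructor
  · rintro B hB _ ⟨p, hp, rfl⟩ h0
    have hB : D.IsUpperBase B := hB
    have hLB := hL B hB.1
    have hlt : ∀ S : Set E, S ⊆ Bᶜ → S.Nonempty → ¬ D.Feasible (symmDiff B S) := by
      intro S hSB hS hF
      refine absurd (hB.2 _ hF) (not_le.2 (Set.ncard_lt_ncard ?_ (Set.toFinite _)))
      obtain ⟨x, hx⟩ := hS
      refine ⟨fun y hy => Or.inl ⟨hy, fun h => hSB h hy⟩, fun h => hSB hx (h ?_)⟩
      exact Or.inr ⟨hx, hSB hx⟩
    ext y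
    by_cases hy : y ∈ B
    · exact h0 y hy
    · obtain ⟨q, hq, hqy⟩ := hLB.surj (Pi.single y 1)
      have h1 := hLB.across_eq hp hq hqy
      have h2 : across B p y = p.2 y := by simp [across, hy]
      change p.2 y = 0
      rw [← h2, h1]
      refine Finset.sum_eq_zero fun e _ => ?_
      by_cases he : e ∈ B
      · have : along B p e = p.2 e := by simp [along, he]
        have h0 : p.2 e = 0 := h0 e he
        rw [this, h0, zero_mul]
      · rw [across_eq_zero hLB hD hq hqy (hlt {y} (by simpa using hy) ⟨y, rfl⟩)
          (hlt {y, e} (by rintro x (rfl | rfl); exacts [hy, he]) ⟨y, Or.inl rfl⟩), mul_zero]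
  · intro B hB b hb
    have hB : D.IsUpperBase B := hB
    obtain ⟨p, hp, hpb⟩ := (hL B hB.1).surj (Pi.single b 1)
    have h1 : ∀ e ∈ B, p.2 e = Pi.single (M := fun _ => ZMod 2) b 1 e := fun e he => by
      rw [← hpb]; simp [along, he]
    refine ⟨p.2, ⟨p, hp, rfl⟩, ?_, fun e he hne => ?_⟩
    · rw [h1 b hb, Pi.single_eq_same]
    · rw [h1 e he, Pi.single_eq_of_ne hne]

end DeltaMatroid

/-! ### The dual map -/

namespace CombinatorialMap

variable {V : Type*}

theorem isLabelling_quad (M : CombinatorialMap V) : M.IsLabelling M.quad where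
  surj := M.quad_surj
  red := M.quad_red
  green := M.quad_green
  fiber := M.quad_eq

/-- The zero coordinates and the coordinate functions are exchanged by duality. -/
theorem IsLabelling.noLoopColoop_dual {E : Type*} [Fintype V] [Fintype E] {M : CombinatorialMap V}
    {l : V → E} (hl : M.IsLabelling l) (h : NoLoopColoop (cocycles (M.labelSpace l))) :
    NoLoopColoop ((M.labelSpace l).comap (LinearMap.inl (ZMod 2) _ _)) := by
  classical
  constructor
  · intro u hu e he
    by_contra! hc
    obtain ⟨_, ⟨p, hp, rfl⟩, h0⟩ := h.loop e
    have := hl.isotropic hu hp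
    rw [Finset.sum_eq_single e (fun e' _ he' => by
      simp [hc e' he']) (by simp)] at this
    simp only [LinearMap.inl_apply, Pi.zero_apply, zero_mul, add_zero] at this
    exact (mul_ne_zero he h0) this
  · intro e
    by_contra! hc
    obtain ⟨p, hp, hpe⟩ := hl.exists_along_eq (F := Set.univ) (σ := Pi.single e 1) fun p hp h0 => by
      have h0 : p.2 = 0 := by
        funext e; simpa [along] using h0 e
      have : p.1 e = 0 := hc p.1 (by
        change (p.1, (0 : E → ZMod 2)) ∈ M.labelSpace l; rwa [← h0])
      simp [Pi.single_apply, across, this]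
    obtain ⟨e', hne, he'⟩ := h.coloop p.2 ⟨p, hp, rfl⟩ e (by
      have := congrFun hpe e
      simp [along] at this
      simp [this])
    have := congrFun hpe e'
    simp [along, hne] at this
    exact he' this

/-- The map with the colours red and green exchanged. -/
def swap (M : CombinatorialMap V) : CombinatorialMap V where
  mate
    | .red => M.mate .green
    | .green => M.mate .red
    | .black => M.mate .black
  mate_mate := by rintro (_ | _ | _) v <;> exact M.mate_mate _ v
  mate_ne := by rintro (_ | _ | _) v <;> exact M.mate_ne _ v
  red_ne_green v := (M.red_ne_green v).symm
  red_green_comm v := (M.red_green_comm v).symm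
  connected := by
    refine M.connected.mono fun u v => ?_
    simp only [SimpleGraph.fromRel_adj]
    refine fun ⟨h, h'⟩ => ⟨h, h'.imp ?_ ?_⟩ <;>
    · rintro ⟨_ | _ | _, h⟩
      exacts [⟨.green, h⟩, ⟨.red, h⟩, ⟨.black, h⟩]

theorem IsLabelling.swap {E : Type*} {M : CombinatorialMap V} {l : V → E}
    (hl : M.IsLabelling l) : M.swap.IsLabelling l where
  surj := hl.surj
  red := hl.green
  green := hl.red
  fiber {a b} h := by
    change b = a ∨ b = M.mate .green a ∨ b = M.mate .red a ∨ b = M.mate .green (M.mate .red a)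
    have := hl.fiber h
    rw [← M.red_green_comm]
    tauto

theorem mem_labelSpace_swap {E : Type*} {M : CombinatorialMap V} {l : V → E}
    (p : (E → ZMod 2) × (E → ZMod 2)) : p ∈ M.swap.labelSpace l ↔ p.swap ∈ M.labelSpace l :=
  ⟨fun ⟨z, h1, h2, h3⟩ => ⟨z, h1, h3, h2⟩, fun ⟨z, h1, h2, h3⟩ => ⟨z, h1, h3, h2⟩⟩

theorem cuts_swap {E : Type*} {M : CombinatorialMap V} {l : V → E} :
    cuts (M.swap.labelSpace l) = (M.labelSpace l).comap (LinearMap.inl (ZMod 2) _ _) := by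
  ext u
  exact mem_labelSpace_swap (0, u)

end CombinatorialMap

/-! ### The graph of a map -/

namespace CombinatorialMap

variable {V E : Type*}

/-- The vertices of the map: the red-black cycles of the map graph. -/
def Vertex (M : CombinatorialMap V) : Type _ :=
  (M.sub ∅).toSimpleGraph.ConnectedComponent

/-- The vertex of the map to which a vertex of the map graph (a flag) belongs. -/
def vert (M : CombinatorialMap V) (a : V) : M.Vertex :=
  (M.sub ∅).toSimpleGraph.connectedComponentMk a

section Vertex

variable (M : CombinatorialMap V)

theorem vert_eq_iff {a b : V} : M.vert a = M.vert b ↔ M.Joined ∅ a b :=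
  SimpleGraph.ConnectedComponent.eq

theorem step_empty (a : V) : M.step ∅ a = M.mate .red a := if_neg fun h => h

theorem vert_surj : Function.Surjective M.vert :=
  fun v => SimpleGraph.ConnectedComponent.ind (fun a => ⟨a, rfl⟩) v

theorem vert_red (a : V) : M.vert (M.mate .red a) = M.vert a := by
  rw [vert_eq_iff, ← M.step_empty]
  exact (Joined.step ∅ a).symm

theorem vert_black (a : V) : M.vert (M.mate .black a) = M.vert a := by
  rw [vert_eq_iff]
  exact (Joined.black ∅ a).symm

theorem vert_ind {P : V → Prop} {a b : V} (hab : M.vert a = M.vert b) (ha : P a)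
    (hb : ∀ x, P x → P (M.mate .black x)) (hr : ∀ x, P x → P (M.mate .red x)) : P b :=
  Joined.ind ha hb (fun x hx => by rw [step_empty]; exact hr x hx) (M.vert_eq_iff.1 hab)

theorem eq_of_vert_eq {α : Type*} {h : V → α} {a b : V} (hab : M.vert a = M.vert b)
    (hb : ∀ x, M.vert x = M.vert a → h (M.mate .black x) = h x)
    (hr : ∀ x, M.vert x = M.vert a → h (M.mate .red x) = h x) : h a = h b := by
  refine (M.vert_ind (P := fun x => M.vert x = M.vert a ∧ h a = h x) hab ⟨rfl, rfl⟩
    (fun x hx => ⟨by rw [vert_black, hx.1], by rw [hb x hx.1, hx.2]⟩)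
    (fun x hx => ⟨by rw [vert_red, hx.1], by rw [hr x hx.1, hx.2]⟩)).2

theorem map_ind {P : V → Prop} {a : V} (ha : P a) (h : ∀ c x, P x → P (M.mate c x)) (b : V) :
    P b := by
  refine reachable_ind ha (fun x y hxy hx => ?_) (M.connected.preconnected a b)
  rw [SimpleGraph.fromRel_adj] at hxy
  rcases hxy.2 with ⟨c, rfl⟩ | ⟨c, hc⟩
  · exact h c x hx
  · have := h c x hx
    rwa [← hc, M.mate_mate] at this

/-- The simple graph of the vertices and the edges of the map, with the vertices of `S` made
isolated. -/
def vertexGraph (S : Set M.Vertex) : SimpleGraph M.Vertex where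
  Adj p q := p ≠ q ∧ p ∉ S ∧ q ∉ S ∧ ∃ a, M.vert a = p ∧ M.vert (M.mate .green a) = q
  symm := ⟨fun _ _ ⟨h1, h2, h3, a, h4, h5⟩ =>
    ⟨h1.symm, h3, h2, M.mate .green a, h5, by rw [M.mate_mate, h4]⟩⟩
  loopless := ⟨fun _ h => h.1 rfl⟩

end Vertex

instance [Finite V] (M : CombinatorialMap V) : Finite M.Vertex :=
  Finite.of_surjective _ M.vert_surj

namespace IsLabelling

variable {M : CombinatorialMap V} {l : V → E} (hl : M.IsLabelling l)

/-- The coboundary of a function on the vertices. -/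
noncomputable def cob (h : M.Vertex → ZMod 2) (e : E) : ZMod 2 :=
  h (M.vert (Function.surjInv hl.surj e)) +
    h (M.vert (M.mate .green (Function.surjInv hl.surj e)))

include hl

theorem cob_apply (h : M.Vertex → ZMod 2) (a : V) :
    hl.cob h (l a) = h (M.vert a) + h (M.vert (M.mate .green a)) := by
  unfold cob
  rcases hl.fiber (Function.surjInv_eq hl.surj (l a)) with e | e | e | e <;> rw [e]
  · rw [← M.red_green_comm, vert_red, vert_red]
  · rw [M.mate_mate, add_comm]
  · rw [← M.red_green_comm, M.mate_mate, vert_red, vert_red, add_comm]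

theorem cob_mem (h : M.Vertex → ZMod 2) : hl.cob h ∈ cuts (M.labelSpace l) := by
  refine ⟨fun a => h (M.vert a), fun a => ?_, fun a => ?_, fun a => ?_⟩
  · simp only [vert_black]
  · simp only [vert_red]; exact (add_zero _).symm
  · change _ = _ + hl.cob h (l a)
    rw [hl.cob_apply, ← add_assoc, CharTwo.add_self_eq_zero, zero_add]

theorem exists_cob {γ : E → ZMod 2} (hγ : γ ∈ cuts (M.labelSpace l)) : ∃ h, hl.cob h = γ := by
  obtain ⟨z, h1, h2, h3⟩ := hγ
  have hz : ∀ a b, M.vert a = M.vert b → z a = z b := fun a b hab =>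
    M.eq_of_vert_eq hab (fun x _ => h1 x) fun x _ => by rw [h2]; exact add_zero _
  refine ⟨fun v => z (Function.surjInv M.vert_surj v), funext fun e => ?_⟩
  obtain ⟨a, rfl⟩ := hl.surj e
  rw [cob_apply, hz _ a (Function.surjInv_eq _ _),
    hz _ (M.mate .green a) (Function.surjInv_eq _ _), h3]
  change z a + (z a + γ (l a)) = _
  rw [← add_assoc, CharTwo.add_self_eq_zero, zero_add]

theorem cob_add (h k : M.Vertex → ZMod 2) : hl.cob (h + k) = hl.cob h + hl.cob k := by
  ext e
  simp only [cob, Pi.add_apply]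
  ring

theorem cob_add_const (h : M.Vertex → ZMod 2) (c : ZMod 2) :
    hl.cob (fun v => h v + c) = hl.cob h := by
  ext e
  unfold cob
  grind

theorem eq_of_cob_eq_zero {h : M.Vertex → ZMod 2} (h0 : hl.cob h = 0) (v w : M.Vertex) :
    h v = h w := by
  obtain ⟨a, rfl⟩ := M.vert_surj v
  obtain ⟨b, rfl⟩ := M.vert_surj w
  refine M.map_ind (P := fun b => h (M.vert a) = h (M.vert b)) rfl (fun c x hx => ?_) b
  rw [hx]
  cases c
  · rw [vert_red]
  · have := hl.cob_apply h x
    rw [h0] at this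
    exact CharTwo.add_eq_zero.1 this.symm
  · rw [vert_black]

/-- The set of edges at a vertex, as a cut. -/
noncomputable def star (v : M.Vertex) : E → ZMod 2 :=
  open Classical in hl.cob (Pi.single v 1)

theorem star_mem (v : M.Vertex) : hl.star v ∈ cuts (M.labelSpace l) := hl.cob_mem _

theorem exists_of_star_ne_zero {v : M.Vertex} {e : E} (h : hl.star v e ≠ 0) :
    ∃ a, M.vert a = v ∧ l a = e := by
  classical
  obtain ⟨a, rfl⟩ := hl.surj e
  rw [star, cob_apply] at h
  by_cases h1 : M.vert a = v
  · exact ⟨a, h1, rfl⟩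
  · by_cases h2 : M.vert (M.mate .green a) = v
    · exact ⟨_, h2, hl.green a⟩
    · rw [Pi.single_eq_of_ne h1, Pi.single_eq_of_ne h2] at h
      exact absurd (add_zero _) h

section NoLoopColoop

variable (h1 : NoLoopColoop (cuts (M.labelSpace l)))
include h1

/-- The graph has no loops, since every edge belongs to a cut. -/
theorem vert_green_ne (a : V) : M.vert (M.mate .green a) ≠ M.vert a := by
  intro h
  obtain ⟨u, hu, hne⟩ := h1.loop (l a)
  obtain ⟨k, rfl⟩ := hl.exists_cob hu
  rw [hl.cob_apply, h, CharTwo.add_self_eq_zero] at hne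
  exact hne rfl

theorem star_vert (a : V) : hl.star (M.vert a) (l a) = 1 := by
  classical
  rw [star, cob_apply, Pi.single_eq_same, Pi.single_eq_of_ne (hl.vert_green_ne h1 a), add_zero]

/-- The flags of an edge at one of its ends are exchanged by the red involution. -/
theorem eq_or_eq_red {a b : V} (hv : M.vert b = M.vert a) (he : l b = l a) :
    b = a ∨ b = M.mate .red a := by
  rcases hl.fiber he with h | h | h | h
  · exact Or.inl h
  · exact Or.inr h
  · rw [h] at hv
    exact absurd hv (hl.vert_green_ne h1 a)
  · rw [h, vert_red] at hv
    exact absurd hv (hl.vert_green_ne h1 a)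

/-- Consecutive edges at a vertex are distinct, since the star of a vertex has two edges. -/
theorem label_black_ne (a : V) : l (M.mate .black a) ≠ l a := by
  intro h
  have hb : M.mate .black a = M.mate .red a :=
    (hl.eq_or_eq_red h1 (M.vert_black a) h).resolve_left (M.mate_ne _ a)
  obtain ⟨e, hne, he⟩ := h1.coloop _ (hl.star_mem (M.vert a)) (l a) (by
    rw [hl.star_vert h1]; exact one_ne_zero)
  obtain ⟨b, hb', rfl⟩ := hl.exists_of_star_ne_zero he
  have : b = a ∨ b = M.mate .red a := by
    refine M.vert_ind (P := fun b => b = a ∨ b = M.mate .red a) hb'.symm (Or.inl rfl) ?_ ?_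
    · rintro x (rfl | rfl)
      · exact Or.inr hb
      · rw [← hb, M.mate_mate]; exact Or.inl rfl
    · rintro x (rfl | rfl)
      · exact Or.inr rfl
      · rw [M.mate_mate]; exact Or.inl rfl
  rcases this with rfl | rfl
  · exact hne rfl
  · exact hne (hl.red a)

/-- If the neighbours of an edge on both sides at a vertex coincide, then the vertex has degree
two. -/
theorem black_red_of_label_eq {a : V}
    (h : l (M.mate .black (M.mate .red a)) = l (M.mate .black a)) :
    M.mate .black (M.mate .red a) = M.mate .red (M.mate .black a) ∧
      ∀ b, M.vert b = M.vert a → l b = l a ∨ l b = l (M.mate .black a) := by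
  have h2 : M.mate .black (M.mate .red a) = M.mate .red (M.mate .black a) := by
    refine (hl.eq_or_eq_red h1 ?_ h).resolve_left fun h3 => ?_
    · rw [vert_black, vert_red, vert_black]
    · have := congrArg (M.mate .black) h3
      rw [M.mate_mate, M.mate_mate] at this
      exact M.mate_ne _ _ this
  refine ⟨h2, fun b hb => ?_⟩
  have : b = a ∨ b = M.mate .red a ∨ b = M.mate .black a ∨ b = M.mate .red (M.mate .black a) := by
    refine M.vert_ind (P := fun b => b = a ∨ b = M.mate .red a ∨ b = M.mate .black a ∨
      b = M.mate .red (M.mate .black a)) hb.symm (Or.inl rfl) ?_ ?_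
    · rintro x (rfl | rfl | rfl | rfl)
      · tauto
      · rw [h2]; tauto
      · rw [M.mate_mate]; tauto
      · rw [← h2, M.mate_mate]; tauto
    · rintro x (rfl | rfl | rfl | rfl)
      · tauto
      · rw [M.mate_mate]; tauto
      · tauto
      · rw [M.mate_mate]; tauto
  rcases this with rfl | rfl | rfl | rfl <;> simp [hl.red]

end NoLoopColoop

end IsLabelling

/-! ### 3-connectivity of the graph -/

/-- The graph formed by the vertices and the edges of the map is simple and 3-connected, with at
least three edges at each vertex. The last condition is stated in the form that the two edges next
to an edge in the cyclic order at its end are distinct. -/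
structure IsLabelling.IsThreeConnected {M : CombinatorialMap V} {l : V → E}
    (hl : M.IsLabelling l) : Prop where
  noLoopColoop : NoLoopColoop (cuts (M.labelSpace l))
  label_eq : ∀ {a b}, M.vert a = M.vert b → M.vert (M.mate .green a) = M.vert (M.mate .green b) →
    l a = l b
  label_black_red : ∀ a, l (M.mate .black (M.mate .red a)) ≠ l (M.mate .black a)
  reachable : ∀ {u v x y : M.Vertex}, x ∉ ({u, v} : Set M.Vertex) → y ∉ ({u, v} : Set M.Vertex) →
    (M.vertexGraph {u, v}).Reachable x y

/-- Parallel edges, the two edges at a vertex of degree two, and the edges on one side of a pair of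
separating vertices would each be a 2-separation of the cut space: every function on the vertices
is, up to one fixed function and a constant, a sum of functions whose coboundaries live on the two
sides. -/
theorem IsLabelling.isThreeConnected [Finite E] {M : CombinatorialMap V} {l : V → E}
    (hl : M.IsLabelling l) (h1 : NoLoopColoop (cuts (M.labelSpace l)))
    (h2 : HasNoTwoSeparation (cuts (M.labelSpace l))) (hn : 4 ≤ Nat.card E) :
    hl.IsThreeConnected := by
  classical
  -- the set of the edges that a nonzero cut may contain has at least two elements
  have two_le : ∀ (h : M.Vertex → ZMod 2) (X : Set E), (∃ v w, h v ≠ h w) →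
      (∀ e, e ∉ X → hl.cob h e = 0) → 2 ≤ X.ncard := by
    rintro h X ⟨v, w, hvw⟩ hX
    have : ∃ e, hl.cob h e ≠ 0 := by
      by_contra! hc
      exact hvw (hl.eq_of_cob_eq_zero (funext hc) v w)
    obtain ⟨e, he⟩ := this
    obtain ⟨e', hne, he'⟩ := h1.coloop _ (hl.cob_mem h) e he
    have m1 : e ∈ X := by by_contra hh; exact he (hX e hh)
    have m2 : e' ∈ X := by by_contra hh; exact he' (hX e' hh)
    exact (Set.one_lt_ncard (Set.toFinite X)).2 ⟨e, m1, e', m2, hne.symm⟩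
  have sep : ∀ (X : Set E), 2 ≤ X.ncard → 2 ≤ Xᶜ.ncard → ∀ w : E → ZMod 2, ¬ ∀ h, ∃ x y,
      (∀ e, e ∉ X → hl.cob x e = 0) ∧ (∀ e, e ∈ X → hl.cob y e = 0) ∧
      (hl.cob h = hl.cob x + hl.cob y ∨ hl.cob h = hl.cob x + hl.cob y + w) := by
    intro X hX hXc w hc
    obtain ⟨u, hu, hu'⟩ := h2 X hX hXc w
    obtain ⟨h, rfl⟩ := hl.exists_cob hu
    obtain ⟨x, y, hx, hy, h3⟩ := hc h
    have := hu' _ (hl.cob_mem x) _ (hl.cob_mem y) hx hy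
    exact h3.elim this.1 this.2
  have pair_compl : ∀ e e' : E, 2 ≤ ({e, e'} : Set E)ᶜ.ncard := by
    intro e e'
    have g1 := Set.ncard_add_ncard_compl ({e, e'} : Set E)
    have g2 : ({e, e'} : Set E).ncard ≤ 2 := (Set.ncard_insert_le _ _).trans (by simp)
    omega
  have label_eq : ∀ {a b}, M.vert a = M.vert b →
      M.vert (M.mate .green a) = M.vert (M.mate .green b) → l a = l b := by
    intro a b hab hab'
    by_contra hne
    refine sep {l a, l b} (by rw [Set.ncard_pair hne]) (pair_compl _ _)
      (hl.cob (Pi.single (M.vert a) 1)) fun h => ?_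
    have hg := hl.vert_green_ne h1 a
    by_cases hh : h (M.vert a) = h (M.vert (M.mate .green a))
    · refine ⟨0, h, fun e _ => by simp [cob], ?_, Or.inl (by rw [← cob_add, zero_add])⟩
      rintro e (rfl | rfl)
      · rw [cob_apply, hh, CharTwo.add_self_eq_zero]
      · rw [cob_apply, ← hab, ← hab', hh, CharTwo.add_self_eq_zero]
    · have hh' : h (M.vert a) + 1 + h (M.vert (M.mate .green a)) = 0 := by
        revert hh
        generalize h (M.vert a) = x
        generalize h (M.vert (M.mate .green a)) = y
        revert x y; decide
      refine ⟨0, h + Pi.single (M.vert a) 1, fun e _ => by simp [cob], ?_,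
        Or.inr ?_⟩
      · rintro e (rfl | rfl)
        · rw [cob_apply, Pi.add_apply, Pi.add_apply, Pi.single_eq_same, Pi.single_eq_of_ne hg,
            add_zero, hh']
        · rw [cob_apply, ← hab, ← hab', Pi.add_apply, Pi.add_apply, Pi.single_eq_same,
            Pi.single_eq_of_ne hg, add_zero, hh']
      · rw [← cob_add, zero_add, ← cob_add, add_assoc]
        congr 1
        ext v
        simp [CharTwo.add_self_eq_zero]
  refine ⟨h1, label_eq, fun a h => ?_, fun {u v x y} hx hy => ?_⟩
  · -- a vertex of degree two would be separated from the rest by its two edges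
    obtain ⟨-, hdeg⟩ := hl.black_red_of_label_eq h1 h
    set b := M.mate .black a with hb
    have hab : M.vert b = M.vert a := M.vert_black a
    have hga := hl.vert_green_ne h1 a
    have hgb : M.vert (M.mate .green b) ≠ M.vert a := hab ▸ hl.vert_green_ne h1 b
    have hgg : M.vert (M.mate .green b) ≠ M.vert (M.mate .green a) := fun hh =>
      hl.label_black_ne h1 a (label_eq hab hh)
    refine sep {l a, l b} (by rw [Set.ncard_pair (hl.label_black_ne h1 a).symm])
      (pair_compl _ _) (hl.cob (Pi.single (M.vert (M.mate .green a)) 1)) fun h => ?_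
    have hsupp : ∀ c : ZMod 2, ∀ e, e ∉ ({l a, l b} : Set E) →
        hl.cob (Pi.single (M.vert a) c) e = 0 := by
      intro c e he
      rcases ZMod.two_cases c with rfl | rfl
      · simp [cob]
      · by_contra hne
        obtain ⟨x, hx, rfl⟩ := hl.exists_of_star_ne_zero (v := M.vert a) hne
        exact he (hdeg x hx)
    set α := h (M.vert a) + h (M.vert (M.mate .green b)) with hα
    set β := h (M.vert a) + h (M.vert (M.mate .green a)) + α with hβ
    have hy : ∀ e ∈ ({l a, l b} : Set E), hl.cob (h + Pi.single (M.vert a) α +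
        Pi.single (M.vert (M.mate .green a)) β) e = 0 := by
      rintro e (rfl | rfl)
      · rw [cob_apply]
        simp only [Pi.add_apply, Pi.single_eq_same, Pi.single_eq_of_ne hga,
          Pi.single_eq_of_ne hga.symm]
        grind
      · rw [cob_apply, hab]
        simp only [Pi.add_apply, Pi.single_eq_same, Pi.single_eq_of_ne hgb,
          Pi.single_eq_of_ne hgg, Pi.single_eq_of_ne hga.symm]
        grind
    have e2 : ∀ f : M.Vertex → ZMod 2, f + f = 0 := fun f => by
      ext v; exact CharTwo.add_self_eq_zero _
    refine ⟨_, _, hsupp α, hy, ?_⟩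
    have hd : h = Pi.single (M.vert a) α + (h + Pi.single (M.vert a) α +
        Pi.single (M.vert (M.mate .green a)) β) + Pi.single (M.vert (M.mate .green a)) β := by
      have e3 := e2 (Pi.single (M.vert a) α)
      have e4 := e2 (Pi.single (M.vert (M.mate .green a)) β)
      generalize (Pi.single (M.vert a) α : M.Vertex → ZMod 2) = f at *
      generalize (Pi.single (M.vert (M.mate .green a)) β : M.Vertex → ZMod 2) = g at *
      rw [show f + (h + f + g) + g = h + (f + f) + (g + g) by ring, e3, e4, add_zero, add_zero]
    rw [← cob_add]
    rcases ZMod.two_cases β with h0 | h0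
    · left
      rw [h0, Pi.single_zero, add_zero, add_zero] at hd
      rw [h0, Pi.single_zero, add_zero]
      exact congrArg hl.cob hd
    · right
      rw [h0] at hd ⊢
      rw [← cob_add]
      exact congrArg hl.cob hd
  · -- the vertices reachable from `x` would be separated from the rest by two vertices
    by_contra hxy
    set A : Set M.Vertex := {w | (M.vertexGraph {u, v}).Reachable x w} with hA
    have hxA : x ∈ A := SimpleGraph.Reachable.refl x
    have hyA : y ∉ A := hxy
    have hAuv : ∀ w ∈ A, w ∉ ({u, v} : Set M.Vertex) := by
      intro w hw
      exact reachable_ind (P := fun w => w ∉ ({u, v} : Set M.Vertex)) hx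
        (fun p q (hpq : (M.vertexGraph {u, v}).Adj p q) _ => hpq.2.2.1) hw
    have hclosed : ∀ a, M.vert a ∈ A → M.vert (M.mate .green a) ∉ ({u, v} : Set M.Vertex) →
        M.vert (M.mate .green a) ∈ A := by
      intro a ha hga
      exact SimpleGraph.Reachable.trans (v := M.vert a) ha (SimpleGraph.Adj.reachable
        ⟨(hl.vert_green_ne h1 a).symm, hAuv _ ha, hga, a, rfl, rfl⟩)
    set X : Set E := {e | ∃ a, l a = e ∧ M.vert a ∈ A} with hX
    have hXa : ∀ a, l a ∉ X → M.vert a ∉ A := fun a ha hh => ha ⟨a, rfl, hh⟩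
    have suppA : ∀ h : M.Vertex → ZMod 2, ∀ e, e ∉ X →
        hl.cob (fun w => if w ∈ A then h w else 0) e = 0 := by
      intro h e he
      obtain ⟨a, rfl⟩ := hl.surj e
      rw [cob_apply, if_neg (hXa a he), if_neg (hXa _ (by rwa [hl.green])), add_zero]
    have suppB : ∀ h : M.Vertex → ZMod 2, ∀ e, e ∈ X →
        hl.cob (fun w => if w ∈ A ∪ {u, v} then 0 else h w) e = 0 := by
      rintro h _ ⟨a, rfl, ha⟩
      have : M.vert (M.mate .green a) ∈ A ∪ {u, v} := by
        by_cases hh : M.vert (M.mate .green a) ∈ ({u, v} : Set M.Vertex)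
        · exact Or.inr hh
        · exact Or.inl (hclosed a ha hh)
      rw [cob_apply, if_pos (show M.vert a ∈ A ∪ {u, v} from Or.inl ha), if_pos this, add_zero]
    have hyAuv : y ∉ A ∪ {u, v} := fun hh => hh.elim hyA hy
    refine sep X (two_le _ X ⟨x, y, ?_⟩ (suppA fun _ => 1))
      (two_le _ Xᶜ ⟨x, y, ?_⟩ fun e he => suppB (fun _ => 1) e (by simpa using he))
      (hl.cob (Pi.single v 1)) fun h => ?_
    · simp [hxA, hyA]
    · rw [if_pos (show x ∈ A ∪ {u, v} from Or.inl hxA), if_neg hyAuv]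
      exact zero_ne_one
    · set k : M.Vertex → ZMod 2 := fun w => h w + h u with hk
      have hku : k u = 0 := CharTwo.add_self_eq_zero _
      have hhk : hl.cob h = hl.cob k := (hl.cob_add_const h (h u)).symm
      refine ⟨_, _, suppA k, suppB k, ?_⟩
      have hd : k = (fun w => if w ∈ A then k w else 0) +
          (fun w => if w ∈ A ∪ {u, v} then 0 else k w) + Pi.single v (k v) := by
        ext w
        simp only [Pi.add_apply]
        by_cases hwv : w = v
        · subst hwv
          have : w ∉ A := fun hh => hAuv _ hh (Or.inr rfl)
          simp [this]
        · rw [Pi.single_eq_of_ne hwv, add_zero]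
          by_cases hwA : w ∈ A
          · simp [hwA]
          · by_cases hwu : w = u
            · subst hwu
              simp [hku]
            · simp [hwA, hwv, hwu]
      rw [hhk]
      rcases ZMod.two_cases (k v) with h0 | h0
      · left
        rw [h0, Pi.single_zero, add_zero] at hd
        rw [← cob_add]
        exact congrArg hl.cob hd
      · right
        rw [h0] at hd
        rw [← cob_add, ← cob_add]
        exact congrArg hl.cob hd

end CombinatorialMap

/-! ### Whitney's theorem -/

namespace CombinatorialMap.IsLabelling

variable {V V' E : Type*} {M : CombinatorialMap V} {M' : CombinatorialMap V'} {l : V → E}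
  {l' : V' → E} {hl : M.IsLabelling l} {hl' : M'.IsLabelling l'}

theorem star_eq_zero (hl : M.IsLabelling l) {v : M.Vertex} {a : V} (h1 : M.vert a ≠ v)
    (h2 : M.vert (M.mate .green a) ≠ v) : hl.star v (l a) = 0 := by
  classical
  rw [star, cob_apply, Pi.single_eq_of_ne h1, Pi.single_eq_of_ne h2, add_zero]

theorem vert_of_label_eq (hl : M.IsLabelling l) {a b : V} (h : l b = l a) :
    M.vert b = M.vert a ∨ M.vert b = M.vert (M.mate .green a) := by
  rcases hl.fiber h with rfl | rfl | rfl | rfl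
  · exact Or.inl rfl
  · exact Or.inl (M.vert_red a)
  · exact Or.inr rfl
  · exact Or.inr (M.vert_red _)

/-- Two vertices with the same star would be joined by all their edges, but there are no parallel
edges. -/
theorem IsThreeConnected.star_injective (T : hl.IsThreeConnected) :
    Function.Injective hl.star := by
  intro v w h
  obtain ⟨a, rfl⟩ := M.vert_surj v
  by_contra hne
  have key : ∀ b, M.vert b = M.vert a → M.vert (M.mate .green b) = w := by
    intro b hb
    have h0 := hl.star_vert T.noLoopColoop b
    rw [hb, h] at h0
    obtain ⟨c, hc, hcb⟩ := hl.exists_of_star_ne_zero (by rw [h0]; exact one_ne_zero)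
    rcases hl.vert_of_label_eq hcb with h1 | h1
    · exact absurd (hb.symm.trans (h1.symm.trans hc)) hne
    · exact h1.symm.trans hc
  refine hl.label_black_ne T.noLoopColoop a (T.label_eq (M.vert_black a) ?_)
  rw [key a rfl, key _ (M.vert_black a)]

/-- Whitney's theorem on 2-isomorphism: the star of a vertex of a 3-connected graph is the star of
a vertex in every graph with the same cut space. Otherwise it is a cut of the second graph which
separates two edges. Some vertex `u` of the first graph is then incident to edges on both sides of
this cut, and dividing the cut of `u` along the sides gives a cut of the first graph which
shows that `u` and `v` separate the graph. -/
theorem IsThreeConnected.exists_star_eq (T : hl.IsThreeConnected)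
    (h1' : NoLoopColoop (cuts (M'.labelSpace l')))
    (hL : M.labelSpace l = M'.labelSpace l') (v : M.Vertex) :
    ∃ v', hl'.star v' = hl.star v := by
  classical
  have h1 := T.noLoopColoop
  obtain ⟨h', hh'⟩ := hl'.exists_cob (hL ▸ hl.star_mem v)
  have hconst : ∀ b, hl.star v (l' b) = 0 → h' (M'.vert (M'.mate .green b)) = h' (M'.vert b) := by
    intro b hb
    rw [← hh', cob_apply] at hb
    exact (CharTwo.add_eq_zero.1 hb).symm
  set g : E → ZMod 2 := fun e => h' (M'.vert (Function.surjInv hl'.surj e)) with hg_def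
  have hg : ∀ b, hl.star v (l' b) = 0 → g (l' b) = h' (M'.vert b) := by
    intro b hb
    rcases hl'.vert_of_label_eq (Function.surjInv_eq hl'.surj (l' b)) with h | h <;>
      simp only [hg_def, h]
    exact hconst b hb
  have hgreen : ∀ a, hl.star v (l a) = 0 → M.vert a ≠ v ∧ M.vert (M.mate .green a) ≠ v := by
    refine fun a ha => ⟨?_, ?_⟩ <;> rintro rfl
    · rw [hl.star_vert h1] at ha
      exact one_ne_zero ha
    · rw [← hl.green, hl.star_vert h1] at ha
      exact one_ne_zero ha
  -- the edges outside the star lie on one side of the cut in the second graph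
  have hside : ∀ b c, hl.star v (l' b) = 0 → hl.star v (l' c) = 0 →
      h' (M'.vert b) = 1 → h' (M'.vert c) = 0 → False := by
    intro b c hb hc hb1 hc0
    rw [← hg b hb] at hb1
    rw [← hg c hc] at hc0
    obtain ⟨a, ha⟩ := hl.surj (l' b)
    obtain ⟨a', ha'⟩ := hl.surj (l' c)
    rw [← ha] at hb hb1
    rw [← ha'] at hc hc0
    have mixed : ∃ a1 a2, M.vert a1 = M.vert a2 ∧ hl.star v (l a1) = 0 ∧ hl.star v (l a2) = 0 ∧
        g (l a1) = 1 ∧ g (l a2) = 0 := by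
      by_contra! hno
      obtain ⟨a1, e1, e2, e3⟩ := reachable_ind (G := M.vertexGraph {v, v})
        (P := fun w => ∃ a1, M.vert a1 = w ∧ hl.star v (l a1) = 0 ∧ g (l a1) = 1)
        ⟨a, rfl, hb, hb1⟩ (fun p q hpq hp => by
          obtain ⟨a1, rfl, e2, e3⟩ := hp
          obtain ⟨-, n1, n2, x, hx, rfl⟩ := hpq
          have n1 : M.vert x ≠ v := by rw [hx]; simpa using n1
          have n2 : M.vert (M.mate .green x) ≠ v := by simpa using n2
          have hx0 := hl.star_eq_zero n1 n2
          refine ⟨M.mate .green x, rfl, by rwa [hl.green], ?_⟩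
          rw [hl.green]
          exact ZMod.two_eq_one_of_ne_zero (hno a1 x hx.symm e2 hx0 e3))
        (T.reachable (u := v) (v := v) (x := M.vert a) (y := M.vert a')
          (by simpa using (hgreen a hb).1) (by simpa using (hgreen a' hc).1))
      exact hno a1 a' e1 e2 hc e3 hc0
    obtain ⟨a1, a2, huu, s1, s2, g1, g2⟩ := mixed
    set u := M.vert a1 with hu
    obtain ⟨k', hk'⟩ := hl'.exists_cob (hL ▸ hl.star_mem u)
    set x := hl'.cob (fun w => if h' w = 1 then k' w else 0) with hx
    have hx1 : ∀ e, hl.star v e = 0 → g e = 1 → x e = hl.star u e := by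
      intro e he hge
      obtain ⟨b, rfl⟩ := hl'.surj e
      rw [hg b he] at hge
      rw [← hk', hx, cob_apply, cob_apply, hconst b he, if_pos hge, if_pos hge]
    have hx0 : ∀ e, hl.star v e = 0 → g e = 0 → x e = 0 := by
      intro e he hge
      obtain ⟨b, rfl⟩ := hl'.surj e
      rw [hg b he] at hge
      rw [hx, cob_apply, hconst b he, hge, if_neg zero_ne_one, if_neg zero_ne_one, add_zero]
    obtain ⟨k, hk⟩ := hl.exists_cob (hL.symm ▸ hl'.cob_mem _ : x ∈ cuts (M.labelSpace l))
    have hkk : ∀ p q, p ∉ ({u, v} : Set M.Vertex) → q ∉ ({u, v} : Set M.Vertex) → k p = k q := by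
      intro p q hp hq
      refine reachable_ind (P := fun q => k p = k q) rfl (fun p' q' hpq hp' => ?_)
        (T.reachable hp hq)
      obtain ⟨-, n1, n2, y, rfl, rfl⟩ := hpq
      simp only [Set.mem_insert_iff, Set.mem_singleton_iff, not_or] at n1 n2
      have hyv := hl.star_eq_zero n1.2 n2.2
      have : x (l y) = 0 := by
        rcases ZMod.two_cases (g (l y)) with h | h
        · exact hx0 _ hyv h
        · rw [hx1 _ hyv h, hl.star_eq_zero n1.1 n2.1]
      rw [← hk, cob_apply] at this
      rw [hp', CharTwo.add_eq_zero.1 this]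
    have hgr : ∀ a, M.vert a = u → hl.star v (l a) = 0 →
        M.vert (M.mate .green a) ∉ ({u, v} : Set M.Vertex) := by
      rintro a ha hav (h | h)
      · exact hl.vert_green_ne h1 a (h.trans ha.symm)
      · exact (hgreen a hav).2 h
    have i1 := hx1 _ s1 g1
    have i2 := hx0 _ s2 g2
    rw [hu, hl.star_vert h1] at i1
    rw [← hk, cob_apply] at i1 i2
    rw [← huu, hkk _ _ (hgr a2 huu.symm s2) (hgr a1 rfl s1)] at i2
    rw [i2] at i1
    exact zero_ne_one i1
  -- one side of the cut contains no edge, and each of its vertices has the given star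
  have hne : ∃ b, h' (M'.vert b) ≠ h' (M'.vert (M'.mate .green b)) := by
    obtain ⟨a, rfl⟩ := M.vert_surj v
    obtain ⟨b, hb⟩ := hl'.surj (l a)
    refine ⟨b, fun h => ?_⟩
    have := hl.star_vert h1 a
    rw [← hh', ← hb, cob_apply, h, CharTwo.add_self_eq_zero] at this
    exact zero_ne_one this
  have hc : ∃ s : M'.Vertex, ∀ b, M'.vert b = s → hl.star v (l' b) ≠ 0 := by
    obtain ⟨b, hb⟩ := hne
    have : ∃ c : ZMod 2, ∀ b, hl.star v (l' b) = 0 → h' (M'.vert b) ≠ c := by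
      by_contra! hcon
      obtain ⟨b0, hb0, hb0'⟩ := hcon 1
      obtain ⟨b1, hb1, hb1'⟩ := hcon 0
      exact hside b0 b1 hb0 hb1 hb0' hb1'
    obtain ⟨c, hc⟩ := this
    have z2 : ∀ c p q : ZMod 2, p ≠ q → p = c ∨ q = c := by decide
    rcases z2 c _ _ hb with h | h
    · exact ⟨_, fun b' hb' h0 => hc b' h0 (by rw [hb', h])⟩
    · exact ⟨_, fun b' hb' h0 => hc b' h0 (by rw [hb', h])⟩
  obtain ⟨s, hs⟩ := hc
  refine ⟨s, ?_⟩
  obtain ⟨k, hk⟩ := hl.exists_cob (hL.symm ▸ hl'.star_mem s : hl'.star s ∈ cuts (M.labelSpace l))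
  have hkk : ∀ p q, p ≠ v → q ≠ v → k p = k q := by
    intro p q hp hq
    refine reachable_ind (P := fun q => k p = k q) rfl (fun p' q' hpq hp' => ?_)
      (T.reachable (u := v) (v := v) (x := p) (y := q) (by simpa using hp) (by simpa using hq))
    obtain ⟨-, n1, n2, y, rfl, rfl⟩ := hpq
    have hyv := hl.star_eq_zero (v := v) (a := y) (by simpa using n1) (by simpa using n2)
    have : hl'.star s (l y) = 0 := by
      by_contra hne
      obtain ⟨b, hb, hby⟩ := hl'.exists_of_star_ne_zero hne
      exact hs b hb (by rw [hby, hyv])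
    rw [← hk, cob_apply] at this
    rw [hp', CharTwo.add_eq_zero.1 this]
  have hkv : ∀ p, p ≠ v → k p ≠ k v := by
    intro p hp hpv
    have hall : ∀ q, k q = k v := fun q => by
      by_cases hq : q = v
      · rw [hq]
      · rw [hkk q p hq hp, hpv]
    obtain ⟨b, rfl⟩ := M'.vert_surj s
    have := hl'.star_vert h1' b
    obtain ⟨a, ha⟩ := hl.surj (l' b)
    rw [← hk, ← ha, cob_apply, hall, hall (M.vert (M.mate .green a)),
      CharTwo.add_self_eq_zero] at this
    exact zero_ne_one this
  have z2 : ∀ p q : ZMod 2, p ≠ q → p + q = 1 := by decide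
  rw [← hk]
  funext e
  obtain ⟨a, rfl⟩ := hl.surj e
  rw [cob_apply]
  by_cases ha : M.vert a = v
  · rw [← ha, hl.star_vert h1, ha]
    exact z2 _ _ fun h => hkv _ (fun hh => hl.vert_green_ne h1 a (hh.trans ha.symm)) h.symm
  · by_cases hga : M.vert (M.mate .green a) = v
    · rw [hga, ← hl.green a, ← hga, hl.star_vert h1]
      rw [hga]
      exact z2 _ _ (hkv _ ha)
    · rw [hl.star_eq_zero ha hga, hkk _ _ ha hga, CharTwo.add_self_eq_zero]

end CombinatorialMap.IsLabelling

/-! ### Menger's theorem for two walks -/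

namespace SimpleGraph

variable {W : Type*}

/-- The vertices that can be reached from `S` without meeting `c`. -/
def reachedAvoiding (G : SimpleGraph W) (S : Set W) (c : W) : Set W :=
  {w | ∃ s ∈ S, ∃ p : G.Walk s w, c ∉ p.support}

theorem mem_reachedAvoiding_of_mem_support {G : SimpleGraph W} {S : Set W} {c s t w : W}
    (hs : s ∈ S) (p : G.Walk s t) (hp : c ∉ p.support) (hw : w ∈ p.support) :
    w ∈ G.reachedAvoiding S c := by
  classical
  exact ⟨s, hs, p.takeUntil w hw, fun h => hp (p.support_takeUntil_subset_support hw h)⟩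

theorem mem_reachedAvoiding_of_adj {G : SimpleGraph W} {S : Set W} {c v w : W}
    (hv : v ∈ G.reachedAvoiding S c) (h : G.Adj v w) (hw : w ≠ c) :
    w ∈ G.reachedAvoiding S c := by
  obtain ⟨s, hs, p, hp⟩ := hv
  refine ⟨s, hs, p.concat h, ?_⟩
  rw [Walk.support_concat]
  simp [hp, hw.symm]

/-- If the edge `xy` leaves the set reached from `S` without `xy` and without the vertex `c`, then a
walk which leaves this set has to meet `c` or `x` before it uses the edge `xy`. -/
theorem exists_walk_deleteEdges {G : SimpleGraph W} {S : Set W} {c x y u : W}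
    (hy : y ∉ (G.deleteEdges {s(x, y)}).reachedAvoiding S c) {s t : W} (p : G.Walk s t)
    (hs : s ∈ (G.deleteEdges {s(x, y)}).reachedAvoiding S c ∨ s = c)
    (ht : t ∉ (G.deleteEdges {s(x, y)}).reachedAvoiding S c) (hu : u ∉ p.support) :
    ∃ w ∈ ({c, x} : Set W), ∃ q : (G.deleteEdges {s(x, y)}).Walk s w, u ∉ q.support := by
  induction p with
  | nil =>
    obtain rfl := hs.resolve_left ht
    exact ⟨_, Or.inl rfl, Walk.nil, hu⟩
  | @cons s s' t h p ih =>
    rw [Walk.support_cons, List.mem_cons, not_or] at hu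
    by_cases hsc : s = c
    · subst hsc
      exact ⟨_, Or.inl rfl, Walk.nil, by simpa using hu.1⟩
    by_cases hsx : s = x
    · subst hsx
      exact ⟨_, Or.inr rfl, Walk.nil, by simpa using hu.1⟩
    have hsR := hs.resolve_right hsc
    have hadj : (G.deleteEdges {s(x, y)}).Adj s s' := by
      rw [deleteEdges_adj]
      refine ⟨h, fun he => ?_⟩
      rw [Set.mem_singleton_iff, Sym2.eq_iff] at he
      rcases he with ⟨rfl, rfl⟩ | ⟨rfl, rfl⟩
      · exact hsx rfl
      · exact hy hsR
    have hs' : s' ∈ (G.deleteEdges {s(x, y)}).reachedAvoiding S c ∨ s' = c := by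
      by_cases hc : s' = c
      · exact Or.inr hc
      · exact Or.inl (mem_reachedAvoiding_of_adj hsR hadj hc)
    obtain ⟨w, hw, q, hq⟩ := ih hs' ht hu.2
    exact ⟨w, hw, Walk.cons hadj q, by simp [hu.1, hq]⟩

/-- **Menger's theorem** for two walks between two sets of vertices, proved by induction on the
number of edges: if `c` separates `S` from `T` once an edge `xy` is deleted, then the induction
hypothesis applies to `S` and `{c, x}`, and to `T` and `{c, y}`. -/
theorem exists_two_disjoint_walks [Finite W] [Nonempty W] (G : SimpleGraph W) (S T : Set W)
    (h : ∀ x, ∃ s ∈ S, ∃ t ∈ T, ∃ p : G.Walk s t, x ∉ p.support) :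
    ∃ s₁ ∈ S, ∃ t₁ ∈ T, ∃ s₂ ∈ S, ∃ t₂ ∈ T, ∃ p₁ : G.Walk s₁ t₁, ∃ p₂ : G.Walk s₂ t₂,
      ∀ w, w ∈ p₁.support → w ∉ p₂.support := by
  classical
  induction hn : G.edgeSet.ncard using Nat.strong_induction_on generalizing G S T with
  | _ n ih =>
  by_cases hbot : G.edgeSet = ∅
  · have hw : ∀ s t, G.Walk s t → s = t := by
      intro s t p
      cases p with
      | nil => rfl
      | cons h _ => exact absurd (show s(_, _) ∈ G.edgeSet from h) (by rw [hbot]; exact fun h => h)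
    obtain ⟨s₁, hs₁, t₁, ht₁, p₁, -⟩ := h (Classical.arbitrary W)
    obtain ⟨s₂, hs₂, t₂, ht₂, p₂, hp₂⟩ := h s₁
    obtain rfl := hw _ _ p₁
    obtain rfl := hw _ _ p₂
    refine ⟨s₁, hs₁, s₁, ht₁, s₂, hs₂, s₂, ht₂, Walk.nil, Walk.nil, fun w hw hw' => ?_⟩
    rw [Walk.mem_support_nil_iff] at hw hw'
    exact hp₂ (by rw [← hw, hw']; exact Walk.start_mem_support _)
  obtain ⟨e, he⟩ := Set.nonempty_iff_ne_empty.2 hbot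
  induction e using Sym2.ind with
  | _ x₀ y₀ =>
  set G' := G.deleteEdges {s(x₀, y₀)} with hG'
  have hle : G' ≤ G := deleteEdges_le _
  have hlt : G'.edgeSet.ncard < n := by
    rw [← hn]
    refine Set.ncard_lt_ncard ⟨edgeSet_mono hle, fun hh => ?_⟩ (Set.toFinite _)
    have := hh he
    rw [hG', edgeSet_deleteEdges] at this
    exact this.2 rfl
  by_cases hG'h : ∀ x, ∃ s ∈ S, ∃ t ∈ T, ∃ p : G'.Walk s t, x ∉ p.support
  · obtain ⟨s₁, hs₁, t₁, ht₁, s₂, hs₂, t₂, ht₂, p₁, p₂, hp⟩ := ih _ hlt G' S T hG'h rfl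
    exact ⟨s₁, hs₁, t₁, ht₁, s₂, hs₂, t₂, ht₂, p₁.mapLe hle, p₂.mapLe hle, by
      simpa [Walk.support_mapLe_eq_support] using hp⟩
  push Not at hG'h
  obtain ⟨c, hc⟩ := hG'h
  -- the sides of `c` in the graph without the edge
  set R := G'.reachedAvoiding S c with hR
  set R' := G'.reachedAvoiding T c with hR'
  have hRR : ∀ w ∈ R, w ∉ R' := by
    rintro w ⟨s, hs, p, hp⟩ ⟨t, ht, q, hq⟩
    have := hc s hs t ht (p.append q.reverse)
    rw [Walk.mem_support_append_iff, Walk.support_reverse, List.mem_reverse] at this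
    exact this.elim hp hq
  have hSR : ∀ s ∈ S, s ∈ R ∨ s = c := fun s hs => by
    by_cases h : s = c
    · exact Or.inr h
    · exact Or.inl ⟨s, hs, Walk.nil, by simpa using fun h' => h h'.symm⟩
  have hTR : ∀ t ∈ T, t ∈ R' ∨ t = c := fun t ht => by
    by_cases h : t = c
    · exact Or.inr h
    · exact Or.inl ⟨t, ht, Walk.nil, by simpa using fun h' => h h'.symm⟩
  have hcR : c ∉ R := fun ⟨_, _, p, hp⟩ => hp p.end_mem_support
  have hcR' : c ∉ R' := fun ⟨_, _, p, hp⟩ => hp p.end_mem_support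
  have hTnR : ∀ t ∈ T, t ∉ R := fun t ht htR => (hTR t ht).elim (hRR t htR) fun h => hcR (h ▸ htR)
  have hSnR : ∀ s ∈ S, s ∉ R' := fun s hs hsR =>
    (hSR s hs).elim (fun h => hRR s h hsR) fun h => hcR' (h ▸ hsR)
  obtain ⟨s₀, hs₀, t₀, ht₀, p₀, hp₀⟩ := h c
  have hs₀R : s₀ ∈ R := (hSR s₀ hs₀).resolve_right fun h => hp₀ (h ▸ p₀.start_mem_support)
  have ht₀R : t₀ ∈ R' := (hTR t₀ ht₀).resolve_right fun h => hp₀ (h ▸ p₀.end_mem_support)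
  obtain ⟨x, y, hxy, hxR, hyR⟩ : ∃ x y, s(x, y) = s(x₀, y₀) ∧ x ∈ R ∧ y ∉ R := by
    obtain ⟨d, hd, h1, h2⟩ := p₀.exists_boundary_dart R hs₀R (hTnR t₀ ht₀)
    refine ⟨d.fst, d.snd, ?_, h1, h2⟩
    by_contra hne
    refine h2 (mem_reachedAvoiding_of_adj h1 ?_ fun hh => ?_)
    · rw [hG', deleteEdges_adj]
      exact ⟨d.adj, hne⟩
    · exact hp₀ (hh ▸ p₀.dart_snd_mem_support_of_mem_darts hd)
  have hyR' : y ∈ R' := by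
    obtain ⟨d, hd, h1, h2⟩ := p₀.exists_boundary_dart R'ᶜ (hSnR s₀ hs₀) (fun h => h ht₀R)
    have h2 : d.snd ∈ R' := by simpa using h2
    by_contra hyn
    by_cases hne : s(d.fst, d.snd) = s(x, y)
    · rw [Sym2.eq_iff] at hne
      rcases hne with ⟨-, hh⟩ | ⟨-, hh⟩
      · exact hyn (hh ▸ h2)
      · exact hRR x hxR (hh ▸ h2)
    · refine h1 (mem_reachedAvoiding_of_adj h2 ?_ fun hh => ?_)
      · rw [hG', deleteEdges_adj, ← hxy]
        exact ⟨d.adj.symm, fun hh => hne (by rw [Sym2.eq_swap]; exact hh)⟩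
      · exact hp₀ (hh ▸ p₀.dart_fst_mem_support_of_mem_darts hd)
  have hadj : G.Adj x y := by
    rw [← hxy] at he
    exact he
  have hxR' := hRR x hxR
  have hcx : c ≠ x := fun h => hcR (h ▸ hxR)
  have hcy : c ≠ y := fun h => hcR' (h ▸ hyR')
  rw [← hxy] at hG'
  have hS : ∀ u, ∃ s ∈ S, ∃ t ∈ ({c, x} : Set W), ∃ p : G'.Walk s t, u ∉ p.support := by
    intro u
    obtain ⟨s, hs, t, ht, p, hp⟩ := h u
    rw [hG'] at hR ⊢
    obtain ⟨w, hw, q, hq⟩ := exists_walk_deleteEdges (hR ▸ hyR) p (hR ▸ hSR s hs)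
      (hR ▸ hTnR t ht) hp
    exact ⟨s, hs, w, hw, q, hq⟩
  have hT : ∀ u, ∃ s ∈ T, ∃ t ∈ ({c, y} : Set W), ∃ p : G'.Walk s t, u ∉ p.support := by
    intro u
    obtain ⟨s, hs, t, ht, p, hp⟩ := h u
    rw [Sym2.eq_swap] at hG'
    rw [hG'] at hR' ⊢
    obtain ⟨w, hw, q, hq⟩ := exists_walk_deleteEdges (hR' ▸ hxR') p.reverse
      (hR' ▸ hTR t ht) (hR' ▸ hSnR s hs) (by simpa using hp)
    exact ⟨t, ht, w, hw, q, hq⟩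
  have pick : ∀ (S : Set W) (x : W), c ≠ x →
      (∀ u, ∃ s ∈ S, ∃ t ∈ ({c, x} : Set W), ∃ p : G'.Walk s t, u ∉ p.support) →
      ∃ s₁ ∈ S, ∃ s₂ ∈ S, ∃ p₁ : G'.Walk s₁ c, ∃ p₂ : G'.Walk s₂ x, p₁.IsPath ∧
        ∀ w, w ∈ p₁.support → w ∉ p₂.support := by
    intro S x hcx hS
    obtain ⟨s₁, hs₁, t₁, ht₁, s₂, hs₂, t₂, ht₂, p₁, p₂, hp⟩ := ih _ hlt G' S {c, x} hS rfl
    have ht : t₁ ≠ t₂ := fun h => hp t₁ p₁.end_mem_support (h ▸ p₂.end_mem_support)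
    rcases ht₁ with rfl | rfl <;> rcases ht₂ with rfl | rfl
    · exact absurd rfl ht
    · exact ⟨s₁, hs₁, s₂, hs₂, p₁.bypass, p₂, p₁.bypass_isPath, fun w hw =>
        hp w (p₁.support_bypass_subset_support hw)⟩
    · exact ⟨s₂, hs₂, s₁, hs₁, p₂.bypass, p₁, p₂.bypass_isPath, fun w hw hw' =>
        hp w hw' (p₂.support_bypass_subset_support hw)⟩
    · exact absurd rfl ht
  obtain ⟨s₁, hs₁, s₂, hs₂, p₁, p₂, hp₁, hp⟩ := pick S x hcx hS
  obtain ⟨t₁, ht₁, t₂, ht₂, q₁, q₂, hq₁, hq⟩ := pick T y hcy hT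
  have path_mem : ∀ (S : Set W) (s : W), s ∈ S → ∀ p : G'.Walk s c, p.IsPath →
      ∀ w ∈ p.support, w ≠ c → w ∈ G'.reachedAvoiding S c := fun S s hs p hp w hw hwc =>
    ⟨s, hs, p.takeUntil w hw, Walk.endpoint_notMem_support_takeUntil hp hw hwc.symm⟩
  have hc₂ : c ∉ p₂.support := hp c p₁.end_mem_support
  have hcq₂ : c ∉ q₂.support := hq c q₁.end_mem_support
  refine ⟨s₁, hs₁, t₁, ht₁, s₂, hs₂, t₂, ht₂, (p₁.append q₁.reverse).mapLe hle,
    (p₂.mapLe hle).append (Walk.cons hadj (q₂.mapLe hle).reverse), fun w hw hw' => ?_⟩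
  rw [Walk.support_mapLe_eq_support, Walk.mem_support_append_iff, Walk.support_reverse,
    List.mem_reverse] at hw
  rw [Walk.mem_support_append_iff, Walk.support_mapLe_eq_support, Walk.support_cons,
    List.mem_cons, Walk.support_reverse, List.mem_reverse, Walk.support_mapLe_eq_support] at hw'
  have hw' : w ∈ p₂.support ∨ w ∈ q₂.support := by
    rcases hw' with h | h | h
    · exact Or.inl h
    · exact Or.inl (h ▸ p₂.end_mem_support)
    · exact Or.inr h
  rcases hw with h1 | h1 <;> rcases hw' with h2 | h2
  · exact hp w h1 h2
  · exact hRR w (path_mem S s₁ hs₁ p₁ hp₁ w h1 fun h => hcq₂ (h ▸ h2))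
      (mem_reachedAvoiding_of_mem_support ht₂ q₂ hcq₂ h2)
  · exact hRR w (mem_reachedAvoiding_of_mem_support hs₂ p₂ hc₂ h2)
      (path_mem T t₁ ht₁ q₁ hq₁ w h1 fun h => hc₂ (h ▸ h2))
  · exact hq w h1 h2

end SimpleGraph

/-! ### Cycles through a vertex or an edge -/

namespace CombinatorialMap

variable {V E : Type*}

/-- The cycles of the graph of a map, given by their sets of edges: the functions orthogonal to
the cuts. -/
def IsCycle [Fintype E] (L : Submodule (ZMod 2) ((E → ZMod 2) × (E → ZMod 2))) (ρ : E → ZMod 2) :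
    Prop :=
  ∀ γ ∈ cuts L, ∑ e, ρ e * γ e = 0

theorem notMem_of_mem_support {M : CombinatorialMap V} {S : Set M.Vertex} {x y : M.Vertex}
    (p : (M.vertexGraph S).Walk x y) (hx : x ∉ S) : ∀ w ∈ p.support, w ∉ S := by
  induction p with
  | nil =>
    intro w hw
    rw [SimpleGraph.Walk.mem_support_nil_iff] at hw
    rwa [hw]
  | cons h p ih =>
    intro w hw
    rw [SimpleGraph.Walk.support_cons, List.mem_cons] at hw
    rcases hw with rfl | hw
    · exact hx
    · exact ih h.2.2.1 w hw

namespace IsLabelling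

variable {M : CombinatorialMap V} {l : V → E} (hl : M.IsLabelling l)
include hl

/-- Every cycle is the first component of an element of the label space. -/
theorem exists_snd_of_isCycle [Fintype V] [Fintype E] {ρ : E → ZMod 2}
    (h : IsCycle (M.labelSpace l) ρ) : ∃ γ, (ρ, γ) ∈ M.labelSpace l := by
  obtain ⟨p, hp, hpρ⟩ := hl.exists_along_eq (F := ∅) (σ := ρ) fun p hp h0 => by
    have h1 : p.1 = 0 := by funext e; simpa [along] using h0 e
    have h2 : ∀ e, across ∅ p e = p.2 e := fun e => by simp [across]
    simp only [h2]
    exact h p.2 (by change ((0 : E → ZMod 2), p.2) ∈ M.labelSpace l; rwa [← h1])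
  refine ⟨p.2, ?_⟩
  have : p.1 = ρ := by rw [← hpρ]; funext e; simp [along]
  rwa [← this]

variable [Fintype E]

theorem isCycle_iff {ρ : E → ZMod 2} :
    IsCycle (M.labelSpace l) ρ ↔ ∀ h, ∑ e, ρ e * hl.cob h e = 0 := by
  refine ⟨fun h k => h _ (hl.cob_mem k), fun h γ hγ => ?_⟩
  obtain ⟨k, rfl⟩ := hl.exists_cob hγ
  exact h k

theorem sum_single_mul [DecidableEq E] (a : V) (h : M.Vertex → ZMod 2) :
    ∑ e, (Pi.single (l a) 1 : E → ZMod 2) e * hl.cob h e =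
      h (M.vert a) + h (M.vert (M.mate .green a)) := by
  rw [← hl.cob_apply h a]
  simp [Pi.single_apply]

/-- The edges of a walk form a set whose boundary consists of the two ends of the walk. -/
theorem exists_walk_sum {S : Set M.Vertex} {x y : M.Vertex} (p : (M.vertexGraph S).Walk x y) :
    ∃ ρ : E → ZMod 2, (∀ h, ∑ e, ρ e * hl.cob h e = h x + h y) ∧
      ∀ a, ρ (l a) ≠ 0 → M.vert a ∈ p.support := by
  classical
  induction p with
  | nil => exact ⟨0, fun h => by simp [CharTwo.add_self_eq_zero], fun a ha => absurd rfl ha⟩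
  | @cons x x' y hxx p ih =>
    obtain ⟨ρ, h1, h2⟩ := ih
    obtain ⟨-, -, -, a, ha, hga⟩ := id hxx
    subst ha hga
    refine ⟨ρ + Pi.single (l a) 1, fun h => ?_, fun b hb => ?_⟩
    · simp only [Pi.add_apply, add_mul, Finset.sum_add_distrib, h1, hl.sum_single_mul]
      grind
    · rw [SimpleGraph.Walk.support_cons, List.mem_cons]
      by_cases hba : l b = l a
      · rcases hl.vert_of_label_eq hba with h | h
        · exact Or.inl h
        · rw [h]; exact Or.inr p.start_mem_support
      · rw [Pi.add_apply, Pi.single_eq_of_ne hba, add_zero] at hb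
        exact Or.inr (h2 b hb)

/-- A walk between two neighbours of a vertex `v` which does not meet `v` can be completed to a
cycle. -/
theorem exists_cycle_of_walk {S : Set M.Vertex} {v : M.Vertex} {a b : V} (ha : M.vert a = v)
    (hb : M.vert b = v) (hab : l a ≠ l b)
    (p : (M.vertexGraph S).Walk (M.vert (M.mate .green a)) (M.vert (M.mate .green b)))
    (hp : v ∉ p.support) :
    ∃ ρ : E → ZMod 2, IsCycle (M.labelSpace l) ρ ∧
      (∀ x, M.vert x = v → (ρ (l x) ≠ 0 ↔ l x = l a ∨ l x = l b)) ∧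
      ∀ x, M.vert x ≠ v → ρ (l x) ≠ 0 → M.vert x ∈ p.support := by
  classical
  obtain ⟨ρ, h1, h2⟩ := hl.exists_walk_sum p
  refine ⟨ρ + Pi.single (l a) 1 + Pi.single (l b) 1, ?_, fun x hx => ?_, fun x hx hρ => ?_⟩
  · rw [hl.isCycle_iff]
    intro h
    simp only [Pi.add_apply, add_mul, Finset.sum_add_distrib, h1, hl.sum_single_mul, ha, hb]
    grind
  · have h0 : ρ (l x) = 0 := by
      by_contra hne
      exact hp (hx ▸ h2 x hne)
    simp only [Pi.add_apply, Pi.single_apply, h0]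
    by_cases e1 : l x = l a
    · simp [e1, hab]
    · simp [e1]
  · by_cases e1 : l x = l a
    · rcases hl.vert_of_label_eq e1 with h | h
      · exact absurd (h.trans ha) hx
      · rw [h]; exact p.start_mem_support
    by_cases e2 : l x = l b
    · rcases hl.vert_of_label_eq e2 with h | h
      · exact absurd (h.trans hb) hx
      · rw [h]; exact p.end_mem_support
    rw [Pi.add_apply, Pi.add_apply, Pi.single_eq_of_ne e1, Pi.single_eq_of_ne e2, add_zero,
      add_zero] at hρ
    exact h2 x hρ

/-- A walk from a neighbour of one end of an edge to a neighbour of the other end which avoids both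
ends can be completed to a cycle through the edge. -/
theorem exists_cycle_of_walk_of_edge {S : Set M.Vertex} {a b c : V}
    (hne : M.vert (M.mate .green a) ≠ M.vert a)
    (hb : M.vert b = M.vert a) (hc : M.vert c = M.vert (M.mate .green a))
    (hba : l b ≠ l a) (hca : l c ≠ l a)
    (p : (M.vertexGraph S).Walk (M.vert (M.mate .green b)) (M.vert (M.mate .green c)))
    (hp : M.vert a ∉ p.support) (hp' : M.vert (M.mate .green a) ∉ p.support) :
    ∃ ρ : E → ZMod 2, IsCycle (M.labelSpace l) ρ ∧
      (∀ x, M.vert x = M.vert a → (ρ (l x) ≠ 0 ↔ l x = l a ∨ l x = l b)) ∧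
      (∀ x, M.vert x = M.vert (M.mate .green a) → (ρ (l x) ≠ 0 ↔ l x = l a ∨ l x = l c)) ∧
      ∀ x, M.vert x ≠ M.vert a → M.vert x ≠ M.vert (M.mate .green a) → ρ (l x) ≠ 0 →
        M.vert x ∈ p.support := by
  classical
  obtain ⟨ρ, h1, h2⟩ := hl.exists_walk_sum p
  have nb : ∀ x, M.vert x = M.vert (M.mate .green a) → l x ≠ l b := by
    intro x hx hxb
    rcases hl.vert_of_label_eq hxb with h | h
    · exact hne (hx.symm.trans (h.trans hb))
    · exact hp' (by rw [← hx, h]; exact p.start_mem_support)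
  have nc : ∀ x, M.vert x = M.vert a → l x ≠ l c := by
    intro x hx hxc
    rcases hl.vert_of_label_eq hxc with h | h
    · exact hne (hc.symm.trans (h.symm.trans hx))
    · exact hp (by rw [← hx, h]; exact p.end_mem_support)
  refine ⟨ρ + Pi.single (l a) 1 + Pi.single (l b) 1 + Pi.single (l c) 1, ?_, fun x hx => ?_,
    fun x hx => ?_, fun x hx hx' hρ => ?_⟩
  · rw [hl.isCycle_iff]
    intro h
    simp only [Pi.add_apply, add_mul, Finset.sum_add_distrib, h1, hl.sum_single_mul, hb, hc]
    grind
  · have h0 : ρ (l x) = 0 := by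
      by_contra hne
      exact hp (hx ▸ h2 x hne)
    simp only [Pi.add_apply, Pi.single_apply, h0, nc x hx]
    by_cases e1 : l x = l a
    · simp [e1, hba.symm]
    · simp [e1]
  · have h0 : ρ (l x) = 0 := by
      by_contra hne
      exact hp' (hx ▸ h2 x hne)
    simp only [Pi.add_apply, Pi.single_apply, h0, nb x hx]
    by_cases e1 : l x = l a
    · simp [e1, hca.symm]
    · simp [e1]
  · have e0 : l x ≠ l a := fun h => (hl.vert_of_label_eq h).elim hx hx'
    by_cases e1 : l x = l b
    · rcases hl.vert_of_label_eq e1 with h | h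
      · exact absurd (h.trans hb) hx
      · rw [h]; exact p.start_mem_support
    by_cases e2 : l x = l c
    · rcases hl.vert_of_label_eq e2 with h | h
      · exact absurd (h.trans hc) hx'
      · rw [h]; exact p.end_mem_support
    rw [Pi.add_apply, Pi.add_apply, Pi.add_apply, Pi.single_eq_of_ne e0, Pi.single_eq_of_ne e1,
      Pi.single_eq_of_ne e2, add_zero, add_zero, add_zero] at hρ
    exact h2 x hρ

end IsLabelling

/-- The cycles `ρ₁`, `ρ₂` meet only in the vertex `v`, where `ρ₁` passes through the edges `e` and
`f` and `ρ₂` through `g` and `h`. -/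
def IsLinkage [Fintype E] (M : CombinatorialMap V) (l : V → E) (v : M.Vertex) (e f g h : E)
    (ρ₁ ρ₂ : E → ZMod 2) : Prop :=
  IsCycle (M.labelSpace l) ρ₁ ∧ IsCycle (M.labelSpace l) ρ₂ ∧
    (∀ x, M.vert x = v → (ρ₁ (l x) ≠ 0 ↔ l x = e ∨ l x = f)) ∧
    (∀ x, M.vert x = v → (ρ₂ (l x) ≠ 0 ↔ l x = g ∨ l x = h)) ∧
    ∀ x y, M.vert x = M.vert y → M.vert x ≠ v → ρ₁ (l x) ≠ 0 → ρ₂ (l y) = 0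

/-- A theta graph formed by three paths between the ends of the edge `e`, one of which is this
edge. It is given by two cycles through `e`. At the end `v` they leave `e` for the edges `f₁`, `f₂`
and at the end `w` for `g₁`, `g₂`. -/
def IsTheta [Fintype E] (M : CombinatorialMap V) (l : V → E) (v w : M.Vertex)
    (e f₁ f₂ g₁ g₂ : E) (ρ₁ ρ₂ : E → ZMod 2) : Prop :=
  IsCycle (M.labelSpace l) ρ₁ ∧ IsCycle (M.labelSpace l) ρ₂ ∧
    (∀ x, M.vert x = v → (ρ₁ (l x) ≠ 0 ↔ l x = e ∨ l x = f₁)) ∧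
    (∀ x, M.vert x = v → (ρ₂ (l x) ≠ 0 ↔ l x = e ∨ l x = f₂)) ∧
    (∀ x, M.vert x = w → (ρ₁ (l x) ≠ 0 ↔ l x = e ∨ l x = g₁)) ∧
    (∀ x, M.vert x = w → (ρ₂ (l x) ≠ 0 ↔ l x = e ∨ l x = g₂)) ∧
    ∀ x y, M.vert x = M.vert y → M.vert x ≠ v → M.vert x ≠ w → ρ₁ (l x) ≠ 0 → ρ₂ (l y) = 0

namespace IsLabelling

variable {M : CombinatorialMap V} {l : V → E} {hl : M.IsLabelling l}

theorem IsThreeConnected.vert_green_ne (T : hl.IsThreeConnected) (a : V) :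
    M.vert (M.mate .green a) ≠ M.vert a :=
  hl.vert_green_ne T.noLoopColoop a

variable [Finite V] [Fintype E]

/-- Four edges at a vertex `v` can be linked in two pairs without pairing the first edge with the
second one: Menger's theorem in the graph without `v`, which is 2-connected, joins the far ends of
the first two edges to those of the other two by disjoint walks. -/
theorem IsThreeConnected.exists_isLinkage (T : hl.IsThreeConnected) {a b c d : V}
    (hb : M.vert b = M.vert a) (hc : M.vert c = M.vert a) (hd : M.vert d = M.vert a)
    (hab : l a ≠ l b) (hac : l a ≠ l c) (had : l a ≠ l d) (hbc : l b ≠ l c) (hbd : l b ≠ l d)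
    (hcd : l c ≠ l d) :
    (∃ ρ₁ ρ₂, IsLinkage M l (M.vert a) (l a) (l c) (l b) (l d) ρ₁ ρ₂) ∨
      ∃ ρ₁ ρ₂, IsLinkage M l (M.vert a) (l a) (l d) (l b) (l c) ρ₁ ρ₂ := by
  set v := M.vert a with hv
  have : Nonempty M.Vertex := ⟨v⟩
  have hg : ∀ x, M.vert x = v → M.vert (M.mate .green x) ≠ v := fun x hx =>
    hx ▸ T.vert_green_ne x
  have pick : ∀ (x y : V), M.vert x = v → M.vert y = v → l x ≠ l y → ∀ u,
      ∃ s ∈ ({M.vert (M.mate .green x), M.vert (M.mate .green y)} : Set M.Vertex),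
        s ∉ ({v, u} : Set M.Vertex) := by
    intro x y hx hy hxy u
    by_cases hu : M.vert (M.mate .green x) = u
    · refine ⟨_, Or.inr rfl, ?_⟩
      rintro (h | h)
      · exact hg y hy h
      · exact hxy (T.label_eq (hx.trans hy.symm) (hu.trans h.symm))
    · refine ⟨_, Or.inl rfl, ?_⟩
      rintro (h | h)
      · exact hg x hx h
      · exact hu h
  obtain ⟨s₁, hs₁, t₁, ht₁, s₂, hs₂, t₂, ht₂, p₁, p₂, hp⟩ :=
    SimpleGraph.exists_two_disjoint_walks (M.vertexGraph {v})
      {M.vert (M.mate .green a), M.vert (M.mate .green b)}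
      {M.vert (M.mate .green c), M.vert (M.mate .green d)} fun u => by
        obtain ⟨s, hs, hs'⟩ := pick a b rfl hb hab u
        obtain ⟨t, ht, ht'⟩ := pick c d hc hd hcd u
        obtain ⟨p⟩ := T.reachable hs' ht'
        have hle : M.vertexGraph {v, u} ≤ M.vertexGraph {v} := fun x y hxy =>
          ⟨hxy.1, fun h => hxy.2.1 (Or.inl h), fun h => hxy.2.2.1 (Or.inl h), hxy.2.2.2⟩
        refine ⟨s, hs, t, ht, p.mapLe hle, fun h => ?_⟩
        rw [SimpleGraph.Walk.support_mapLe_eq_support] at h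
        exact notMem_of_mem_support p hs' u h (Or.inr rfl)
  -- it is enough to close up two disjoint walks
  have close : ∀ x x' y y' : V, M.vert x = v → M.vert x' = v → M.vert y = v → M.vert y' = v →
      l x ≠ l y → l x' ≠ l y' →
      ∀ (p : (M.vertexGraph {v}).Walk (M.vert (M.mate .green x)) (M.vert (M.mate .green y)))
        (q : (M.vertexGraph {v}).Walk (M.vert (M.mate .green x')) (M.vert (M.mate .green y'))),
      (∀ w, w ∈ p.support → w ∉ q.support) →
      ∃ ρ₁ ρ₂, IsLinkage M l v (l x) (l y) (l x') (l y') ρ₁ ρ₂ := by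
    intro x x' y y' hx hx' hy hy' hxy hxy' p q hpq
    obtain ⟨ρ₁, h1, h2, h3⟩ := hl.exists_cycle_of_walk hx hy hxy p fun h =>
      notMem_of_mem_support p (hg x hx) v h rfl
    obtain ⟨ρ₂, k1, k2, k3⟩ := hl.exists_cycle_of_walk hx' hy' hxy' q fun h =>
      notMem_of_mem_support q (hg x' hx') v h rfl
    refine ⟨ρ₁, ρ₂, h1, k1, h2, k2, fun i j hij hi hi1 => ?_⟩
    by_contra hj
    exact hpq _ (h3 i hi hi1) (hij ▸ k3 j (hij ▸ hi) hj)
  have hs : s₁ ≠ s₂ := fun h => hp s₁ p₁.start_mem_support (h ▸ p₂.start_mem_support)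
  have ht : t₁ ≠ t₂ := fun h => hp t₁ p₁.end_mem_support (h ▸ p₂.end_mem_support)
  have hp' : ∀ w, w ∈ p₂.support → w ∉ p₁.support := fun w h h' => hp w h' h
  rcases hs₁ with rfl | rfl <;> rcases hs₂ with rfl | rfl <;> rcases ht₁ with rfl | rfl <;>
    rcases ht₂ with rfl | rfl
  all_goals first | exact absurd rfl hs | exact absurd rfl ht | skip
  · exact Or.inl (close a b c d rfl hb hc hd hac hbd p₁ p₂ hp)
  · exact Or.inr (close a b d c rfl hb hd hc had hbc p₁ p₂ hp)
  · exact Or.inr (close a b d c rfl hb hd hc had hbc p₂ p₁ hp')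
  · exact Or.inl (close a b c d rfl hb hc hd hac hbd p₂ p₁ hp')

/-- Every edge is part of a theta graph: after deletion of its ends `v` and `w`, two disjoint walks
lead from the other neighbours of `v` to those of `w`. A single vertex `u` cannot block all such
walks, since a walk from a neighbour of `v` to `w` which avoids `v` and `u` can be stopped just
before it arrives at `w`. -/
theorem IsThreeConnected.exists_isTheta (T : hl.IsThreeConnected) (a : V) :
    ∃ b₁ b₂ c₁ c₂ : V, M.vert b₁ = M.vert a ∧ M.vert b₂ = M.vert a ∧
      M.vert c₁ = M.vert (M.mate .green a) ∧ M.vert c₂ = M.vert (M.mate .green a) ∧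
      l b₁ ≠ l a ∧ l b₂ ≠ l a ∧ l c₁ ≠ l a ∧ l c₂ ≠ l a ∧ l b₁ ≠ l b₂ ∧ l c₁ ≠ l c₂ ∧
      l b₂ ≠ l c₂ ∧ ∃ ρ₁ ρ₂, IsTheta M l (M.vert a) (M.vert (M.mate .green a)) (l a) (l b₁) (l b₂)
        (l c₁) (l c₂) ρ₁ ρ₂ := by
  set v := M.vert a with hv
  set w := M.vert (M.mate .green a) with hw
  have hwv : w ≠ v := T.vert_green_ne a
  have : Nonempty M.Vertex := ⟨v⟩
  set S : Set M.Vertex := {s | ∃ b, M.vert b = v ∧ l b ≠ l a ∧ M.vert (M.mate .green b) = s} with hS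
  set U : Set M.Vertex := {s | ∃ c, M.vert c = w ∧ l c ≠ l a ∧ M.vert (M.mate .green c) = s} with hU
  have hSvw : ∀ s ∈ S, s ∉ ({v, w} : Set M.Vertex) := by
    rintro s ⟨b, hb, hba, rfl⟩ (h | h)
    · exact T.vert_green_ne b (h.trans hb.symm)
    · exact hba (T.label_eq hb h)
  have main : ∀ u, u ≠ w → ∃ s ∈ S, ∃ t ∈ U, ∃ p : (M.vertexGraph {v, w}).Walk s t,
      u ∉ p.support := by
    intro u huw
    have hs : ∃ s ∈ S, s ≠ u := by
      have h1 : M.vert (M.mate .green (M.mate .black a)) ∈ S :=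
        ⟨_, M.vert_black a, hl.label_black_ne T.noLoopColoop a, rfl⟩
      have h2 : M.vert (M.mate .green (M.mate .black (M.mate .red a))) ∈ S := by
        refine ⟨_, by rw [vert_black, vert_red], fun h => ?_, rfl⟩
        exact hl.label_black_ne T.noLoopColoop (M.mate .red a) (h.trans (hl.red a).symm)
      by_cases hu : M.vert (M.mate .green (M.mate .black a)) = u
      · refine ⟨_, h2, fun h => T.label_black_red a (T.label_eq ?_ (h.trans hu.symm))⟩
        rw [vert_black, vert_red, vert_black]
      · exact ⟨_, h1, hu⟩
    obtain ⟨s, hs, hsu⟩ := hs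
    have hsvw := hSvw s hs
    simp only [Set.mem_insert_iff, Set.mem_singleton_iff, not_or] at hsvw
    obtain ⟨p⟩ := T.reachable (u := v) (v := u) (x := s) (y := w)
      (by simp [hsvw.1, hsu]) (by simp [hwv, huw.symm])
    -- stop the walk before it arrives at `w`
    have cut : ∀ (x y : M.Vertex) (p : (M.vertexGraph {v, u}).Walk x y), y = w → x ≠ w →
        x ≠ v → x ≠ u → ∃ t ∈ U, ∃ q : (M.vertexGraph {v, w}).Walk x t, u ∉ q.support := by
      intro x y p
      induction p with
      | nil => exact fun h h' => absurd h h'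
      | @cons x x' y h p ih =>
        intro hyw hxw hxv hxu
        have h' := h
        obtain ⟨hne, n1, n2, i, hi, hi'⟩ := h'
        simp only [Set.mem_insert_iff, Set.mem_singleton_iff, not_or] at n2
        by_cases hx'w : x' = w
        · refine ⟨x, ⟨M.mate .green i, hi'.trans hx'w, fun hh => ?_, by rw [M.mate_mate, hi]⟩,
            SimpleGraph.Walk.nil, by simpa using fun h => hxu h.symm⟩
          rw [hl.green] at hh
          rcases hl.vert_of_label_eq hh with h3 | h3
          · exact hxv (hi.symm.trans h3)
          · exact hxw (hi.symm.trans h3)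
        · obtain ⟨t, ht, q, hq⟩ := ih hyw hx'w n2.1 n2.2
          have hadj : (M.vertexGraph {v, w}).Adj x x' :=
            ⟨hne, by simp [hxv, hxw], by simp [n2.1, hx'w], i, hi, hi'⟩
          refine ⟨t, ht, SimpleGraph.Walk.cons hadj q, ?_⟩
          rw [SimpleGraph.Walk.support_cons, List.mem_cons, not_or]
          exact ⟨fun h => hxu h.symm, hq⟩
    obtain ⟨t, ht, q, hq⟩ := cut s w p rfl hsvw.2 hsvw.1 hsu
    exact ⟨s, hs, t, ht, q, hq⟩
  obtain ⟨s₁, ⟨b₁, hb₁, hb₁a, rfl⟩, t₁, ⟨c₁, hc₁, hc₁a, rfl⟩, s₂, ⟨b₂, hb₂, hb₂a, rfl⟩, t₂,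
      ⟨c₂, hc₂, hc₂a, rfl⟩, p₁, p₂, hp⟩ :=
    SimpleGraph.exists_two_disjoint_walks (M.vertexGraph {v, w}) S U fun u => by
      by_cases huw : u = w
      · obtain ⟨s, hs, t, ht, p, -⟩ := main v hwv.symm
        exact ⟨s, hs, t, ht, p, fun h => notMem_of_mem_support p (hSvw s hs) u h (Or.inr huw)⟩
      · exact main u huw
  have n1 := notMem_of_mem_support p₁ (hSvw _ ⟨b₁, hb₁, hb₁a, rfl⟩)
  have n2 := notMem_of_mem_support p₂ (hSvw _ ⟨b₂, hb₂, hb₂a, rfl⟩)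
  obtain ⟨ρ₁, h1, h2, h3, h4⟩ := hl.exists_cycle_of_walk_of_edge hwv hb₁ hc₁ hb₁a hc₁a p₁
    (fun h => n1 _ h (Or.inl rfl)) (fun h => n1 _ h (Or.inr rfl))
  obtain ⟨ρ₂, k1, k2, k3, k4⟩ := hl.exists_cycle_of_walk_of_edge hwv hb₂ hc₂ hb₂a hc₂a p₂
    (fun h => n2 _ h (Or.inl rfl)) (fun h => n2 _ h (Or.inr rfl))
  have ends : ∀ x y : V, M.vert x = M.vert y → l x = l y →
      M.vert (M.mate .green x) = M.vert (M.mate .green y) := by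
    intro x y h h'
    rcases hl.eq_or_eq_red T.noLoopColoop h h' with rfl | rfl
    · rfl
    · rw [← M.red_green_comm, vert_red]
  refine ⟨b₁, b₂, c₁, c₂, hb₁, hb₂, hc₁, hc₂, hb₁a, hb₂a, hc₁a, hc₂a, fun h => ?_, fun h => ?_,
    fun h => ?_, ρ₁, ρ₂, h1, k1, h2, k2, h3, k3, fun x y hxy hxv hxw hx => ?_⟩
  · exact hp _ p₁.start_mem_support
      (by rw [ends b₁ b₂ (hb₁.trans hb₂.symm) h]; exact p₂.start_mem_support)
  · exact hp _ p₁.end_mem_support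
      (by rw [ends c₁ c₂ (hc₁.trans hc₂.symm) h]; exact p₂.end_mem_support)
  · rcases hl.vert_of_label_eq h with h' | h'
    · exact hwv (hc₂.symm.trans (h'.symm.trans hb₂))
    · exact n2 _ p₂.end_mem_support (Or.inl (h'.symm.trans hb₂))
  · by_contra hy
    exact hp _ (h4 x hxv hxw hx) (hxy ▸ k4 y (hxy ▸ hxv) (hxy ▸ hxw) hy)

end IsLabelling

end CombinatorialMap

/-! ### Pairings of cycles -/

namespace CombinatorialMap

variable {V V' E : Type*} {M : CombinatorialMap V} {M' : CombinatorialMap V'} {l : V → E}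
  {l' : V' → E}

namespace IsLabelling

variable {hl : M.IsLabelling l} {hl' : M'.IsLabelling l'}

/-- A pairing of a cycle `ρ₂` with the second component of a pair `(ρ₁, γ₁)` is determined near the
set `B` of vertices if `ρ₁` and `ρ₂` have no common vertex outside `B`. Subtracting a cut from `γ₁`
does not change the pairing, and the cut can be chosen so that a lift `z` of the pair is killed at
all vertices outside `B` which `ρ₁` does not meet. -/
theorem sum_mul_eq_of_disjoint [Fintype E] (hl : M.IsLabelling l) {ρ₁ ρ₂ γ₁ W : E → ZMod 2}
    {z : V → ZMod 2}
    (hρ₂ : IsCycle (M.labelSpace l) ρ₂) (hb : ∀ a, z (M.mate .black a) = z a)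
    (hr : ∀ a, z (M.mate .red a) = z a + ρ₁ (l a))
    (hg : ∀ a, z (M.mate .green a) = z a + γ₁ (l a)) (B : Set M.Vertex) [DecidablePred (· ∈ B)]
    (hB : ∀ x y, M.vert x = M.vert y → M.vert x ∉ B → ρ₁ (l x) ≠ 0 → ρ₂ (l y) = 0)
    (hW : ∀ a, W (l a) = ρ₂ (l a) * ((if M.vert a ∈ B then z a else 0) +
      if M.vert (M.mate .green a) ∈ B then z (M.mate .green a) else 0)) :
    ∑ e, ρ₂ e * γ₁ e = ∑ e, W e := by
  classical
  set k : M.Vertex → ZMod 2 := fun v =>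
    if v ∉ B ∧ ∀ y, M.vert y = v → ρ₁ (l y) = 0 then z (Function.surjInv M.vert_surj v) else 0
    with hk
  have key : ∀ x, ρ₂ (l x) ≠ 0 → z x + k (M.vert x) = if M.vert x ∈ B then z x else 0 := by
    intro x hx
    by_cases hxB : M.vert x ∈ B
    · simp [hk, hxB]
    · have h0 : ∀ y, M.vert y = M.vert x → ρ₁ (l y) = 0 := by
        intro y hy
        by_contra hne
        exact hx (hB y x hy (by rwa [hy]) hne)
      have : z (Function.surjInv M.vert_surj (M.vert x)) = z x := by
        refine M.eq_of_vert_eq (Function.surjInv_eq _ _) (fun y _ => hb y) fun y hy => ?_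
        rw [hr, h0 y (hy.trans (Function.surjInv_eq _ _)), add_zero]
      rw [hk]
      simp only
      rw [if_pos ⟨hxB, h0⟩, this, CharTwo.add_self_eq_zero, if_neg hxB]
  have h1 := hρ₂ _ (hl.cob_mem k)
  have h2 : ∑ e, ρ₂ e * γ₁ e = ∑ e, ρ₂ e * γ₁ e + ∑ e, ρ₂ e * hl.cob k e := by rw [h1, add_zero]
  rw [h2, ← Finset.sum_add_distrib]
  refine Finset.sum_congr rfl fun e _ => ?_
  obtain ⟨a, rfl⟩ := hl.surj e
  rw [hW]
  by_cases ha : ρ₂ (l a) = 0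
  · rw [ha]; ring
  · have k1 := key a ha
    have k2 := key (M.mate .green a) (by rwa [hl.green])
    rw [← k1, ← k2, hg, hl.cob_apply]
    grind

/-- The change of a lift along a green edge depends on the label only. -/
theorem add_of_label_eq (hl : M.IsLabelling l) {ρ γ : E → ZMod 2} {z : V → ZMod 2}
    (hr : ∀ a, z (M.mate .red a) = z a + ρ (l a))
    (hg : ∀ a, z (M.mate .green a) = z a + γ (l a)) {a b : V} (h : l b = l a) :
    z b + z (M.mate .green b) = z a + z (M.mate .green a) := by
  rw [hg, hg, h]
  rcases hl.fiber h with rfl | rfl | rfl | rfl <;> simp only [hr, hg, hl.green] <;> grind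

/-- A lift takes the same value at both flags of an edge at a vertex if the cycle avoids the edge.
-/
theorem eq_of_vert_label (hl : M.IsLabelling l) (h1 : NoLoopColoop (cuts (M.labelSpace l)))
    {ρ : E → ZMod 2} {z : V → ZMod 2} (hr : ∀ a, z (M.mate .red a) = z a + ρ (l a)) {a b : V}
    (hv : M.vert b = M.vert a) (h : l b = l a) (h0 : ρ (l a) = 0) : z b = z a := by
  rcases hl.eq_or_eq_red h1 hv h with rfl | rfl
  · rfl
  · rw [hr, h0, add_zero]

/-- Two cycles which meet only in one vertex: their pairing compares the values of a lift of the
first one at the two edges of the second one. -/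
theorem sum_mul_eq_of_linked [Fintype E] (hl : M.IsLabelling l)
    (h1 : NoLoopColoop (cuts (M.labelSpace l))) {ρ₁ ρ₂ γ₁ : E → ZMod 2}
    {z : V → ZMod 2} (hρ₂ : IsCycle (M.labelSpace l) ρ₂) (hb : ∀ a, z (M.mate .black a) = z a)
    (hr : ∀ a, z (M.mate .red a) = z a + ρ₁ (l a))
    (hg : ∀ a, z (M.mate .green a) = z a + γ₁ (l a)) {v : M.Vertex} {p q : V} (hp : M.vert p = v)
    (hq : M.vert q = v) (hpq : l p ≠ l q) (hp0 : ρ₁ (l p) = 0) (hq0 : ρ₁ (l q) = 0)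
    (h2 : ∀ x, M.vert x = v → (ρ₂ (l x) ≠ 0 ↔ l x = l p ∨ l x = l q))
    (hB : ∀ x y, M.vert x = M.vert y → M.vert x ≠ v → ρ₁ (l x) ≠ 0 → ρ₂ (l y) = 0) :
    ∑ e, ρ₂ e * γ₁ e = z p + z q := by
  classical
  rw [hl.sum_mul_eq_of_disjoint (W := Pi.single (l p) (z p) + Pi.single (l q) (z q)) hρ₂ hb hr hg
    {v} hB fun a => ?_]
  · simp [Finset.sum_add_distrib]
  have key : ∀ a, M.vert a = v → (Pi.single (l p) (z p) + Pi.single (l q) (z q) : E → ZMod 2) (l a)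
      = ρ₂ (l a) * z a := by
    intro a ha
    have h2a := h2 a ha
    by_cases e1 : l a = l p
    · rw [ZMod.two_eq_one_of_ne_zero (h2a.2 (Or.inl e1)),
        hl.eq_of_vert_label h1 hr (ha.trans hp.symm) e1 hp0, e1]
      simp [hpq]
    by_cases e2 : l a = l q
    · rw [ZMod.two_eq_one_of_ne_zero (h2a.2 (Or.inr e2)),
        hl.eq_of_vert_label h1 hr (ha.trans hq.symm) e2 hq0, e2]
      simp [hpq.symm]
    have : ρ₂ (l a) = 0 := by
      by_contra hne
      exact (h2a.1 hne).elim e1 e2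
    rw [this, Pi.add_apply, Pi.single_eq_of_ne e1, Pi.single_eq_of_ne e2]
    ring
  simp only [Set.mem_singleton_iff]
  by_cases ha : M.vert a = v
  · rw [key a ha, if_pos ha, if_neg (fun h => hl.vert_green_ne h1 a (Eq.trans h ha.symm)), add_zero]
  by_cases hga : M.vert (M.mate .green a) = v
  · rw [if_neg ha, if_pos hga, ← hl.green a, key _ hga, zero_add]
  rw [if_neg ha, if_neg hga, add_zero, mul_zero, Pi.add_apply, Pi.single_eq_of_ne,
    Pi.single_eq_of_ne, add_zero]
  · intro h
    rcases hl.vert_of_label_eq h.symm with h' | h'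
    · exact ha (h'.symm.trans hq)
    · exact hga (h'.symm.trans hq)
  · intro h
    rcases hl.vert_of_label_eq h.symm with h' | h'
    · exact ha (h'.symm.trans hp)
    · exact hga (h'.symm.trans hp)

/-- The pairing of the two cycles of a theta graph. -/
theorem sum_mul_eq_of_isTheta [Fintype E] (T : hl.IsThreeConnected) {ρ₁ ρ₂ γ₁ : E → ZMod 2}
    {z : V → ZMod 2} (hb : ∀ a, z (M.mate .black a) = z a)
    (hr : ∀ a, z (M.mate .red a) = z a + ρ₁ (l a))
    (hg : ∀ a, z (M.mate .green a) = z a + γ₁ (l a)) {a p q : V} {f₁ g₁ : E}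
    (hp : M.vert p = M.vert a) (hq : M.vert q = M.vert (M.mate .green a))
    (hpa : l p ≠ l a) (hqa : l q ≠ l a) (hpf : l p ≠ f₁) (hqg : l q ≠ g₁) (hpq : l p ≠ l q)
    (h : IsTheta M l (M.vert a) (M.vert (M.mate .green a)) (l a) f₁ (l p) g₁ (l q) ρ₁ ρ₂) :
    ∑ e, ρ₂ e * γ₁ e = z a + z (M.mate .green a) + z p + z q := by
  classical
  have h1 := T.noLoopColoop
  obtain ⟨-, hρ₂, t1, t2, t3, t4, hB⟩ := h
  set W : E → ZMod 2 := Pi.single (l a) (z a + z (M.mate .green a)) + Pi.single (l p) (z p) +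
    Pi.single (l q) (z q) with hW
  have hp0 : ρ₁ (l p) = 0 := by
    by_contra hne
    exact ((t1 p hp).1 hne).elim hpa hpf
  have hq0 : ρ₁ (l q) = 0 := by
    by_contra hne
    exact ((t3 q hq).1 hne).elim hqa hqg
  -- apart from the edge itself, no edge joins the two common vertices of the cycles
  have single : ∀ x, M.vert x = M.vert a → M.vert (M.mate .green x) = M.vert (M.mate .green a) →
      l x = l a := fun x h h' => T.label_eq h h'
  have Wp : W (l p) = z p := by simp [hW, hpa, hpq]
  have Wq : W (l q) = z q := by simp [hW, hqa, hpq.symm]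
  have Wa : W (l a) = z a + z (M.mate .green a) := by simp [hW, hpa.symm, hqa.symm]
  have W0 : ∀ x, l x ≠ l a → l x ≠ l p → l x ≠ l q → W (l x) = 0 := by
    intro x n1 n2 n3
    rw [hW, Pi.add_apply, Pi.add_apply, Pi.single_eq_of_ne n1, Pi.single_eq_of_ne n2,
      Pi.single_eq_of_ne n3]
    rfl
  have key₁ : ∀ x, M.vert x = M.vert a → l x ≠ l a → W (l x) = ρ₂ (l x) * z x := by
    intro x hx hxa
    by_cases e1 : l x = l p
    · rw [ZMod.two_eq_one_of_ne_zero ((t2 x hx).2 (Or.inr e1)),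
        hl.eq_of_vert_label h1 hr (hx.trans hp.symm) e1 hp0, e1, Wp, one_mul]
    have e0 : ρ₂ (l x) = 0 := by
      by_contra hne
      exact ((t2 x hx).1 hne).elim hxa e1
    rw [e0, zero_mul, W0 x hxa e1]
    intro e2
    rcases hl.vert_of_label_eq e2.symm with h | h
    · exact T.vert_green_ne a (hq.symm.trans (h.trans hx))
    · exact hxa (single x hx (h.symm.trans hq))
  have key₂ : ∀ x, M.vert x = M.vert (M.mate .green a) → l x ≠ l a →
      W (l x) = ρ₂ (l x) * z x := by
    intro x hx hxa
    by_cases e1 : l x = l q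
    · rw [ZMod.two_eq_one_of_ne_zero ((t4 x hx).2 (Or.inr e1)),
        hl.eq_of_vert_label h1 hr (hx.trans hq.symm) e1 hq0, e1, Wq, one_mul]
    have e0 : ρ₂ (l x) = 0 := by
      by_contra hne
      exact ((t4 x hx).1 hne).elim hxa e1
    rw [e0, zero_mul, W0 x hxa (fun e2 => ?_) e1]
    rcases hl.vert_of_label_eq e2.symm with h | h
    · exact T.vert_green_ne a (hx.symm.trans (h.symm.trans hp))
    · refine hxa ((hl.green x).symm.trans (single (M.mate .green x) (h.symm.trans hp) ?_))
      rw [M.mate_mate, hx]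
  have main : ∑ e, ρ₂ e * γ₁ e = ∑ e, W e := by
    refine hl.sum_mul_eq_of_disjoint hρ₂ hb hr hg {M.vert a, M.vert (M.mate .green a)}
      (fun x y hxy hx => hB x y hxy (fun h => hx (Or.inl h)) fun h => hx (Or.inr h)) fun x => ?_
    simp only [Set.mem_insert_iff, Set.mem_singleton_iff]
    by_cases hxa : l x = l a
    · have e1 : ρ₂ (l x) = 1 := by
        rw [hxa]
        exact ZMod.two_eq_one_of_ne_zero ((t2 a rfl).2 (Or.inl rfl))
      rw [if_pos (hl.vert_of_label_eq hxa), if_pos (hl.vert_of_label_eq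
        ((hl.green x).trans hxa)), hl.add_of_label_eq hr hg hxa, e1, hxa, Wa, one_mul]
    have hno : ∀ x, l x ≠ l a → (M.vert x = M.vert a ∨ M.vert x = M.vert (M.mate .green a)) →
        ¬ (M.vert (M.mate .green x) = M.vert a ∨
          M.vert (M.mate .green x) = M.vert (M.mate .green a)) := by
      rintro x hx (h | h) (h' | h')
      · exact T.vert_green_ne x (h'.trans h.symm)
      · exact hx (single x h h')
      · refine hx ((hl.green x).symm.trans (single _ h' ?_))
        rw [M.mate_mate, h]
      · exact T.vert_green_ne x (h'.trans h.symm)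
    by_cases hx : M.vert x = M.vert a ∨ M.vert x = M.vert (M.mate .green a)
    · rw [if_pos hx, if_neg (hno x hxa hx), add_zero]
      exact hx.elim (key₁ x · hxa) (key₂ x · hxa)
    by_cases hgx : M.vert (M.mate .green x) = M.vert a ∨
        M.vert (M.mate .green x) = M.vert (M.mate .green a)
    · rw [if_neg hx, if_pos hgx, zero_add, ← hl.green x]
      have hgxa : l (M.mate .green x) ≠ l a := by rwa [hl.green]
      exact hgx.elim (key₁ _ · hgxa) (key₂ _ · hgxa)
    rw [if_neg hx, if_neg hgx, add_zero, mul_zero]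
    refine W0 x hxa (fun h => ?_) fun h => ?_
    · rcases hl.vert_of_label_eq h.symm with h' | h'
      · exact hx (Or.inl (h'.symm.trans hp))
      · exact hgx (Or.inl (h'.symm.trans hp))
    · rcases hl.vert_of_label_eq h.symm with h' | h'
      · exact hx (Or.inr (h'.symm.trans hq))
      · exact hgx (Or.inr (h'.symm.trans hq))
  rw [main, hW]
  simp [Finset.sum_add_distrib]

/-- If two consecutive edges are the only edges at a vertex along which a lift `z` changes, then `z`
takes the same value at all flags of the other edges at the vertex. -/
theorem eq_of_consecutive (hl : M.IsLabelling l) (h1 : NoLoopColoop (cuts (M.labelSpace l)))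
    {ρ : E → ZMod 2} {z : V → ZMod 2} (hb : ∀ a, z (M.mate .black a) = z a)
    (hr : ∀ a, z (M.mate .red a) = z a + ρ (l a)) {a p q : V}
    (hρ : ∀ x, M.vert x = M.vert a → (ρ (l x) ≠ 0 ↔ l x = l a ∨ l x = l (M.mate .black a)))
    (hp : M.vert p = M.vert a) (hq : M.vert q = M.vert a) (hpa : l p ≠ l a)
    (hpb : l p ≠ l (M.mate .black a)) (hqa : l q ≠ l a) (hqb : l q ≠ l (M.mate .black a)) :
    z p = z q := by
  classical
  set y : V → ZMod 2 := fun x => z x + if x = a ∨ x = M.mate .black a then 1 else 0 with hy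
  have hyz : ∀ x, l x ≠ l a → l x ≠ l (M.mate .black a) → y x = z x := by
    intro x n1 n2
    rw [hy]
    simp only
    rw [if_neg, add_zero]
    rintro (rfl | rfl)
    · exact n1 rfl
    · exact n2 rfl
  have hne := hl.label_black_ne h1 a
  rw [← hyz p hpa hpb, ← hyz q hqa hqb]
  refine M.eq_of_vert_eq (hp.trans hq.symm) (fun x _ => ?_) fun x hx => ?_
  · have : (M.mate .black x = a ∨ M.mate .black x = M.mate .black a) ↔
        (x = a ∨ x = M.mate .black a) := by
      constructor
      · rintro (rfl | h)
        · rw [M.mate_mate]; exact Or.inr rfl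
        · left; rw [← M.mate_mate .black x, h, M.mate_mate]
      · rintro (rfl | rfl)
        · exact Or.inr rfl
        · rw [M.mate_mate]; exact Or.inl rfl
    simp only [hy, hb, this]
  · have hxa : M.vert x = M.vert a := hx.trans hp
    have hρx := hρ x hxa
    by_cases e1 : l x = l a
    · have hx1 := ZMod.two_eq_one_of_ne_zero (hρx.2 (Or.inl e1))
      have n2 : x ≠ M.mate .black a := fun h => hne (by rw [← h, e1])
      have n3 : M.mate .red x ≠ M.mate .black a := fun h => hne (by rw [← h, hl.red, e1])
      rcases hl.eq_or_eq_red h1 hxa e1 with rfl | rfl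
      · simp only [hy, hr, hx1, n2, n3, M.mate_ne]
        simp
      · rw [M.mate_mate] at n3
        have := hr (M.mate .red a)
        simp only [hy, M.mate_mate, n2, n3, M.mate_ne]
        rw [M.mate_mate, hx1] at this
        rw [this]
        grind
    · by_cases e2 : l x = l (M.mate .black a)
      · have hx1 := ZMod.two_eq_one_of_ne_zero (hρx.2 (Or.inr e2))
        have n2 : x ≠ a := fun h => e1 (by rw [h])
        have n3 : M.mate .red x ≠ a := fun h => e1 (by rw [← hl.red, h])
        rcases hl.eq_or_eq_red h1 (hxa.trans (M.vert_black a).symm) e2 with h | h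
        · have n4 : M.mate .red x ≠ M.mate .black a := h ▸ M.mate_ne _ _
          simp only [hy, hr, hx1, n2, n3, n4]
          simp [h]
        · have h' : M.mate .red x = M.mate .black a := by rw [h, M.mate_mate]
          have n4 : x ≠ M.mate .black a := h' ▸ (M.mate_ne _ x).symm
          have := hr x
          rw [hx1] at this
          simp only [hy, n2, n3, n4, this]
          simp [h', add_assoc, CharTwo.add_self_eq_zero]
      · have hx0 : ρ (l x) = 0 := by
          by_contra hne
          exact (hρx.1 hne).elim e1 e2
        rw [hyz x e1 e2, hyz _ (by rwa [hl.red]) (by rwa [hl.red]), hr, hx0, add_zero]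

/-- The local form of the isotropy of the label space at a vertex, for two lifts which change along
the edges of `a`, `p` and of `a`, `q`. -/
theorem local_isotropic [Fintype V] (hl : M.IsLabelling l)
    (h1 : NoLoopColoop (cuts (M.labelSpace l)))
    {ρ₁ ρ₂ : E → ZMod 2} {z₁ z₂ : V → ZMod 2} (hb₁ : ∀ a, z₁ (M.mate .black a) = z₁ a)
    (hr₁ : ∀ a, z₁ (M.mate .red a) = z₁ a + ρ₁ (l a)) (hb₂ : ∀ a, z₂ (M.mate .black a) = z₂ a)
    (hr₂ : ∀ a, z₂ (M.mate .red a) = z₂ a + ρ₂ (l a)) {a p q : V}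
    (hp : M.vert p = M.vert a) (hq : M.vert q = M.vert a) (hpa : l p ≠ l a) (hqa : l q ≠ l a)
    (hpq : l p ≠ l q)
    (hρ₁ : ∀ x, M.vert x = M.vert a → (ρ₁ (l x) ≠ 0 ↔ l x = l a ∨ l x = l p))
    (hρ₂ : ∀ x, M.vert x = M.vert a → (ρ₂ (l x) ≠ 0 ↔ l x = l a ∨ l x = l q)) :
    z₁ a + z₂ a + 1 + z₂ p + z₁ q = 0 := by
  classical
  set Y : V → ZMod 2 := fun x => if M.vert x = M.vert a then z₁ x * z₂ x else 0 with hY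
  have sY : ∑ x, Y x = 0 := sum_eq_zero_of_involution (M.mate_mate .black) (M.mate_ne .black)
    fun x => by simp only [hY, vert_black, hb₁, hb₂]
  set D : V → ZMod 2 := Pi.single a (z₁ a + z₂ a + 1) + Pi.single p (z₂ p) + Pi.single q (z₁ q)
    with hD
  have n1 : ∀ {x y}, l x ≠ l y → x ≠ y := fun h h' => h (congrArg l h')
  have Da : D a = z₁ a + z₂ a + 1 := by simp [hD, n1 hpa.symm, n1 hqa.symm]
  have Dp : D p = z₂ p := by simp [hD, n1 hpa, n1 hpq]
  have Dq : D q = z₁ q := by simp [hD, n1 hqa, n1 hpq.symm]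
  have D0 : ∀ x, x ≠ a → x ≠ p → x ≠ q → D x = 0 := by
    intro x h1 h2 h3
    rw [hD, Pi.add_apply, Pi.add_apply, Pi.single_eq_of_ne h1, Pi.single_eq_of_ne h2,
      Pi.single_eq_of_ne h3]
    rfl
  have Dra : D (M.mate .red a) = 0 := D0 _ (M.mate_ne _ _) (n1 (by rw [hl.red]; exact hpa.symm))
    (n1 (by rw [hl.red]; exact hqa.symm))
  have Drp : D (M.mate .red p) = 0 := D0 _ (n1 (by rw [hl.red]; exact hpa)) (M.mate_ne _ _)
    (n1 (by rw [hl.red]; exact hpq))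
  have Drq : D (M.mate .red q) = 0 := D0 _ (n1 (by rw [hl.red]; exact hqa))
    (n1 (by rw [hl.red]; exact hpq.symm)) (M.mate_ne _ _)
  have v1 : ∀ {ρ : E → ZMod 2} {x} {P : Prop}, (ρ (l x) ≠ 0 ↔ P) → P → ρ (l x) = 1 :=
    fun h h' => ZMod.two_eq_one_of_ne_zero (h.2 h')
  have v0 : ∀ {ρ : E → ZMod 2} {x} {P : Prop}, (ρ (l x) ≠ 0 ↔ P) → ¬ P → ρ (l x) = 0 :=
    fun h h' => by by_contra hne; exact h' (h.1 hne)
  have Pa : Y (M.mate .red a) + D (M.mate .red a) = Y a + D a := by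
    rw [Dra, Da]
    simp only [hY, vert_red, if_true, hr₁, hr₂, v1 (hρ₁ a rfl) (Or.inl rfl),
      v1 (hρ₂ a rfl) (Or.inl rfl)]
    ring
  have Pp : Y (M.mate .red p) + D (M.mate .red p) = Y p + D p := by
    rw [Drp, Dp]
    simp only [hY, vert_red, hp, if_true, hr₁, hr₂, v1 (hρ₁ p hp) (Or.inr rfl),
      v0 (hρ₂ p hp) (not_or.2 ⟨hpa, hpq⟩)]
    ring
  have Pq : Y (M.mate .red q) + D (M.mate .red q) = Y q + D q := by
    rw [Drq, Dq]
    simp only [hY, vert_red, hq, if_true, hr₁, hr₂, v1 (hρ₂ q hq) (Or.inr rfl),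
      v0 (hρ₁ q hq) (not_or.2 ⟨hqa, hpq.symm⟩)]
    ring
  have sYD : ∑ x, (Y x + D x) = 0 := by
    refine sum_eq_zero_of_involution (M.mate_mate .red) (M.mate_ne .red) fun x => ?_
    by_cases hx : M.vert x = M.vert a
    · by_cases e1 : l x = l a
      · rcases hl.eq_or_eq_red h1 hx e1 with rfl | rfl
        · exact Pa
        · rw [M.mate_mate]; exact Pa.symm
      by_cases e2 : l x = l p
      · rcases hl.eq_or_eq_red h1 (hx.trans hp.symm) e2 with rfl | rfl
        · exact Pp
        · rw [M.mate_mate]; exact Pp.symm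
      by_cases e3 : l x = l q
      · rcases hl.eq_or_eq_red h1 (hx.trans hq.symm) e3 with rfl | rfl
        · exact Pq
        · rw [M.mate_mate]; exact Pq.symm
      rw [D0 x (n1 e1) (n1 e2) (n1 e3), D0 _ (n1 (by rwa [hl.red])) (n1 (by rwa [hl.red]))
        (n1 (by rwa [hl.red]))]
      simp only [hY, vert_red, hr₁, hr₂, v0 (hρ₁ x hx) (not_or.2 ⟨e1, e2⟩),
        v0 (hρ₂ x hx) (not_or.2 ⟨e1, e3⟩), add_zero]
    · have nv : ∀ {y}, M.vert y = M.vert a → x ≠ y := fun h h' => hx (h' ▸ h)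
      have nv' : ∀ {y}, M.vert y = M.vert a → M.mate .red x ≠ y := fun h h' => hx (by
        rw [← h, ← h', vert_red])
      rw [D0 x (nv rfl) (nv hp) (nv hq), D0 _ (nv' rfl) (nv' hp) (nv' hq)]
      simp only [hY, vert_red, hx, if_false]
  rw [Finset.sum_add_distrib, sY, zero_add, hD] at sYD
  simpa [Finset.sum_add_distrib] using sYD

end IsLabelling

end CombinatorialMap

/-! ### Reconstruction of a 3-connected map -/

namespace CombinatorialMap

variable {V V' E : Type*} {M : CombinatorialMap V} {M' : CombinatorialMap V'} {l : V → E}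
  {l' : V' → E}

/-- There is an isomorphism of maps which respects the labellings of the quadrilaterals. -/
def IsoOver (M : CombinatorialMap V) (M' : CombinatorialMap V') (l : V → E) (l' : V' → E) : Prop :=
  ∃ f : V ≃ V', (∀ c a, f (M.mate c a) = M'.mate c (f a)) ∧ ∀ a, l' (f a) = l a

namespace IsLabelling

variable {hl : M.IsLabelling l} {hl' : M'.IsLabelling l'}

theorem exists_flag_of_star_eq (h1 : NoLoopColoop (cuts (M.labelSpace l))) {v' : M'.Vertex} {a : V}
    (h : hl'.star v' = hl.star (M.vert a)) : ∃ x, M'.vert x = v' ∧ l' x = l a :=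
  hl'.exists_of_star_ne_zero (by rw [h, hl.star_vert h1]; exact one_ne_zero)

/-- The label and the star of a flag determine it up to the red involution. -/
theorem IsThreeConnected.eq_or_eq_red_of_star_eq (T : hl.IsThreeConnected) {a b : V}
    (hs : hl.star (M.vert b) = hl.star (M.vert a)) (h : l b = l a) : b = a ∨ b = M.mate .red a :=
  hl.eq_or_eq_red T.noLoopColoop (T.star_injective hs) h

/-- Corresponding flags lie on the same side of their edges. -/
theorem star_vert_green_eq (T : hl.IsThreeConnected) (T' : hl'.IsThreeConnected)
    (hL : M.labelSpace l = M'.labelSpace l') {a : V} {x : V'}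
    (hs : hl'.star (M'.vert x) = hl.star (M.vert a)) (h : l' x = l a) :
    hl'.star (M'.vert (M'.mate .green x)) = hl.star (M.vert (M.mate .green a)) := by
  obtain ⟨v', hv'⟩ := T.exists_star_eq (hl' := hl') T'.noLoopColoop hL (M.vert (M.mate .green a))
  obtain ⟨y, rfl, hy⟩ := exists_flag_of_star_eq T.noLoopColoop hv'
  rw [hl.green, ← h] at hy
  rcases hl'.vert_of_label_eq hy with h' | h'
  · rw [h', hs] at hv'
    exact absurd (T.star_injective hv').symm (T.vert_green_ne a)
  · rwa [← h']

/-- Linkages are determined by the label space: the cycles are, and the edges at a vertex are given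
by its star. -/
theorem _root_.CombinatorialMap.IsLinkage.transfer [Fintype E] (T : hl.IsThreeConnected)
    (T' : hl'.IsThreeConnected) (hL : M.labelSpace l = M'.labelSpace l') {v : M.Vertex}
    {v' : M'.Vertex}
    (hs : hl'.star v' = hl.star v) {e f g h : E} {ρ₁ ρ₂ : E → ZMod 2}
    (H : IsLinkage M l v e f g h ρ₁ ρ₂) : IsLinkage M' l' v' e f g h ρ₁ ρ₂ := by
  obtain ⟨c1, c2, t1, t2, hB⟩ := H
  have tr : ∀ x', M'.vert x' = v' → ∃ x, M.vert x = v ∧ l x = l' x' := by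
    rintro x' rfl
    exact exists_flag_of_star_eq (hl' := hl) T'.noLoopColoop hs.symm
  refine ⟨hL ▸ c1, hL ▸ c2, fun x' hx' => ?_, fun x' hx' => ?_, fun x' y' hxy hx hρ => ?_⟩
  · obtain ⟨x, hx, hxx⟩ := tr x' hx'
    rw [← hxx]; exact t1 x hx
  · obtain ⟨x, hx, hxx⟩ := tr x' hx'
    rw [← hxx]; exact t2 x hx
  · obtain ⟨u, hu⟩ := T'.exists_star_eq (hl' := hl) T.noLoopColoop hL.symm (M'.vert x')
    obtain ⟨x, hxu, hxx⟩ := exists_flag_of_star_eq T'.noLoopColoop hu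
    obtain ⟨y, hyu, hyy⟩ := exists_flag_of_star_eq T'.noLoopColoop (hxy ▸ hu)
    rw [← hyy]
    refine hB x y (hxu.trans hyu.symm) (fun hxv => hx ?_) (by rwa [hxx])
    exact T'.star_injective (by rw [hs, ← hxv, hxu, hu])

theorem _root_.CombinatorialMap.IsTheta.transfer [Fintype E] (T : hl.IsThreeConnected)
    (T' : hl'.IsThreeConnected) (hL : M.labelSpace l = M'.labelSpace l') {v w : M.Vertex}
    {v' w' : M'.Vertex}
    (hv : hl'.star v' = hl.star v) (hw : hl'.star w' = hl.star w) {e f₁ f₂ g₁ g₂ : E}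
    {ρ₁ ρ₂ : E → ZMod 2} (H : IsTheta M l v w e f₁ f₂ g₁ g₂ ρ₁ ρ₂) :
    IsTheta M' l' v' w' e f₁ f₂ g₁ g₂ ρ₁ ρ₂ := by
  obtain ⟨c1, c2, t1, t2, t3, t4, hB⟩ := H
  have tr : ∀ {u : M.Vertex} {u' : M'.Vertex}, hl'.star u' = hl.star u → ∀ x', M'.vert x' = u' →
      ∃ x, M.vert x = u ∧ l x = l' x' := by
    rintro u _ hs x' rfl
    exact exists_flag_of_star_eq (hl' := hl) T'.noLoopColoop hs.symm
  refine ⟨hL ▸ c1, hL ▸ c2, fun x' hx' => ?_, fun x' hx' => ?_, fun x' hx' => ?_,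
    fun x' hx' => ?_, fun x' y' hxy hxv hxw hρ => ?_⟩
  · obtain ⟨x, hx, hxx⟩ := tr hv x' hx'
    rw [← hxx]; exact t1 x hx
  · obtain ⟨x, hx, hxx⟩ := tr hv x' hx'
    rw [← hxx]; exact t2 x hx
  · obtain ⟨x, hx, hxx⟩ := tr hw x' hx'
    rw [← hxx]; exact t3 x hx
  · obtain ⟨x, hx, hxx⟩ := tr hw x' hx'
    rw [← hxx]; exact t4 x hx
  · obtain ⟨u, hu⟩ := T'.exists_star_eq (hl' := hl) T.noLoopColoop hL.symm (M'.vert x')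
    obtain ⟨x, hxu, hxx⟩ := exists_flag_of_star_eq T'.noLoopColoop hu
    obtain ⟨y, hyu, hyy⟩ := exists_flag_of_star_eq T'.noLoopColoop (hxy ▸ hu)
    rw [← hyy]
    refine hB x y (hxu.trans hyu.symm) (fun h => hxv ?_) (fun h => hxw ?_) (by rwa [hxx])
    · exact T'.star_injective (by rw [hv, ← h, hxu, hu])
    · exact T'.star_injective (by rw [hw, ← h, hxu, hu])

/-- A linkage of four edges at a vertex gives a relation between the cyclic orders of the two maps
at this vertex. -/
theorem _root_.CombinatorialMap.IsLinkage.exists_lifts [Fintype V] [Fintype E]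
    (T : hl.IsThreeConnected) (T' : hl'.IsThreeConnected)
    (hL : M.labelSpace l = M'.labelSpace l') {v : M.Vertex} {v' : M'.Vertex}
    (hs : hl'.star v' = hl.star v) {e f : E} {ρ₁ ρ₂ : E → ZMod 2} {p q : V} {p' q' : V'}
    (hp : M.vert p = v) (hq : M.vert q = v) (hp' : M'.vert p' = v') (hq' : M'.vert q' = v')
    (hpp : l' p' = l p) (hqq : l' q' = l q) (hpq : l p ≠ l q) (hpe : l p ≠ e) (hpf : l p ≠ f)
    (hqe : l q ≠ e) (hqf : l q ≠ f) (H : IsLinkage M l v e f (l p) (l q) ρ₁ ρ₂) :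
    ∃ (z : V → ZMod 2) (z' : V' → ZMod 2), (∀ a, z (M.mate .black a) = z a) ∧
      (∀ a, z (M.mate .red a) = z a + ρ₁ (l a)) ∧ (∀ a, z' (M'.mate .black a) = z' a) ∧
      (∀ a, z' (M'.mate .red a) = z' a + ρ₁ (l' a)) ∧ z p + z q = z' p' + z' q' := by
  have H' := H.transfer T T' hL hs
  obtain ⟨c1, c2, t1, t2, hB⟩ := H
  obtain ⟨-, c2', t1', t2', hB'⟩ := H'
  obtain ⟨γ₁, hγ₁⟩ := hl.exists_snd_of_isCycle c1
  have hγ₁' := hL ▸ hγ₁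
  obtain ⟨z, hb, hr, hg⟩ := hγ₁
  obtain ⟨z', hb', hr', hg'⟩ := hγ₁'
  have hp0 : ρ₁ (l p) = 0 := by
    by_contra hne
    exact ((t1 p hp).1 hne).elim hpe hpf
  have hq0 : ρ₁ (l q) = 0 := by
    by_contra hne
    exact ((t1 q hq).1 hne).elim hqe hqf
  refine ⟨z, z', hb, hr, hb', hr', ?_⟩
  rw [← hl.sum_mul_eq_of_linked T.noLoopColoop c2 hb hr hg hp hq hpq hp0 hq0 t2 hB]
  exact hl'.sum_mul_eq_of_linked T'.noLoopColoop c2' hb' hr' hg' hp' hq' (by rwa [hpp, hqq])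
    (by rwa [hpp]) (by rwa [hqq]) (by rwa [hpp, hqq]) hB'

/-- The edges which follow each other at a vertex are the same in both maps. If `e`, `g` are
consecutive in the first map but `e` lies between `f` and `h` in the second one, then two of the
three ways to link the edges `e`, `f`, `g`, `h` in pairs by two cycles which meet only in the
vertex are possible. The pairings of these cycles differ in the two maps. -/
theorem exists_label_black_eq [Fintype V] [Fintype V'] [Fintype E] (T : hl.IsThreeConnected)
    (T' : hl'.IsThreeConnected) (hL : M.labelSpace l = M'.labelSpace l') (a : V) :
    ∃ x, hl'.star (M'.vert x) = hl.star (M.vert a) ∧ l' x = l a ∧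
      l' (M'.mate .black x) = l (M.mate .black a) := by
  have h1 := T.noLoopColoop
  have h1' := T'.noLoopColoop
  obtain ⟨v', hv'⟩ := T.exists_star_eq (hl' := hl') h1' hL (M.vert a)
  obtain ⟨x, rfl, hxa⟩ := exists_flag_of_star_eq h1 hv'
  by_contra! hno
  have gf : l (M.mate .black a) ≠ l' (M'.mate .black x) := fun h => hno x hv' hxa h.symm
  have gh : l (M.mate .black a) ≠ l' (M'.mate .black (M'.mate .red x)) := fun h =>
    hno (M'.mate .red x) (by rwa [vert_red]) (by rw [hl'.red, hxa]) h.symm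
  have hf := T'.label_black_red x
  have ef := hl'.label_black_ne h1' x
  have eh := hl'.label_black_ne h1' (M'.mate .red x)
  rw [hl'.red] at eh
  have eg := hl.label_black_ne h1 a
  obtain ⟨p, hp, hpl⟩ := exists_flag_of_star_eq (hl' := hl) (v' := M.vert a) h1'
    (a := M'.mate .black x) (by rw [vert_black, hv'])
  obtain ⟨q, hq, hql⟩ := exists_flag_of_star_eq (hl' := hl) (v' := M.vert a) h1'
    (a := M'.mate .black (M'.mate .red x)) (by rw [vert_black, vert_red, hv'])
  obtain ⟨y, hy, hyl⟩ := exists_flag_of_star_eq (hl := hl) (v' := M'.vert x) h1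
    (a := M.mate .black a) (by rw [vert_black, hv'])
  have vx : M'.vert (M'.mate .black x) = M'.vert x := M'.vert_black x
  have vrx : M'.vert (M'.mate .black (M'.mate .red x)) = M'.vert x := by
    rw [vert_black, vert_red]
  have va := M.vert_black a
  rw [← hpl] at hf ef gf
  rw [← hql] at hf eh gh
  rw [hxa] at ef eh
  have hpg : l p ≠ l (M.mate .black a) := gf.symm
  -- in the first map the two cycles touch at the vertex, in the second one they cross
  by_cases L1 : ∃ ρ₁ ρ₂, IsLinkage M l (M.vert a) (l a) (l (M.mate .black a)) (l p) (l q) ρ₁ ρ₂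
  · obtain ⟨ρ₁, ρ₂, H⟩ := L1
    obtain ⟨z, z', hb, hr, hb', hr', hz⟩ := H.exists_lifts T T' hL hv' hp hq vx vrx hpl.symm
      hql.symm hf.symm ef hpg eh gh.symm
    have t1 := H.2.2.1
    rw [hl.eq_of_consecutive h1 hb hr t1 hp hq ef hpg eh gh.symm, CharTwo.add_self_eq_zero, hb',
      hb', hr', hxa, ZMod.two_eq_one_of_ne_zero ((t1 a rfl).2 (Or.inl rfl)), ← add_assoc,
      CharTwo.add_self_eq_zero, zero_add] at hz
    exact zero_ne_one hz
  -- in the second map both linkages touch at the vertex, in the first one this is impossible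
  · obtain ⟨ρ₁, ρ₂, H₁⟩ := (T.exists_isLinkage hq hp va eh.symm ef.symm eg.symm hf gh.symm
      hpg).resolve_right fun ⟨ρ₁, ρ₂, c1, c2, t1, t2, hB⟩ =>
        L1 ⟨ρ₁, ρ₂, c1, c2, t1, fun x hx => (t2 x hx).trans or_comm, hB⟩
    obtain ⟨ρ₃, ρ₄, H₂⟩ := (T.exists_isLinkage hp hq va ef.symm eh.symm eg.symm hf.symm hpg
      gh.symm).resolve_right L1
    obtain ⟨z₁, z₁', hb₁, hr₁, hb₁', hr₁', hz₁⟩ := H₁.exists_lifts T T' hL hv' hq va vrx hy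
      hql.symm hyl gh.symm eh hf eg gf
    obtain ⟨z₂, z₂', hb₂, hr₂, hb₂', hr₂', hz₂⟩ := H₂.exists_lifts T T' hL hv' hp va vx hy
      hpl.symm hyl hpg ef hf.symm eg gh
    have t₁ := (H₁.transfer T T' hL hv').2.2.1
    have t₂ := (H₂.transfer T T' hL hv').2.2.1
    rw [hl'.eq_of_consecutive (a := x) h1' hb₁' hr₁' (by rwa [hxa, ← hpl]) vrx hy
      (by rwa [← hql, hxa]) (by rwa [← hql, ← hpl]) (by rwa [hyl, hxa]) (by rwa [hyl, ← hpl]),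
      CharTwo.add_self_eq_zero, hb₁] at hz₁
    rw [hl'.eq_of_consecutive (a := M'.mate .red x) (p := M'.mate .black x) (q := y) h1' hb₂' hr₂'
      (by rwa [vert_red, hl'.red, hxa, ← hql]) (by rwa [vert_red]) (by rwa [vert_red])
      (by rwa [← hpl, hl'.red, hxa]) (by rw [← hql, ← hpl]; exact hf.symm)
      (by rwa [hyl, hl'.red, hxa]) (by rwa [hyl, ← hql]),
      CharTwo.add_self_eq_zero, hb₂] at hz₂
    have := hl.local_isotropic h1 hb₁ hr₁ hb₂ hr₂ hp hq ef eh hf.symm H₁.2.2.1 H₂.2.2.1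
    have e0 : z₁ a + z₂ a + 1 + z₂ p + z₁ q = (z₁ q + z₁ a) + (z₂ p + z₂ a) + 1 := by ring
    rw [e0, hz₁, hz₂] at this
    exact one_ne_zero this

/-- A 3-connected map is determined by its label space. The isomorphism respects the green edges
because the sum of the lifts of a cycle to both maps is constant at each vertex, so that the pairing
of the two cycles of a theta graph fixes the end of a green edge. -/
theorem IsThreeConnected.exists_equiv [Fintype V] [Fintype V'] [Fintype E]
    (T : hl.IsThreeConnected) (T' : hl'.IsThreeConnected)
    (hL : M.labelSpace l = M'.labelSpace l') :
    IsoOver M M' l l' := by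
  -- map a flag to the one with the same star and label whose black neighbour has the same label
  choose f hs hlf hfb using exists_label_black_eq T T' hL
  have hblack : ∀ a, f (M.mate .black a) = M'.mate .black (f a) := by
    intro a
    have e1 := hfb (M.mate .black a)
    rw [M.mate_mate] at e1
    rcases T'.eq_or_eq_red_of_star_eq (a := M'.mate .black (f a)) (b := f (M.mate .black a))
      (by rw [hs, vert_black, vert_black, hs]) (by rw [hlf, hfb]) with h | h
    · exact h
    · rw [h] at e1
      have := T'.label_black_red (M'.mate .black (f a))
      rw [M'.mate_mate, e1, hlf] at this
      exact absurd rfl this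
  have hred : ∀ a, f (M.mate .red a) = M'.mate .red (f a) := by
    intro a
    rcases T'.eq_or_eq_red_of_star_eq (a := f a) (b := f (M.mate .red a))
      (by rw [hs, vert_red, hs]) (by rw [hlf, hl.red, hlf]) with h | h
    · have := T.label_black_red a
      rw [← hfb, ← hfb, h] at this
      exact absurd rfl this
    · exact h
  have hinj : Function.Injective f := by
    intro a b hab
    rcases T.eq_or_eq_red_of_star_eq (a := b) (b := a) (by rw [← hs, ← hs, hab])
      (by rw [← hlf, ← hlf, hab]) with h | h
    · exact h
    · rw [h, hred] at hab
      exact absurd hab (M'.mate_ne _ _)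
  have hsurj : Function.Surjective f := by
    intro x
    obtain ⟨v, hv⟩ := T'.exists_star_eq (hl' := hl) T.noLoopColoop hL.symm (M'.vert x)
    obtain ⟨a, rfl, ha⟩ := exists_flag_of_star_eq T'.noLoopColoop hv
    rcases T'.eq_or_eq_red_of_star_eq (a := f a) (b := x) (by rw [hs, hv])
      (by rw [hlf, ha]) with h | h
    · exact ⟨a, h.symm⟩
    · exact ⟨M.mate .red a, by rw [hred, h]⟩
  have hgreen : ∀ a, f (M.mate .green a) = M'.mate .green (f a) := by
    intro a
    have hsg := star_vert_green_eq T T' hL (hs a) (hlf a)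
    refine (T'.eq_or_eq_red_of_star_eq (a := M'.mate .green (f a)) (b := f (M.mate .green a))
      (by rw [hs, hsg]) (by rw [hlf, hl.green, hl'.green, hlf])).resolve_right fun h => ?_
    -- the lift of a cycle of a theta graph separates the two flags that `f (green a)` may be
    obtain ⟨b₁, b₂, c₁, c₂, -, hb₂, -, hc₂, -, n2, -, n4, n5, n6, n7, ρ₁, ρ₂, H⟩ :=
      T.exists_isTheta a
    have H' := H.transfer T T' hL (hs a) hsg
    obtain ⟨γ₁, hγ₁⟩ := hl.exists_snd_of_isCycle H.1
    have hγ₁' := hL ▸ hγ₁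
    obtain ⟨z, hb, hr, hg⟩ := hγ₁
    obtain ⟨z', hb', hr', hg'⟩ := hγ₁'
    have fv : ∀ {x y}, M.vert x = M.vert y → M'.vert (f x) = M'.vert (f y) := fun h =>
      T'.star_injective (by rw [hs, hs, h])
    have const : ∀ {x y}, M.vert x = M.vert y → z x + z' (f x) = z y + z' (f y) := by
      intro x y hxy
      refine M.eq_of_vert_eq (h := fun x => z x + z' (f x)) hxy (fun t _ => ?_) fun t _ => ?_
      · simp only [hblack, hb, hb']
      · simp only [hred, hr, hr', hlf]
        grind
    have vfg : M'.vert (f (M.mate .green a)) = M'.vert (M'.mate .green (f a)) := by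
      rw [h, vert_red]
    have s1 := sum_mul_eq_of_isTheta T hb hr hg hb₂ hc₂ n2 n4 n5.symm n6.symm n7 H
    rw [← hlf a, ← hlf b₂, ← hlf c₂] at H'
    have s2 := sum_mul_eq_of_isTheta T' hb' hr' hg' (fv hb₂) ((fv hc₂).trans vfg)
      (by rwa [hlf, hlf]) (by rwa [hlf, hlf]) (by rw [hlf]; exact n5.symm)
      (by rw [hlf]; exact n6.symm) (by rwa [hlf, hlf]) H'
    have k1 := const hb₂
    have k2 := const hc₂
    have k3 : z' _ = z' _ + ρ₁ (l' _) := hr' (M'.mate .green (f a))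
    rw [← h, hl'.green, ZMod.two_eq_one_of_ne_zero ((H'.2.2.1 (f a) rfl).2 (Or.inl rfl))] at k3
    rw [s1] at s2
    grind
  refine ⟨Equiv.ofBijective f ⟨hinj, hsurj⟩, fun c a => ?_, hlf⟩
  cases c
  · exact hred a
  · exact hgreen a
  · exact hblack a

end IsLabelling

end CombinatorialMap

/-! ### Maps with at most three edges -/

namespace CombinatorialMap

variable {V V' E : Type*} {M : CombinatorialMap V} {M' : CombinatorialMap V'} {l : V → E}
  {l' : V' → E}

/-- The flag which is reached from `a` along a red edge (if `r` holds) and a green edge (if `g`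
holds). -/
def move (M : CombinatorialMap V) (r g : Bool) (a : V) : V :=
  bif r then M.mate .red (bif g then M.mate .green a else a) else bif g then M.mate .green a else a

theorem red_move (M : CombinatorialMap V) (r g : Bool) (a : V) :
    M.mate .red (M.move r g a) = M.move (!r) g a := by
  cases r <;> cases g <;> simp [move, M.mate_mate]

theorem green_move (M : CombinatorialMap V) (r g : Bool) (a : V) :
    M.mate .green (M.move r g a) = M.move r (!g) a := by
  cases r <;> cases g <;> simp [move, M.mate_mate, ← M.red_green_comm]

namespace IsLabelling

theorem move (hl : M.IsLabelling l) (r g : Bool) (a : V) : l (M.move r g a) = l a := by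
  cases r <;> cases g <;> simp [CombinatorialMap.move, hl.red, hl.green]

theorem move_bijective (hl : M.IsLabelling l) {a : E → V} (ha : ∀ e, l (a e) = e) :
    Function.Bijective fun p : E × Bool × Bool => M.move p.2.1 p.2.2 (a p.1) := by
  constructor
  · rintro ⟨e, r, g⟩ ⟨e', r', g'⟩ h
    have he : e = e' := by
      have := congrArg l h
      simpa only [hl.move, ha] using this
    subst he
    have c1 := fun c => M.mate_ne c (a e)
    have c2 := M.red_green_ne (a e)
    have c3 := M.red_ne_green (a e)
    have c4 := M.mate_ne .green (a e)
    have c5 : M.mate .red (M.mate .green (a e)) ≠ M.mate .red (a e) := fun h => c4 (by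
      rw [← M.mate_mate .red (M.mate .green (a e)), h, M.mate_mate])
    have c6 := M.mate_ne .red (M.mate .green (a e))
    revert h
    cases r <;> cases g <;> cases r' <;> cases g' <;>
      simp [CombinatorialMap.move, c1, c2, c3, c5, c6, (c1 _).symm, c2.symm, c3.symm, c5.symm,
        c6.symm]
  · intro b
    rcases hl.fiber ((ha (l b)).symm) with h | h | h | h
    · exact ⟨(l b, false, false), h.symm⟩
    · exact ⟨(l b, true, false), h.symm⟩
    · exact ⟨(l b, false, true), h.symm⟩
    · exact ⟨(l b, true, true), h.symm⟩

/-- A bijection which respects the red and green edges can be prescribed at one flag of each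
quadrilateral. -/
theorem exists_equiv_of_base (hl : M.IsLabelling l) (hl' : M'.IsLabelling l') {a : E → V}
    {x : E → V'} (ha : ∀ e, l (a e) = e) (hx : ∀ e, l' (x e) = e) :
    ∃ f : V ≃ V', (∀ b, f (M.mate .red b) = M'.mate .red (f b)) ∧
      (∀ b, f (M.mate .green b) = M'.mate .green (f b)) ∧ (∀ b, l' (f b) = l b) ∧
      ∀ e, f (a e) = x e := by
  set θ := Equiv.ofBijective _ (hl.move_bijective ha) with hθ
  set θ' := Equiv.ofBijective _ (hl'.move_bijective hx) with hθ'
  have key : ∀ e r g, (θ.symm.trans θ') (M.move r g (a e)) = M'.move r g (x e) := by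
    intro e r g
    have : M.move r g (a e) = θ (e, r, g) := rfl
    rw [Equiv.trans_apply, this, Equiv.symm_apply_apply]
    rfl
  refine ⟨θ.symm.trans θ', fun b => ?_, fun b => ?_, fun b => ?_, fun e => key e false false⟩
  · obtain ⟨⟨e, r, g⟩, rfl⟩ := θ.surjective b
    change (θ.symm.trans θ') (M.mate .red (M.move r g (a e))) =
      M'.mate .red ((θ.symm.trans θ') (M.move r g (a e)))
    rw [red_move, key, key, red_move]
  · obtain ⟨⟨e, r, g⟩, rfl⟩ := θ.surjective b
    change (θ.symm.trans θ') (M.mate .green (M.move r g (a e))) =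
      M'.mate .green ((θ.symm.trans θ') (M.move r g (a e)))
    rw [green_move, key, key, green_move]
  · obtain ⟨⟨e, r, g⟩, rfl⟩ := θ.surjective b
    change l' ((θ.symm.trans θ') (M.move r g (a e))) = l (M.move r g (a e))
    rw [key, hl.move, hl'.move, ha, hx]

/-- For a single quadrilateral, a nonzero element of the label space tells along with which pairs of
its flags the black edges run. -/
theorem black_eq_move [Subsingleton E] (hl : M.IsLabelling l)
    {p : (E → ZMod 2) × (E → ZMod 2)} (hp : p ∈ M.labelSpace l) {e : E}
    (h1 : p.1 e = 1 ∨ p.2 e = 1) (a : V) :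
    M.mate .black a = M.move (p.2 e == 1) (p.1 e == 1) a := by
  obtain ⟨z, hb, hr, hg⟩ := hp
  have h01 : ((0 : ZMod 2) == 1) = false := by decide
  have hr := hr a
  have hg' := hg (M.mate .red a)
  have hg := hg a
  have hb := hb a
  rw [hl.red] at hg'
  rw [Subsingleton.elim (l a) e] at hr hg hg'
  rw [← M.red_green_comm] at hg'
  rcases hl.fiber (Subsingleton.elim (l (M.mate .black a)) (l a)) with h | h | h | h
  · exact absurd h (M.mate_ne .black a)
  · rw [h] at hb ⊢
    have e1 : p.1 e = 0 := by grind
    have e2 : p.2 e = 1 := by simpa [e1] using h1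
    simp [CombinatorialMap.move, e1, e2, h01]
  · rw [h] at hb ⊢
    have e1 : p.2 e = 0 := by grind
    have e2 : p.1 e = 1 := by simpa [e1] using h1
    simp [CombinatorialMap.move, e1, e2, h01]
  · rw [h] at hb ⊢
    have e1 : p.1 e = p.2 e := by grind
    have e2 : p.2 e = 1 := by simpa [e1] using h1
    simp [CombinatorialMap.move, e1, e2]

theorem isoOver_of_card_eq_one [Fintype V] [Fintype E] (hl : M.IsLabelling l)
    (hl' : M'.IsLabelling l') (hL : M.labelSpace l = M'.labelSpace l')
    (hex : ∃ F, M.IsFeasibleLabel l F) (hn : Nat.card E = 1) : IsoOver M M' l l' := by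
  obtain ⟨hs, ⟨e⟩⟩ := Nat.card_eq_one_iff_unique.1 hn
  obtain ⟨F, hF⟩ := hex
  obtain ⟨p, hp, hpF⟩ := (hl.isLagrangianAt hF).surj 1
  have h1 : p.1 e = 1 ∨ p.2 e = 1 := by
    have := congrFun hpF e
    unfold along at this
    split_ifs at this
    · exact Or.inr this
    · exact Or.inl this
  obtain ⟨a, ha⟩ := hl.surj e
  obtain ⟨x, hx⟩ := hl'.surj e
  obtain ⟨f, hr, hg, hf, -⟩ := hl.exists_equiv_of_base hl' (a := fun _ => a) (x := fun _ => x)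
    (fun _ => Subsingleton.elim _ _) fun _ => Subsingleton.elim _ _
  refine ⟨f, fun c b => ?_, hf⟩
  cases c
  · exact hr b
  · exact hg b
  · rw [hl.black_eq_move hp h1, hl'.black_eq_move (hL ▸ hp) h1]
    unfold CombinatorialMap.move
    cases (p.2 e == 1) <;> cases (p.1 e == 1) <;> simp [hr, hg]

theorem eq_of_card_eq_two (hn : Nat.card E = 2) {x y w : E} (hx : x ≠ w) (hy : y ≠ w) : x = y := by
  by_contra hxy
  have := Nat.finite_of_card_ne_zero (α := E) (by omega)
  have : ({x, y, w} : Set E).ncard ≤ 2 := hn ▸ Set.ncard_le_card _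
  rw [Set.ncard_eq_three.2 ⟨x, y, w, hxy, hx, hy, rfl⟩] at this
  omega

theorem black_red_of_card_eq_two (hn : Nat.card E = 2) (hl : M.IsLabelling l)
    (h1 : NoLoopColoop (cuts (M.labelSpace l))) (a : V) :
    M.mate .black (M.mate .red a) = M.mate .red (M.mate .black a) := by
  refine (hl.black_red_of_label_eq h1 (eq_of_card_eq_two hn (w := l a) ?_
    (hl.label_black_ne h1 a))).1
  rw [← hl.red a]
  exact hl.label_black_ne h1 _

/-- With two quadrilaterals, the black edges match the first with the second one and commute with
the red and the green edges. -/
theorem isoOver_of_card_eq_two (hl : M.IsLabelling l) (hl' : M'.IsLabelling l')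
    (h1 : NoLoopColoop (cuts (M.labelSpace l))) (h2 : NoLoopColoop (cuts (M.swap.labelSpace l)))
    (h1' : NoLoopColoop (cuts (M'.labelSpace l')))
    (h2' : NoLoopColoop (cuts (M'.swap.labelSpace l')))
    (hn : Nat.card E = 2) : IsoOver M M' l l' := by
  classical
  have cr := black_red_of_card_eq_two hn hl h1
  have cr' := black_red_of_card_eq_two hn hl' h1'
  have cg : ∀ a, M.mate .black (M.mate .green a) = M.mate .green (M.mate .black a) :=
    black_red_of_card_eq_two hn hl.swap h2
  have cg' : ∀ a, M'.mate .black (M'.mate .green a) = M'.mate .green (M'.mate .black a) :=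
    black_red_of_card_eq_two hn hl'.swap h2'
  have hE : Nonempty E := (Nat.card_pos_iff.1 (by omega)).1
  obtain ⟨e⟩ := hE
  obtain ⟨a, rfl⟩ := hl.surj e
  obtain ⟨x, hx⟩ := hl'.surj (l a)
  have na := hl.label_black_ne h1 a
  have nx := hl'.label_black_ne h1' x
  rw [hx] at nx
  obtain ⟨f, hr, hg, hf, hfa⟩ := hl.exists_equiv_of_base hl'
    (a := fun e => if e = l a then a else M.mate .black a)
    (x := fun e => if e = l a then x else M'.mate .black x)
    (fun e => by
      split_ifs with h
      · exact h.symm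
      · exact eq_of_card_eq_two hn na h)
    (fun e => by
      split_ifs with h
      · rw [hx, h]
      · exact eq_of_card_eq_two hn nx h)
  have k1 : f a = x := by simpa using hfa (l a)
  have k2 : f (M.mate .black a) = M'.mate .black x := by simpa [na] using hfa (l (M.mate .black a))
  have hb : ∀ b, f (M.mate .black b) = M'.mate .black (f b) := by
    refine M.map_ind (a := a) (by rw [k1, k2]) fun c b hb => ?_
    cases c
    · rw [cr, hr, hb, hr, cr']
    · rw [cg, hg, hb, hg, cg']
    · rw [M.mate_mate, hb, M'.mate_mate]
  refine ⟨f, fun c b => ?_, hf⟩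
  cases c
  · exact hr b
  · exact hg b
  · exact hb b

section three

variable [Finite E] (hn : Nat.card E = 3)
include hn

theorem eq_or_eq_or_eq_of_card {x y w : E} (hxy : x ≠ y) (hxw : x ≠ w) (hyw : y ≠ w) (e : E) :
    e = x ∨ e = y ∨ e = w := by
  have : ({x, y, w} : Set E) = Set.univ := by
    refine Set.eq_of_subset_of_ncard_le (Set.subset_univ _) ?_
    rw [Set.ncard_univ, hn, Set.ncard_eq_three.2 ⟨x, y, w, hxy, hxw, hyw, rfl⟩]
  have he : e ∈ ({x, y, w} : Set E) := this ▸ Set.mem_univ e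
  simpa using he

/-- A vertex of degree three of a map with three edges. -/
theorem one_mem_cuts (hl : M.IsLabelling l) (h1 : NoLoopColoop (cuts (M.labelSpace l))) {a : V}
    (h : l (M.mate .black (M.mate .red a)) ≠ l (M.mate .black a)) :
    (1 : E → ZMod 2) ∈ cuts (M.labelSpace l) := by
  have : hl.star (M.vert a) = 1 := by
    funext e
    have n1 := hl.label_black_ne h1 a
    have n2 := hl.label_black_ne h1 (M.mate .red a)
    rw [hl.red] at n2
    rcases eq_or_eq_or_eq_of_card hn n1.symm n2.symm h.symm e with rfl | rfl | rfl
    · exact hl.star_vert h1 a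
    · rw [← M.vert_black a]; exact hl.star_vert h1 _
    · rw [← M.vert_red a, ← M.vert_black]; exact hl.star_vert h1 _
  exact this ▸ hl.star_mem _

/-- If all three edges form a cut, then no vertex has degree two: its star and this cut would add up
to a single edge. -/
theorem label_black_red_ne (hl : M.IsLabelling l) (h1 : NoLoopColoop (cuts (M.labelSpace l)))
    (h : (1 : E → ZMod 2) ∈ cuts (M.labelSpace l)) (a : V) :
    l (M.mate .black (M.mate .red a)) ≠ l (M.mate .black a) := by
  intro hne
  obtain ⟨-, hdeg⟩ := hl.black_red_of_label_eq h1 hne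
  have sa := hl.star_vert h1 a
  have sb := hl.star_vert h1 (M.mate .black a)
  rw [vert_black] at sb
  obtain ⟨e, he⟩ : ∃ e, e ∉ ({l a, l (M.mate .black a)} : Set E) := by
    by_contra! hc
    have : ({l a, l (M.mate .black a)} : Set E).ncard = 3 := by
      rw [← hn, ← Set.ncard_univ, Set.eq_univ_of_forall hc]
    have := Set.ncard_insert_le (l a) {l (M.mate .black a)}
    rw [Set.ncard_singleton] at this
    omega
  have se : hl.star (M.vert a) e = 0 := by
    by_contra hse
    obtain ⟨b, hb, rfl⟩ := hl.exists_of_star_ne_zero hse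
    exact he (hdeg b hb)
  simp only [Set.mem_insert_iff, Set.mem_singleton_iff, not_or] at he
  obtain ⟨e', hne', he'⟩ := h1.coloop _ (Submodule.add_mem _ h (hl.star_mem (M.vert a))) e (by
    simp [se])
  rcases eq_or_eq_or_eq_of_card hn he.1 he.2 (hl.label_black_ne h1 a).symm e' with rfl | rfl | rfl
  · exact hne' rfl
  · simp [sa, CharTwo.add_self_eq_zero] at he'
  · simp [sb, CharTwo.add_self_eq_zero] at he'

/-- If all vertices of a map with three edges have degree two, then all faces have degree three. -/
theorem label_black_green_ne (hl : M.IsLabelling l) (h1 : NoLoopColoop (cuts (M.labelSpace l)))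
    (h2 : NoLoopColoop (cuts (M.swap.labelSpace l)))
    (h : (1 : E → ZMod 2) ∉ cuts (M.labelSpace l)) :
    (∀ a, M.mate .black (M.mate .red a) = M.mate .red (M.mate .black a)) ∧
      ∀ a, l (M.mate .black (M.mate .green a)) ≠ l (M.mate .black a) := by
  have cr : ∀ a, M.mate .black (M.mate .red a) = M.mate .red (M.mate .black a) := fun a =>
    (hl.black_red_of_label_eq h1 (by by_contra hne; exact h (hl.one_mem_cuts hn h1 hne))).1
  refine ⟨cr, fun a => hl.swap.label_black_red_ne hn h2 ?_ a⟩
  by_contra h'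
  have cg : ∀ a, M.mate .black (M.mate .green a) = M.mate .green (M.mate .black a) := fun a =>
    (hl.swap.black_red_of_label_eq h2
      (by by_contra hne; exact h' (hl.swap.one_mem_cuts hn h2 hne))).1
  have two : ∀ b, l b = l a ∨ l b = l (M.mate .black a) := by
    intro b
    refine (M.map_ind (a := a) (P := fun b =>
      (l b = l a ∧ l (M.mate .black b) = l (M.mate .black a)) ∨
      (l b = l (M.mate .black a) ∧ l (M.mate .black b) = l a)) (Or.inl ⟨rfl, rfl⟩)
      (fun c x hx => ?_) b).imp And.left And.left
    cases c
    · rwa [cr, hl.red, hl.red]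
    · rwa [cg, hl.green, hl.green]
    · rw [M.mate_mate]; tauto
  have : (Set.univ : Set E) ⊆ {l a, l (M.mate .black a)} := by
    intro e _
    obtain ⟨b, rfl⟩ := hl.surj e
    exact two b
  have := Set.ncard_le_ncard this
  have := Set.ncard_insert_le (l a) {l (M.mate .black a)}
  rw [Set.ncard_singleton] at this
  rw [Set.ncard_univ] at *
  omega

/-- The face through `a` contains only two flags of the third edge. They are reached from `a` in
both directions along the face. -/
theorem black_green_black (hl : M.IsLabelling l) (h1 : NoLoopColoop (cuts (M.labelSpace l)))
    (h2 : NoLoopColoop (cuts (M.swap.labelSpace l)))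
    (h : ∀ a, l (M.mate .black (M.mate .green a)) ≠ l (M.mate .black a)) (a : V) :
    M.mate .black (M.mate .green (M.mate .black a)) =
      M.mate .green (M.mate .black (M.mate .green a)) := by
  have n1 := hl.label_black_ne h1 a
  have n2 := hl.label_black_ne h1 (M.mate .green a)
  rw [hl.green] at n2
  have n3 := h (M.mate .black a)
  rw [M.mate_mate] at n3
  have n4 := hl.label_black_ne h1 (M.mate .green (M.mate .black a))
  rw [hl.green] at n4
  have hlab : l (M.mate .black (M.mate .green (M.mate .black a))) =
      l (M.mate .black (M.mate .green a)) := by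
    rcases eq_or_eq_or_eq_of_card hn n1.symm n2.symm (h a).symm
      (l (M.mate .black (M.mate .green (M.mate .black a)))) with h | h | h
    · exact absurd h n3
    · exact absurd h n4
    · exact h
  have hface : M.swap.vert (M.mate .black (M.mate .green (M.mate .black a))) =
      M.swap.vert (M.mate .black (M.mate .green a)) := by
    have vb : ∀ b, M.swap.vert (M.mate .black b) = M.swap.vert b := M.swap.vert_black
    have vg : ∀ b, M.swap.vert (M.mate .green b) = M.swap.vert b := M.swap.vert_red
    rw [vb, vg, vb, vb, vg]
  refine (hl.swap.eq_or_eq_red h2 hface hlab).resolve_left fun h => ?_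
  have := congrArg (M.mate .green) (congrArg (M.mate .black) h)
  rw [M.mate_mate, M.mate_mate, M.mate_mate, M.mate_mate] at this
  exact M.mate_ne _ _ this

/-- A map with three edges all of whose vertices have degree two is a triangle on the sphere. All
black edges are determined by those at a flag `a` and at `green a`. -/
theorem isoOver_of_one_notMem (hl : M.IsLabelling l) (hl' : M'.IsLabelling l')
    (hL : M.labelSpace l = M'.labelSpace l')
    (h1 : NoLoopColoop (cuts (M.labelSpace l))) (h2 : NoLoopColoop (cuts (M.swap.labelSpace l)))
    (h1' : NoLoopColoop (cuts (M'.labelSpace l')))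
    (h2' : NoLoopColoop (cuts (M'.swap.labelSpace l')))
    (h : (1 : E → ZMod 2) ∉ cuts (M.labelSpace l)) : IsoOver M M' l l' := by
  classical
  obtain ⟨cr, ng⟩ := hl.label_black_green_ne hn h1 h2 h
  obtain ⟨cr', ng'⟩ := hl'.label_black_green_ne hn h1' h2' (hL ▸ h)
  have hE : Nonempty E := (Nat.card_pos_iff.1 (by omega)).1
  obtain ⟨e⟩ := hE
  obtain ⟨a, rfl⟩ := hl.surj e
  have na := hl.label_black_ne h1 a
  have nga := hl.label_black_ne h1 (M.mate .green a)
  rw [hl.green] at nga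
  have cases := eq_or_eq_or_eq_of_card hn na.symm nga.symm (ng a).symm
  have hx : ∃ x, l' x = l a ∧ l' (M'.mate .black x) = l (M.mate .black a) := by
    obtain ⟨x, hx⟩ := hl'.surj (l a)
    have nx := hl'.label_black_ne h1' x
    have ngx := hl'.label_black_ne h1' (M'.mate .green x)
    rw [hl'.green] at ngx
    rw [hx] at nx ngx
    rcases cases (l' (M'.mate .black x)) with h | h | h
    · exact absurd h nx
    · exact ⟨x, hx, h⟩
    · refine ⟨M'.mate .green x, by rw [hl'.green, hx], ?_⟩
      rcases cases (l' (M'.mate .black (M'.mate .green x))) with h' | h' | h'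
      · exact absurd h' ngx
      · exact h'
      · exact absurd (h'.trans h.symm) (ng' x)
  obtain ⟨x, hx, hbx⟩ := hx
  have hgx : l' (M'.mate .black (M'.mate .green x)) = l (M.mate .black (M.mate .green a)) := by
    have ngx := hl'.label_black_ne h1' (M'.mate .green x)
    rw [hl'.green, hx] at ngx
    rcases cases (l' (M'.mate .black (M'.mate .green x))) with h | h | h
    · exact absurd h ngx
    · exact absurd (h.trans hbx.symm) (ng' x)
    · exact h
  obtain ⟨f, hr, hg, hf, hfa⟩ := hl.exists_equiv_of_base hl'
    (a := fun e => if e = l a then a else if e = l (M.mate .black a) then M.mate .black a else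
      M.mate .black (M.mate .green a))
    (x := fun e => if e = l a then x else if e = l (M.mate .black a) then M'.mate .black x else
      M'.mate .black (M'.mate .green x))
    (fun e => by
      rcases cases e with rfl | rfl | rfl
      · simp
      · simp [na]
      · simp [nga, ng a])
    (fun e => by
      rcases cases e with rfl | rfl | rfl
      · simp [hx]
      · simp [na, hbx]
      · simp [nga, ng a, hgx])
  have k1 : f a = x := by simpa using hfa (l a)
  have k2 : f (M.mate .black a) = M'.mate .black x := by simpa [na] using hfa (l (M.mate .black a))
  have k3 : f (M.mate .black (M.mate .green a)) = M'.mate .black (M'.mate .green x) := by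
    simpa [nga, ng a] using hfa (l (M.mate .black (M.mate .green a)))
  have pr : ∀ b, f (M.mate .black b) = M'.mate .black (f b) →
      f (M.mate .black (M.mate .red b)) = M'.mate .black (f (M.mate .red b)) := by
    intro b hb
    rw [cr, hr, hb, hr, cr']
  have pb : ∀ b, f (M.mate .black b) = M'.mate .black (f b) →
      f (M.mate .black (M.mate .black b)) = M'.mate .black (f (M.mate .black b)) := by
    intro b hb
    rw [M.mate_mate, hb, M'.mate_mate]
  have p1 : f (M.mate .black a) = M'.mate .black (f a) := by rw [k1, k2]
  have p2 : f (M.mate .black (M.mate .green a)) = M'.mate .black (f (M.mate .green a)) := by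
    rw [k3, hg, k1]
  have p3 : f (M.mate .black (M.mate .green (M.mate .black a))) =
      M'.mate .black (f (M.mate .green (M.mate .black a))) := by
    rw [black_green_black hn hl h1 h2 ng, hg, k3, hg, k2, black_green_black hn hl' h1' h2' ng']
  have p4 : f (M.mate .black (M.mate .green (M.mate .black (M.mate .green a)))) =
      M'.mate .black (f (M.mate .green (M.mate .black (M.mate .green a)))) := by
    rw [← black_green_black hn hl h1 h2 ng]
    exact pb _ p3
  have all : ∀ b, f (M.mate .black b) = M'.mate .black (f b) →
      f (M.mate .black (M.mate .green b)) = M'.mate .black (f (M.mate .green b)) →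
      ∀ y, l y = l b → f (M.mate .black y) = M'.mate .black (f y) := by
    intro b hb hgb y hy
    rcases hl.fiber hy with rfl | rfl | rfl | rfl
    · exact hb
    · exact pr _ hb
    · exact hgb
    · exact pr _ hgb
  refine ⟨f, fun c b => ?_, hf⟩
  cases c
  · exact hr b
  · exact hg b
  · rcases cases (l b) with h | h | h
    · exact all _ p1 p2 b h
    · exact all _ (pb _ p1) p3 b h
    · exact all _ (pb _ p2) p4 b h

/-- If some vertex has degree three, then all three edges form a cut, and the dual map is a
triangle. -/
theorem isoOver_of_card_eq_three [Fintype V] (hl : M.IsLabelling l) (hl' : M'.IsLabelling l')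
    (hL : M.labelSpace l = M'.labelSpace l')
    (h1 : NoLoopColoop (cuts (M.labelSpace l))) (h2 : NoLoopColoop (cuts (M.swap.labelSpace l)))
    (h1' : NoLoopColoop (cuts (M'.labelSpace l')))
    (h2' : NoLoopColoop (cuts (M'.swap.labelSpace l'))) : IsoOver M M' l l' := by
  have := Fintype.ofFinite E
  by_cases h : (1 : E → ZMod 2) ∈ cuts (M.labelSpace l)
  · have hL' : M.swap.labelSpace l = M'.swap.labelSpace l' := by
      ext p
      rw [mem_labelSpace_swap, mem_labelSpace_swap, hL]
    obtain ⟨f, hf, hfl⟩ := isoOver_of_one_notMem hn hl.swap hl'.swap hL' h2 h1 h2' h1' fun h' => by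
      rw [cuts_swap] at h'
      -- three is odd
      have := hl.isotropic h h'
      simp only [LinearMap.inr_apply, LinearMap.inl_apply, Pi.zero_apply, Pi.one_apply, mul_zero,
        mul_one, zero_add, Finset.sum_const, Finset.card_univ, ← Nat.card_eq_fintype_card,
        hn] at this
      revert this
      decide
    refine ⟨f, fun c a => ?_, hfl⟩
    cases c
    · exact hf .green a
    · exact hf .red a
    · exact hf .black a
  · exact isoOver_of_one_notMem hn hl hl' hL h1 h2 h1' h2' h

end three

end IsLabelling

end CombinatorialMap

/-! ### Isomorphisms of Δ-matroids -/

namespace CombinatorialMap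

/-- With at least four edges the connectivity of the lower matroid suffices. With two or three edges
it only concerns the vertices, and that of the upper matroid gives the same information on the
faces. -/
theorem isoOver_of_isNConnected {V V' : Type*} [Finite V] [Finite V'] (M : CombinatorialMap V)
    (M' : CombinatorialMap V') (hl : M.deltaMatroid.lowerMatroid.IsNConnected 3)
    (hu : M.deltaMatroid.upperMatroid.IsNConnected 3)
    (φ : M.deltaMatroid.Iso M'.deltaMatroid) :
    IsoOver M M' M.quad fun x => φ.toEquiv.symm (M'.quad x) := by
  have := Fintype.ofFinite V
  have := Fintype.ofFinite V'
  have := Fintype.ofFinite M.Edge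
  have hM := M.isLabelling_quad
  have hM' : M'.IsLabelling fun x => φ.toEquiv.symm (M'.quad x) := by
    refine ⟨φ.toEquiv.symm.surjective.comp M'.quad_surj, fun a => ?_, fun a => ?_, fun h => ?_⟩
    · simp only [M'.quad_red]
    · simp only [M'.quad_green]
    · exact M'.quad_eq (φ.toEquiv.symm.injective h)
  have hfeas : ∀ F, M.deltaMatroid.Feasible F ↔ M.IsFeasibleLabel M.quad F := fun F =>
    M.isFeasible_iff_isFeasibleLabel fun a => Iff.rfl
  have hfeas' : ∀ F, M.deltaMatroid.Feasible F ↔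
      M'.IsFeasibleLabel (fun x => φ.toEquiv.symm (M'.quad x)) F := fun F => by
    rw [φ.feasible_iff]
    refine M'.isFeasible_iff_isFeasibleLabel fun a => ?_
    rw [Equiv.image_eq_preimage_symm, Set.mem_preimage]
  obtain ⟨F, hF⟩ := M.deltaMatroid.exists_feasible
  have hex : ∃ F, M.IsFeasibleLabel M.quad F := ⟨F, (hfeas F).1 hF⟩
  have hL : M.labelSpace M.quad = M'.labelSpace fun x => φ.toEquiv.symm (M'.quad x) :=
    hM.labelSpace_eq hM' (fun F => (hfeas F).symm.trans (hfeas' F)) hex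
  have hT : ∀ F, M.deltaMatroid.Feasible F ↔ IsTransversal (M.labelSpace M.quad) F := fun F => by
    rw [hfeas, hM.isFeasibleLabel_iff]; rfl
  have hLag : ∀ F, M.deltaMatroid.Feasible F → IsLagrangianAt (M.labelSpace M.quad) F :=
    fun F hF => hM.isLagrangianAt ((hfeas F).1 hF)
  have hlow := DeltaMatroid.represents_lowerMatroid hT hLag
  have hupp := DeltaMatroid.represents_upperMatroid hT hLag
  by_cases h4 : 4 ≤ Nat.card M.Edge
  · have h1 := hlow.noLoopColoop rfl hl (by omega)
    have h2 := hlow.hasNoTwoSeparation rfl hl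
    exact (hM.isThreeConnected h1 h2 h4).exists_equiv
      (hM'.isThreeConnected (hL ▸ h1) (hL ▸ h2) h4) hL
  have hpos : 0 < Nat.card M.Edge := by
    obtain ⟨a⟩ := M.connected.nonempty
    have : Nonempty M.Edge := ⟨M.quad a⟩
    exact Nat.card_pos
  by_cases h1 : Nat.card M.Edge = 1
  · exact hM.isoOver_of_card_eq_one hM' hL hex h1
  have n1 := hlow.noLoopColoop rfl hl (by omega)
  have n2 : NoLoopColoop (cuts (M.swap.labelSpace M.quad)) := by
    rw [cuts_swap]
    exact hM.noLoopColoop_dual (hupp.noLoopColoop rfl hu (by omega))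
  have n1' := hL ▸ n1
  have n2' : NoLoopColoop (cuts (M'.swap.labelSpace fun x => φ.toEquiv.symm (M'.quad x))) := by
    rw [cuts_swap, ← hL, ← cuts_swap]
    exact n2
  by_cases h2 : Nat.card M.Edge = 2
  · exact hM.isoOver_of_card_eq_two hM' n1 n2 n1' n2' h2
  · exact IsLabelling.isoOver_of_card_eq_three (by omega) hM hM' hL n1 n2 n1' n2'

end CombinatorialMap

theorem theorem2p3 {V V' : Type*} [Finite V] [Finite V']
    (M : CombinatorialMap V) (M' : CombinatorialMap V')
    (hl : M.deltaMatroid.lowerMatroid.IsNConnected 3)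
    (hu : M.deltaMatroid.upperMatroid.IsNConnected 3)
    (φ : M.deltaMatroid.Iso M'.deltaMatroid) :
    ∃ f : M.Iso M', ∀ v, M'.quad (f.toEquiv v) = φ.toEquiv (M.quad v) := by
  obtain ⟨f, hf, hfl⟩ := CombinatorialMap.isoOver_of_isNConnected M M' hl hu φ
  exact ⟨⟨f, hf⟩, fun v => by rw [← hfl v, Equiv.apply_symm_apply]⟩
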